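/- **Setting.** Let $X$ be a Hausdorff smooth manifold of dimension $n+1$ ($n\ge 0$), possibly with boundary, and let $\pi:Y\to X$ be a fibred manifold with $m$-dimensional fibres ($Y$ Hausdorff, $\pi$ surjective; around every point of $Y$ there are fibred coordinates $(x^\mu,y^i)$ in which $\pi$ is $(x,y)\mapsto x$, so that $\partial Y=\pi^{-1}(\partial X)$). *Lagrangian side.* Let $\eta$ be a volume form on $X$, and let $Z=J^1\pi$ be the first jet bundle, with coordinates $(x^\mu,y^i,z^i_\mu)$, whose points over $y$ are the linear sections $A:T_{\pi(y)}X\to T_yY$ of $T_y\pi$, with projections $\pi_{YZ}:Z\to Y$ and $\pi_{XZ}:Z\to X$. The vertical endomorphism is the $TZ$-valued $(n+1)$-form $$(S_\eta)_z(V_0,\dots,V_n)=\sum_{i=0}^n(\eta_i\otimes w_i)^v,$$ where, for $z=(y,A)$, $w_i=T\pi_{YZ}V_i-A(T\pi_{XZ}V_i)$, $\eta_i(u)=\eta(T\pi_{XZ}V_0,\dots,u,\dots,T\pi_{XZ}V_n)$ with $u$ in the $i$-th place, and $f^v=\frac{d}{dt}(z+tf)|_{t=0}$. In coordinates with $\eta=dx^0\wedge\dots\wedge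 dx^n$, $S_\eta=(dy^i-z^i_\mu dx^\mu)\wedge d^nx_\nu\otimes\partial/\partial z^i_\nu$ with $d^nx_\nu=\iota_{\partial/\partial x^\nu}\eta$. For a smooth function $L:Z\to\mathbb R$ put $\Theta_L=L\,\pi_{XZ}^*\eta+S_\eta^*(dL)$ and $\Omega_L=-d\Theta_L$. *Hamiltonian side.* Let $\Lambda^{n+1}_rY$ be the bundle of $(n+1)$-forms on $Y$ annihilated by any $r$ $\pi$-vertical vectors, $Z^*=\Lambda^{n+1}_2Y/\Lambda^{n+1}_1Y$, with projections $\nu_2:\Lambda^{n+1}_2Y\to Y$, $\mu:\Lambda^{n+1}_2Y\to Z^*$ and $\pi_{XZ^*}:Z^*\to X$, and let $\Theta$ be the Liouville form $\Theta_\omega(V_0,\dots,V_n)=\omega(T\nu_2V_0,\dots,T\nu_2V_n)$ on $\Lambda^{n+1}_2Y$. For a smooth section $h$ of $\mu$ put $\Theta_h=h^*\Theta$ and $\Omega_h=-d\Theta_h$. *Equations, symmetries, flows.* Let $(M,p,\Theta_M)$ be either $(Z,\pi_{XZ},\Theta_L)$ or $(Z^*,\pi_{XZ^*},\Theta_h)$,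 and $\Omega_M=-d\Theta_M$. A boundary condition consists of an embedded submanifold (without boundary) $i_B:B\hookrightarrow M$ which $p$ maps by a submersion onto $\partial X$, and a smooth $n$-form $\Pi$ on $B$ with $i_B^*\Theta_M=d\Pi$. A *solution* (of the De Donder equations if $M=Z$, of Hamilton's equations if $M=Z^*$) over an open set $U\subseteq X$ is a smooth section $\sigma:U\to M$ of $p$ with $\sigma^*(\iota_\zeta\Omega_M)=0$ for all smooth vector fields $\zeta$ on $M$ (the *field equations*), and $\sigma(U\cap\partial X)\subseteq B$ (the *boundary condition*). A *Cartan symmetry* is a smooth vector field $\xi$ on $M$ such that $\pounds_\xi\Theta_M=d\alpha$ for some smooth $n$-form $\alpha$ on $M$ with $i_B^*\alpha$ exact (zero if $n=0$), $\xi$ is tangent to $B$, and $\pounds_{\xi|_B}\Pi=0$. A *flow* of $\xi$ is a smooth map $(t,z)\mapsto\phi_t(z)\in M$ on an open set $D\subseteq\mathbb R\times M$, where $(t,z)\in D$ implies $(s,z)\in D$ for all $s$ between $0$ and $t$, such that $\phi_0(z)=z$ and $\frac{d}{dt}\phi_t(z)=\xi(\phi_t(z))$. **Theorem.** In both cases,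 let $\xi$ be a Cartan symmetry with flow $\phi$ on $D$, let $\sigma$ be a solution over an open set $U\subseteq X$, and let $\psi_t=p\circ\phi_t\circ\sigma$. 1. For every $t$, if $\psi_t$ is defined on an open set $V\subseteq U$ and is a diffeomorphism of $V$ onto an open set $V'\subseteq X$, then $\phi_t\circ\sigma\circ\psi_t^{-1}$ is a smooth section of $p$ over $V'$ which satisfies the field equations; if $B$ is closed in $M$, it also satisfies the boundary condition, so it is a solution over $V'$. 2. For every $x_0\in U$ with $(0,\sigma(x_0))\in D$ there are $\varepsilon>0$ and an open neighbourhood $W\subseteq U$ of $x_0$ such that for all $|t|<\varepsilon$ the map $\psi_t$ is defined on $W$, is a diffeomorphism of $W$ onto an open set $\psi_t(W)\subseteq X$, and $\phi_t\circ\sigma\circ\psi_t^{-1}$ is a solution over $\psi_t(W)$, including the boundary condition. That is, the flow of Cartan symmetries maps solutions of the De Donder equations to solutions of the De Donder equations, and solutions of Hamilton's equations to solutions of Hamilton's equations. -/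

import Mathlib

open Set Manifold
open scoped ContDiff Topology

noncomputable section

namespace FieldTheory
section Transition

variable {E : Type*} [NormedAddCommGroup E] [NormedSpace ℝ E] {H : Type*} [TopologicalSpace H]
  {I : ModelWithCorners ℝ E H} {M : Type*} [TopologicalSpace M] [ChartedSpace H M]

theorem mdiff_of_mem {e : OpenPartialHomeomorph M H} (he : e ∈ IsManifold.maximalAtlas I ∞ M) :
    e.MDifferentiable I I :=
  ⟨(contMDiffOn_of_mem_maximalAtlas he).mdifferentiableOn (by simp),
    (contMDiffOn_symm_of_mem_maximalAtlas he).mdifferentiableOn (by simp)⟩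

/-- The differential of a chart, as an isomorphism onto the model vector space. -/
def chartDeriv {e : OpenPartialHomeomorph M H} (he : e ∈ IsManifold.maximalAtlas I ∞ M)
    {x : M} (hx : x ∈ e.source) : TangentSpace I x ≃L[ℝ] E :=
  (mdiff_of_mem he).mfderiv hx

theorem chartDeriv_coe {e : OpenPartialHomeomorph M H} (he : e ∈ IsManifold.maximalAtlas I ∞ M)
    {x : M} (hx : x ∈ e.source) :
    (chartDeriv he hx : TangentSpace I x →L[ℝ] E) = mfderiv I I e x := rfl

theorem chartDeriv_transition {e e' : OpenPartialHomeomorph M H}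
    (he : e ∈ IsManifold.maximalAtlas I ∞ M) (he' : e' ∈ IsManifold.maximalAtlas I ∞ M)
    {x : M} (hx : x ∈ e.source) (hx' : x ∈ e'.source) :
    ((chartDeriv he' hx' : TangentSpace I x →L[ℝ] E).comp
      ((chartDeriv he hx).symm : E →L[ℝ] TangentSpace I x)) =
      fderivWithin ℝ (e'.extend I ∘ (e.extend I).symm) (range I) (e.extend I x) := by
  have h1 : mfderiv I I (e' ∘ e.symm) (e x) =
      (mfderiv I I e' x).comp (mfderiv I I e.symm (e x)) := by
    have h2 := mfderiv_comp (I := I) (I' := I) (I'' := I) (e x) (f := e.symm) (g := e')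
      (by rw [e.left_inv hx]; exact (mdiff_of_mem he').mdifferentiableAt hx')
      ((mdiff_of_mem he).mdifferentiableAt_symm (e.map_source hx))
    rw [h2]
    congr 1
    rw [e.left_inv hx]
  have h3 : ((chartDeriv he' hx' : TangentSpace I x →L[ℝ] E).comp
      ((chartDeriv he hx).symm : E →L[ℝ] TangentSpace I x)) =
      mfderiv I I (e' ∘ e.symm) (e x) := by rw [h1]; rfl
  have hm : MDifferentiableAt I I (e' ∘ e.symm) (e x) :=
    MDifferentiableAt.comp _ ((mdiff_of_mem he').mdifferentiableAt (x := e.symm (e x))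
      (by rwa [e.left_inv hx])) ((mdiff_of_mem he).mdifferentiableAt_symm (e.map_source hx))
  refine h3.trans (hm.mfderiv.trans ?_)
  simp only [mfld_simps]
  rfl

theorem contMDiffOn_transition {e e' : OpenPartialHomeomorph M H}
    (he : e ∈ IsManifold.maximalAtlas I ∞ M) (he' : e' ∈ IsManifold.maximalAtlas I ∞ M) :
    ContMDiffOn I 𝓘(ℝ, E →L[ℝ] E) ∞
      (fun x => fderivWithin ℝ (e'.extend I ∘ (e.extend I).symm) (range I) (e.extend I x))
      (e.source ∩ e'.source) := by
  have h : ContDiffOn ℝ ∞ (fderivWithin ℝ (e'.extend I ∘ (e.extend I).symm) (range I))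
      ((e.extend I).symm ≫ e'.extend I).source := by
    have h : ((e.extend I).symm ≫ e'.extend I).source ⊆ range I := by
      refine I.extendCoordChange_source.trans_subset ?_; apply image_subset_range
    intro x hx
    refine (ContDiffWithinAt.fderivWithin_right ?_ I.uniqueDiffOn le_rfl
      <| h hx).mono h
    refine (I.contDiffOn_extendCoordChange (n := ∞) he he' x hx).mono_of_mem_nhdsWithin ?_
    exact I.extendCoordChange_source_mem_nhdsWithin hx
  refine h.contMDiffOn.comp ((e.contMDiffOn_extend he).mono inter_subset_left) ?_
  intro x hx
  simp [hx.1, hx.2, e.left_inv hx.1]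

end Transition

section Forms

variable {E : Type*} [NormedAddCommGroup E] [NormedSpace ℝ E] {H : Type*} [TopologicalSpace H]
  (I : ModelWithCorners ℝ E H) (M : Type*) [TopologicalSpace M] [ChartedSpace H M]
  {E' : Type*} [NormedAddCommGroup E'] [NormedSpace ℝ E'] {H' : Type*} [TopologicalSpace H']
  {I' : ModelWithCorners ℝ E' H'} {M' : Type*} [TopologicalSpace M'] [ChartedSpace H' M']

/-- Differential `k`-forms on `M` (no regularity imposed). -/
abbrev DForm (k : ℕ) := (x : M) → TangentSpace I x [⋀^Fin k]→L[ℝ] ℝ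

/-- Vector fields on `M` (no regularity imposed). -/
abbrev VField := (x : M) → TangentSpace I x

variable {I M} {k : ℕ}

/-- The expression of the form `θ` in the preferred chart around `x₀`. -/
def DForm.inChart (θ : DForm I M k) (x₀ : M) (u : E) : E [⋀^Fin k]→L[ℝ] ℝ :=
  (θ ((extChartAt I x₀).symm u)).compContinuousLinearMap
    (mfderivWithin 𝓘(ℝ, E) I (extChartAt I x₀).symm (range I) u)

/-- Smooth (`C^∞`, up to the boundary) differential forms. -/
def DForm.IsSmooth (θ : DForm I M k) : Prop :=
  ∀ x₀ : M, ContDiffOn ℝ ∞ (θ.inChart x₀) (extChartAt I x₀).target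

/-- The exterior derivative. -/
def DForm.d (θ : DForm I M k) : DForm I M (k + 1) := fun x =>
  (extDerivWithin (θ.inChart x) (range I) (extChartAt I x x)).compContinuousLinearMap
    (mfderiv I 𝓘(ℝ, E) (extChartAt I x) x)

/-- The interior product `ι_ξ θ`, i.e. `θ` with `ξ` inserted in the first slot. -/
def DForm.interior (ξ : VField I M) (θ : DForm I M (k + 1)) : DForm I M k := fun x =>
  ContinuousAlternatingMap.curryLeft (E := E) (θ x) (ξ x)

/-- The Lie derivative of a form along a vector field, `£_ξ θ = ι_ξ dθ + d ι_ξ θ`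
(with `ι_ξ θ = 0` if `θ` is a function). -/
def DForm.lieDeriv (ξ : VField I M) : {k : ℕ} → DForm I M k → DForm I M k
  | 0, θ => DForm.interior ξ θ.d
  | _ + 1, θ => DForm.interior ξ θ.d + (DForm.interior ξ θ).d

/-- The pullback `f^* θ`. -/
def DForm.pullback (f : M → M') (θ : DForm I' M' k) : DForm I M k := fun x =>
  (θ (f x)).compContinuousLinearMap (mfderiv I I' f x)

/-- Exact forms; a `0`-form is exact only if it vanishes. -/
def DForm.IsExact : {k : ℕ} → DForm I M k → Prop
  | 0, θ => θ = 0
  | _ + 1, θ => ∃ β : DForm I M _, β.IsSmooth ∧ θ = β.d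

/-- Smooth vector fields. -/
def VField.IsSmooth [IsManifold I 1 M] (ξ : VField I M) : Prop :=
  ContMDiff I I.tangent ∞ (fun x => (⟨x, ξ x⟩ : TangentBundle I M))

theorem interior_apply (ξ : VField I M) (θ : DForm I M (k + 1)) (x : M)
    (v : Fin k → TangentSpace I x) : θ.interior ξ x v = θ x (Matrix.vecCons (ξ x) v) := rfl

end Forms
section FibreAtlas

variable {E : Type*} [NormedAddCommGroup E] [NormedSpace ℝ E] {H : Type*} [TopologicalSpace H]
  (I : ModelWithCorners ℝ E H) {Y : Type*} [TopologicalSpace Y] [ChartedSpace H Y]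
  (G : Type*) [NormedAddCommGroup G] [NormedSpace ℝ G] (P : Y → Type*)

/-- Data turning the disjoint union of the fibres `P y`, `y : Y`, into a smooth manifold: charts of
`Y` and, over each of them, fibre coordinates with values in `G` which change smoothly. -/
structure FibreAtlas where
  ι : Type*
  chart : ι → OpenPartialHomeomorph Y H
  chart_mem : ∀ i, chart i ∈ IsManifold.maximalAtlas I ∞ Y
  index : Y → ι
  mem_index : ∀ y, y ∈ (chart (index y)).source
  coord : ∀ i y, y ∈ (chart i).source → P y ≃ G
  smooth : ∀ i j, ∃ f : Y × G → G,
    ContMDiffOn (I.prod 𝓘(ℝ, G)) 𝓘(ℝ, G) ∞ f (((chart i).source ∩ (chart j).source) ×ˢ univ) ∧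
      ∀ y hi hj g, coord j y hj ((coord i y hi).symm g) = f (y, g)

namespace FibreAtlas

variable {I G P} (A : FibreAtlas I G P)

open Classical in
/-- The coordinates `(y, p) ↦ (chart i y, coord i y p)` on the total space. -/
def totalMap (i : A.ι) (z : Σ y, P y) : ModelProd H G :=
  (A.chart i z.1, if h : z.1 ∈ (A.chart i).source then A.coord i z.1 h z.2 else 0)

open Classical in
/-- The inverse of `totalMap`; `z₀` is a junk value. -/
def totalInv (z₀ : Σ y, P y) (i : A.ι) (q : ModelProd H G) : Σ y, P y :=
  if h : q.1 ∈ (A.chart i).target then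
    ⟨(A.chart i).symm q.1, (A.coord i _ ((A.chart i).map_target h)).symm q.2⟩ else z₀

theorem totalMap_of_mem {i : A.ι} {z : Σ y, P y} (h : z.1 ∈ (A.chart i).source) :
    A.totalMap i z = (A.chart i z.1, A.coord i z.1 h z.2) := by
  rw [totalMap, dif_pos h]

theorem totalInv_of_mem (z₀ : Σ y, P y) {i : A.ι} {q : ModelProd H G}
    (h : q.1 ∈ (A.chart i).target) : A.totalInv z₀ i q =
      ⟨(A.chart i).symm q.1, (A.coord i _ ((A.chart i).map_target h)).symm q.2⟩ := by
  rw [totalInv, dif_pos h]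

/-- The chart of the total space over `chart i`. -/
def totalChart (z₀ : Σ y, P y) (i : A.ι) : PartialEquiv (Σ y, P y) (ModelProd H G) where
  toFun := A.totalMap i
  invFun := A.totalInv z₀ i
  source := {z | z.1 ∈ (A.chart i).source}
  target := {q | q.1 ∈ (A.chart i).target}
  map_source' _ hz := (A.chart i).map_source hz
  map_target' q hq := by
    rw [A.totalInv_of_mem z₀ hq]
    exact (A.chart i).map_target hq
  left_inv' z hz := by
    have hz' : z.1 ∈ (A.chart i).source := hz
    have ht : (A.totalMap i z).1 ∈ (A.chart i).target := (A.chart i).map_source hz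
    have key : ∀ y' (hy' : y' ∈ (A.chart i).source) (_ : y' = z.1) (g : G)
        (_ : g = A.coord i z.1 hz' z.2),
        (⟨y', (A.coord i y' hy').symm g⟩ : Σ y, P y) = z := by
      rintro y' hy' rfl g rfl
      simp
    rw [A.totalInv_of_mem z₀ ht]
    exact key _ _ ((A.chart i).left_inv hz) _ (by rw [A.totalMap_of_mem hz'])
  right_inv' q hq := by
    have hs := (A.chart i).map_target hq
    rw [A.totalInv_of_mem z₀ hq, A.totalMap_of_mem hs]
    simp only [Equiv.apply_symm_apply]
    rw [(A.chart i).right_inv hq]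
    rfl

theorem totalChart_trans_source (z₀ z₁ : Σ y, P y) (i j : A.ι) :
    ((A.totalChart z₀ i).symm.trans (A.totalChart z₁ j)).source =
      {q | q.1 ∈ (A.chart i).target ∧ (A.chart i).symm q.1 ∈ (A.chart j).source} := by
  ext q
  refine and_congr_right fun (hq : q.1 ∈ (A.chart i).target) => ?_
  change (A.totalInv z₀ i q).1 ∈ (A.chart j).source ↔ (A.chart i).symm q.1 ∈ (A.chart j).source
  rw [A.totalInv_of_mem z₀ hq]

theorem isOpen_totalChart_trans_source (z₀ z₁ : Σ y, P y) (i j : A.ι) :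
    IsOpen ((A.totalChart z₀ i).symm.trans (A.totalChart z₁ j)).source := by
  rw [totalChart_trans_source]
  exact ((A.chart i).symm.trans (A.chart j)).open_source.preimage continuous_fst

theorem contMDiffOn_totalChart_trans (z₀ z₁ : Σ y, P y) (i j : A.ι) :
    ContMDiffOn (I.prod 𝓘(ℝ, G)) (I.prod 𝓘(ℝ, G)) ∞
      ((A.totalChart z₀ i).symm.trans (A.totalChart z₁ j))
      ((A.totalChart z₀ i).symm.trans (A.totalChart z₁ j)).source := by
  obtain ⟨f, hf, hfeq⟩ := A.smooth i j
  rw [totalChart_trans_source]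
  set S : Set (ModelProd H G) :=
    {q | q.1 ∈ (A.chart i).target ∧ (A.chart i).symm q.1 ∈ (A.chart j).source} with hS
  have h1 : ContMDiffOn (I.prod 𝓘(ℝ, G)) I ∞ (fun q : H × G => (A.chart i).symm q.1) S :=
    (contMDiffOn_symm_of_mem_maximalAtlas (A.chart_mem i)).comp contMDiff_fst.contMDiffOn
      (fun q hq => hq.1)
  have h2 : ContMDiffOn (I.prod 𝓘(ℝ, G)) I ∞
      (fun q : H × G => A.chart j ((A.chart i).symm q.1)) S :=
    (contMDiffOn_of_mem_maximalAtlas (A.chart_mem j)).comp h1 (fun q hq => hq.2)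
  have h3 : ContMDiffOn (I.prod 𝓘(ℝ, G)) 𝓘(ℝ, G) ∞
      (fun q : H × G => f ((A.chart i).symm q.1, q.2)) S :=
    hf.comp (h1.prodMk contMDiff_snd.contMDiffOn)
      (fun q hq => ⟨⟨(A.chart i).map_target hq.1, hq.2⟩, mem_univ _⟩)
  have h4 := h2.prodMk h3
  rw [chartedSpaceSelf_prod] at h4
  refine ContMDiffOn.congr h4 ?_
  rintro q ⟨hq, hq'⟩
  change A.totalMap j (A.totalInv z₀ i q) = _
  rw [A.totalInv_of_mem z₀ hq, A.totalMap_of_mem hq', hfeq]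

/-- The smooth atlas of the total space. -/
def core : ChartedSpaceCore (ModelProd H G) (Σ y, P y) where
  atlas := {e | ∃ z₀ i, e = A.totalChart z₀ i}
  chartAt z := A.totalChart z (A.index z.1)
  mem_chart_source z := A.mem_index z.1
  chart_mem_atlas z := ⟨z, A.index z.1, rfl⟩
  open_source := by
    rintro _ _ ⟨z₀, i, rfl⟩ ⟨z₁, j, rfl⟩
    exact A.isOpen_totalChart_trans_source z₀ z₁ i j
  continuousOn_toFun := by
    rintro _ _ ⟨z₀, i, rfl⟩ ⟨z₁, j, rfl⟩
    exact (A.contMDiffOn_totalChart_trans z₀ z₁ i j).continuousOn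

theorem isManifold :
    letI := A.core.toTopologicalSpace
    letI := A.core.toChartedSpace
    IsManifold (I.prod 𝓘(ℝ, G)) ∞ (Σ y, P y) := by
  let _ := A.core.toTopologicalSpace
  let _ := A.core.toChartedSpace
  refine isManifold_of_contDiffOn _ _ _ fun e e' he he' => ?_
  have he1 : ∃ z₀ i, e.toPartialEquiv = A.totalChart z₀ i := by
    change e ∈ ⋃ (e : PartialEquiv _ _) (he : e ∈ A.core.atlas), _ at he
    simp only [mem_iUnion, mem_singleton_iff] at he
    obtain ⟨e₀, ⟨z₀, i, rfl⟩, rfl⟩ := he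
    exact ⟨z₀, i, rfl⟩
  have he2 : ∃ z₀ i, e'.toPartialEquiv = A.totalChart z₀ i := by
    change e' ∈ ⋃ (e : PartialEquiv _ _) (he : e ∈ A.core.atlas), _ at he'
    simp only [mem_iUnion, mem_singleton_iff] at he'
    obtain ⟨e₀, ⟨z₀, i, rfl⟩, rfl⟩ := he'
    exact ⟨z₀, i, rfl⟩
  obtain ⟨z₀, i, hi⟩ := he1
  obtain ⟨z₁, j, hj⟩ := he2
  have key := A.contMDiffOn_totalChart_trans z₀ z₁ i j
  rw [← hi, ← hj] at key
  rw [← contMDiffOn_iff_contDiffOn]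
  refine (I.prod 𝓘(ℝ, G)).contMDiff.comp_contMDiffOn
    (ContMDiffOn.comp key ((I.prod 𝓘(ℝ, G)).contMDiffOn_symm.mono inter_subset_right) ?_)
  exact fun x hx => hx.1

end FibreAtlas
end FibreAtlas
section Fibration

/-- The model of the base: `(n + 1)`-dimensional manifolds, possibly with boundary. -/
abbrev baseModel (n : ℕ) :
    ModelWithCorners ℝ (EuclideanSpace ℝ (Fin (n + 1))) (EuclideanHalfSpace (n + 1)) :=
  𝓡∂ (n + 1)

abbrev TotalSpaceModel (n m : ℕ) : Type :=
  ModelProd (EuclideanHalfSpace (n + 1)) (EuclideanSpace ℝ (Fin m))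

abbrev TotalVectorModel (n m : ℕ) : Type :=
  EuclideanSpace ℝ (Fin (n + 1)) × EuclideanSpace ℝ (Fin m)

/-- The model of the total space: `(n + 1 + m)`-dimensional manifolds, possibly with boundary. -/
abbrev totalModel (n m : ℕ) :
    ModelWithCorners ℝ (TotalVectorModel n m) (TotalSpaceModel n m) :=
  (𝓡∂ (n + 1)).prod (𝓡 m)

variable (n m : ℕ)
  (X : Type*) [TopologicalSpace X] [ChartedSpace (EuclideanHalfSpace (n + 1)) X]
  (Y : Type*) [TopologicalSpace Y] [ChartedSpace (TotalSpaceModel n m) Y]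

/-- A fibration (fibred manifold) `π : Y → X` with `m`-dimensional fibres: a surjective map
such that around each point of `Y` there are fibred coordinates `(x^μ, y^i)`, i.e. a smooth
chart of `Y` and a smooth chart of `X` in which `π` is the projection `(x, y) ↦ x`.
In particular `∂Y` is the preimage of `∂X`. -/
structure Fibration where
  toFun : Y → X
  surjective : Function.Surjective toFun
  exists_chart : ∀ y : Y, ∃ e ∈ IsManifold.maximalAtlas (totalModel n m) ∞ Y,
    ∃ c ∈ IsManifold.maximalAtlas (baseModel n) ∞ X,
      y ∈ e.source ∧ ∀ y' ∈ e.source, toFun y' ∈ c.source ∧ (e y').1 = c (toFun y')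

variable {n m X Y}

theorem hasMFDerivAt_modelFst (p : TotalSpaceModel n m) :
    HasMFDerivAt (totalModel n m) (baseModel n) (fun q : TotalSpaceModel n m => q.1) p
      (ContinuousLinearMap.fst ℝ (EuclideanSpace ℝ (Fin (n + 1))) (EuclideanSpace ℝ (Fin m))) := by
  have h3 : HasMFDerivAt (totalModel n m) (baseModel n)
      (fun p : EuclideanHalfSpace (n + 1) × EuclideanSpace ℝ (Fin m) => p.1) p
      (ContinuousLinearMap.fst ℝ (EuclideanSpace ℝ (Fin (n + 1))) (EuclideanSpace ℝ (Fin m))) :=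
    hasMFDerivAt_fst _
  rw [chartedSpaceSelf_prod] at h3
  exact h3

/-- A fibred chart: a chart `tot` of `Y` over a chart `base` of `X`. -/
structure FibredChart (π : Fibration n m X Y) where
  tot : OpenPartialHomeomorph Y (TotalSpaceModel n m)
  base : OpenPartialHomeomorph X (EuclideanHalfSpace (n + 1))
  tot_mem : tot ∈ IsManifold.maximalAtlas (totalModel n m) ∞ Y
  base_mem : base ∈ IsManifold.maximalAtlas (baseModel n) ∞ X
  maps_source : ∀ y ∈ tot.source, π.toFun y ∈ base.source
  fst_tot : ∀ y ∈ tot.source, (tot y).1 = base (π.toFun y)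

variable (π : Fibration n m X Y)

namespace Fibration

theorem exists_fibredChart (y : Y) : ∃ c : FibredChart π, y ∈ c.tot.source := by
  obtain ⟨e, he, c, hc, hy, h⟩ := π.exists_chart y
  exact ⟨⟨e, c, he, hc, fun y' hy' => (h y' hy').1, fun y' hy' => (h y' hy').2⟩, hy⟩

/-- A chosen fibred chart around `y`. -/
def chartAround (y : Y) : FibredChart π := (π.exists_fibredChart y).choose

theorem mem_chartAround (y : Y) : y ∈ (π.chartAround y).tot.source :=
  (π.exists_fibredChart y).choose_spec

/-- The differential `T_y π`. -/
abbrev deriv (y : Y) : TangentSpace (totalModel n m) y →L[ℝ]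
    TangentSpace (baseModel n) (π.toFun y) :=
  mfderiv (totalModel n m) (baseModel n) π.toFun y

end Fibration

namespace FibredChart

variable {π} (c : FibredChart π)

/-- The differential of the chart of `Y`, in coordinates `T_y Y ≃ ℝ^{n+1} × ℝ^m`. -/
def dtot {y : Y} (hy : y ∈ c.tot.source) :
    TangentSpace (totalModel n m) y ≃L[ℝ] TotalVectorModel n m :=
  chartDeriv c.tot_mem hy

/-- The differential of the chart of `X` at `π y`. -/
def dbase {y : Y} (hy : y ∈ c.tot.source) :
    TangentSpace (baseModel n) (π.toFun y) ≃L[ℝ] EuclideanSpace ℝ (Fin (n + 1)) :=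
  chartDeriv c.base_mem (c.maps_source y hy)

theorem contMDiffOn_proj : ContMDiffOn (totalModel n m) (baseModel n) ∞ π.toFun c.tot.source := by
  have h1 : ContMDiffOn (totalModel n m) (baseModel n) ∞
      (fun y => c.base.symm (c.tot y).1) c.tot.source := by
    refine (contMDiffOn_symm_of_mem_maximalAtlas c.base_mem).comp (t := c.base.target)
      (f := fun y => (c.tot y).1) ?_ ?_
    · have h2 := contMDiffOn_of_mem_maximalAtlas (n := ∞) c.tot_mem
      have h3 : ContMDiff (totalModel n m) (baseModel n) ∞
          (fun p : EuclideanHalfSpace (n + 1) × EuclideanSpace ℝ (Fin m) => p.1) :=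
        contMDiff_fst
      rw [chartedSpaceSelf_prod] at h3
      exact ContMDiff.comp_contMDiffOn h3 h2
    · intro y hy
      simp only [mem_preimage]
      rw [c.fst_tot y hy]
      exact c.base.map_source (c.maps_source y hy)
  refine h1.congr fun y hy => ?_
  rw [c.fst_tot y hy, c.base.left_inv (c.maps_source y hy)]

theorem dbase_deriv {y : Y} (hy : y ∈ c.tot.source) (v : TangentSpace (totalModel n m) y) :
    c.dbase hy (π.deriv y v) = (c.dtot hy v).1 := by
  have hπ : MDifferentiableAt (totalModel n m) (baseModel n) π.toFun y :=
    (c.contMDiffOn_proj.contMDiffAt (c.tot.open_source.mem_nhds hy)).mdifferentiableAt (by simp)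
  have hb := (mdiff_of_mem c.base_mem).mdifferentiableAt (c.maps_source y hy)
  have ht := (mdiff_of_mem c.tot_mem).mdifferentiableAt hy
  have h1 := mfderiv_comp y hb hπ
  have h2 := (HasMFDerivAt.comp y (hasMFDerivAt_modelFst (c.tot y)) ht.hasMFDerivAt).mfderiv
  have h4 : mfderiv (totalModel n m) (baseModel n) (c.base ∘ π.toFun) y =
      mfderiv (totalModel n m) (baseModel n)
        ((fun q : TotalSpaceModel n m => q.1) ∘ c.tot) y := by
    apply Filter.EventuallyEq.mfderiv_eq
    filter_upwards [c.tot.open_source.mem_nhds hy] with y' hy'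
    exact (c.fst_tot y' hy').symm
  have h5 := DFunLike.congr_fun (h1.symm.trans (h4.trans h2)) v
  exact h5

end FibredChart
end Fibration
section Jet

variable {n m : ℕ}
  {X : Type*} [TopologicalSpace X] [ChartedSpace (EuclideanHalfSpace (n + 1)) X]
  {Y : Type*} [TopologicalSpace Y] [ChartedSpace (TotalSpaceModel n m) Y]
  (π : Fibration n m X Y)

/-- The fibre over `y` of the first jet bundle: the linear sections of `T_y π`, i.e. the
differentials at `π y` of the local sections of `π` through `y`. -/
def JetFiber (y : Y) : Type :=
  {A : TangentSpace (baseModel n) (π.toFun y) →L[ℝ] TangentSpace (totalModel n m) y //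
    (π.deriv y).comp A = ContinuousLinearMap.id ℝ _}

/-- The coordinates `z^i_μ` on the fibre of the jet bundle given by a fibred chart. -/
def FibredChart.jetCoord {π : Fibration n m X Y} (c : FibredChart π) {y : Y}
    (hy : y ∈ c.tot.source) :
    JetFiber π y ≃ (EuclideanSpace ℝ (Fin (n + 1)) →L[ℝ] EuclideanSpace ℝ (Fin m)) where
  toFun A := (ContinuousLinearMap.snd ℝ _ _).comp
    ((c.dtot hy : _ →L[ℝ] TotalVectorModel n m).comp
      (A.1.comp ((c.dbase hy).symm : EuclideanSpace ℝ (Fin (n + 1)) →L[ℝ] _)))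
  invFun g := ⟨((c.dtot hy).symm : TotalVectorModel n m →L[ℝ] _).comp
    (((ContinuousLinearMap.id ℝ _).prod g).comp
      (c.dbase hy : _ →L[ℝ] EuclideanSpace ℝ (Fin (n + 1)))), by
    ext1 v
    apply (c.dbase hy).injective
    have := c.dbase_deriv hy ((c.dtot hy).symm (c.dbase hy v, g (c.dbase hy v)))
    rw [ContinuousLinearEquiv.apply_symm_apply] at this
    exact this⟩
  left_inv A := by
    apply Subtype.ext
    ext1 v
    apply (c.dtot hy).injective
    have h1 : π.deriv y (A.1 v) = v := DFunLike.congr_fun A.2 v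
    have h2 := c.dbase_deriv hy (A.1 v)
    rw [h1] at h2
    change c.dtot hy ((c.dtot hy).symm (c.dbase hy v,
      (c.dtot hy (A.1 ((c.dbase hy).symm (c.dbase hy v)))).2)) = c.dtot hy (A.1 v)
    rw [ContinuousLinearEquiv.apply_symm_apply, ContinuousLinearEquiv.symm_apply_apply, h2]
  right_inv g := by
    ext1 v
    change (c.dtot hy ((c.dtot hy).symm (c.dbase hy ((c.dbase hy).symm v),
      g (c.dbase hy ((c.dbase hy).symm v))))).2 = g v
    rw [ContinuousLinearEquiv.apply_symm_apply, ContinuousLinearEquiv.apply_symm_apply]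

/-- The smooth structure of the first jet bundle, with coordinates `(x^μ, y^i, z^i_μ)`. -/
def jetAtlas : FibreAtlas (totalModel n m)
    (EuclideanSpace ℝ (Fin (n + 1)) →L[ℝ] EuclideanSpace ℝ (Fin m)) (JetFiber π) where
  ι := FibredChart π
  chart c := c.tot
  chart_mem c := c.tot_mem
  index := π.chartAround
  mem_index := π.mem_chartAround
  coord c _ hy := c.jetCoord hy
  smooth c c' := by
    let T : Y → TotalVectorModel n m →L[ℝ] TotalVectorModel n m := fun y =>
      fderivWithin ℝ (c'.tot.extend (totalModel n m) ∘ (c.tot.extend (totalModel n m)).symm)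
        (range (totalModel n m)) (c.tot.extend (totalModel n m) y)
    let S : X → EuclideanSpace ℝ (Fin (n + 1)) →L[ℝ] EuclideanSpace ℝ (Fin (n + 1)) := fun x =>
      fderivWithin ℝ (c.base.extend (baseModel n) ∘ (c'.base.extend (baseModel n)).symm)
        (range (baseModel n)) (c'.base.extend (baseModel n) x)
    have hT : ContMDiffOn (totalModel n m) 𝓘(ℝ, _) ∞ T (c.tot.source ∩ c'.tot.source) :=
      contMDiffOn_transition c.tot_mem c'.tot_mem
    have hS : ContMDiffOn (totalModel n m) 𝓘(ℝ, _) ∞ (fun y => S (π.toFun y))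
        (c.tot.source ∩ c'.tot.source) :=
      (contMDiffOn_transition c'.base_mem c.base_mem).comp
        (c.contMDiffOn_proj.mono inter_subset_left)
        (fun y hy => ⟨c'.maps_source y hy.2, c.maps_source y hy.1⟩)
    refine ⟨fun p => (ContinuousLinearMap.snd ℝ _ _).comp ((T p.1).comp
      ((ContinuousLinearMap.inl ℝ _ _ + (ContinuousLinearMap.inr ℝ _ _).comp p.2).comp
        (S (π.toFun p.1)))), ?_, ?_⟩
    · have hfst : ContMDiffOn ((totalModel n m).prod 𝓘(ℝ, EuclideanSpace ℝ (Fin (n + 1)) →L[ℝ]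
          EuclideanSpace ℝ (Fin m))) (totalModel n m) ∞
          (fun p : Y × (EuclideanSpace ℝ (Fin (n + 1)) →L[ℝ] EuclideanSpace ℝ (Fin m)) => p.1)
          ((c.tot.source ∩ c'.tot.source) ×ˢ univ) := contMDiff_fst.contMDiffOn
      have hT' := hT.comp hfst (fun p hp => hp.1)
      have hS' := hS.comp hfst (fun p hp => hp.1)
      have hsnd : ContMDiffOn ((totalModel n m).prod 𝓘(ℝ, EuclideanSpace ℝ (Fin (n + 1)) →L[ℝ]
          EuclideanSpace ℝ (Fin m))) 𝓘(ℝ, EuclideanSpace ℝ (Fin (n + 1)) →L[ℝ]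
          EuclideanSpace ℝ (Fin m)) ∞
          (fun p : Y × (EuclideanSpace ℝ (Fin (n + 1)) →L[ℝ] EuclideanSpace ℝ (Fin m)) => p.2)
          ((c.tot.source ∩ c'.tot.source) ×ˢ univ) := contMDiff_snd.contMDiffOn
      exact contMDiffOn_const.clm_comp (hT'.clm_comp
        ((contMDiffOn_const.add (contMDiffOn_const.clm_comp hsnd)).clm_comp hS'))
    · intro y hi hj g
      ext1 v
      have hTy := chartDeriv_transition c.tot_mem c'.tot_mem hi hj
      have hSy := chartDeriv_transition c'.base_mem c.base_mem (c'.maps_source y hj)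
        (c.maps_source y hi)
      change (c'.dtot hj ((c.dtot hi).symm (c.dbase hi ((c'.dbase hj).symm v),
        g (c.dbase hi ((c'.dbase hj).symm v))))).2 = (T y
          (ContinuousLinearMap.inl ℝ _ _ (S (π.toFun y) v) +
            ContinuousLinearMap.inr ℝ _ _ (g (S (π.toFun y) v)))).2
      have h1 : c.dbase hi ((c'.dbase hj).symm v) = S (π.toFun y) v := DFunLike.congr_fun hSy v
      have h2 : ∀ w, c'.dtot hj ((c.dtot hi).symm w) = T y w := fun w => DFunLike.congr_fun hTy w
      rw [h1, h2]
      simp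

/-- The first jet bundle `Z = J¹π` of the fibration `π`. -/
def JetBundle : Type _ := Σ y : Y, JetFiber π y

abbrev jetModel (n m : ℕ) :=
  (totalModel n m).prod
    𝓘(ℝ, EuclideanSpace ℝ (Fin (n + 1)) →L[ℝ] EuclideanSpace ℝ (Fin m))

instance : TopologicalSpace (JetBundle π) := (jetAtlas π).core.toTopologicalSpace

instance : ChartedSpace (ModelProd (TotalSpaceModel n m)
    (EuclideanSpace ℝ (Fin (n + 1)) →L[ℝ] EuclideanSpace ℝ (Fin m))) (JetBundle π) :=
  (jetAtlas π).core.toChartedSpace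

instance : IsManifold (jetModel n m) ∞ (JetBundle π) := (jetAtlas π).isManifold

end Jet
section SubQuotient

section

variable {W : Type*} [AddCommGroup W] [Module ℝ W]
/-- The quotient `P / (P ∩ Q)` of a subspace `P`. -/
def SubQuotient (P Q : Submodule ℝ W) : Type _ := P ⧸ Q.submoduleOf P
instance (P Q : Submodule ℝ W) : AddCommGroup (SubQuotient P Q) :=
  inferInstanceAs (AddCommGroup (P ⧸ Q.submoduleOf P))
instance (P Q : Submodule ℝ W) : Module ℝ (SubQuotient P Q) :=
  inferInstanceAs (Module ℝ (P ⧸ Q.submoduleOf P))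
/-- The class of an element of `P`. -/
def SubQuotient.mk (P Q : Submodule ℝ W) : P →ₗ[ℝ] SubQuotient P Q := (Q.submoduleOf P).mkQ
end

section

variable {W : Type*} [NormedAddCommGroup W] [NormedSpace ℝ W] [FiniteDimensional ℝ W]

instance (P Q : Submodule ℝ W) : IsClosed ((Q.submoduleOf P : Submodule ℝ P) : Set P) :=
  Submodule.closed_of_finiteDimensional _
instance (P Q : Submodule ℝ W) : NormedAddCommGroup (SubQuotient P Q) :=
  inferInstanceAs (NormedAddCommGroup (P ⧸ Q.submoduleOf P))
instance (P Q : Submodule ℝ W) : NormedSpace ℝ (SubQuotient P Q) :=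
  inferInstanceAs (NormedSpace ℝ (P ⧸ Q.submoduleOf P))
instance (P Q : Submodule ℝ W) : FiniteDimensional ℝ (SubQuotient P Q) :=
  inferInstanceAs (FiniteDimensional ℝ (P ⧸ Q.submoduleOf P))
end

variable {W : Type*} [AddCommGroup W] [Module ℝ W]
variable {W' : Type*} [AddCommGroup W'] [Module ℝ W']
/-- The isomorphism of quotients induced by an isomorphism of subspaces. -/
def SubQuotient.equiv {P Q : Submodule ℝ W} {P' Q' : Submodule ℝ W'} (e : P ≃ₗ[ℝ] P')
    (h : ∀ θ : P, (θ : W) ∈ Q ↔ (e θ : W') ∈ Q') : SubQuotient P Q ≃ₗ[ℝ] SubQuotient P' Q' :=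
  Submodule.Quotient.equiv _ _ e (by
    ext θ
    constructor
    · rintro ⟨θ', hθ', rfl⟩
      exact (h θ').1 hθ'
    · intro hθ
      exact ⟨e.symm θ, (h _).2 (by rwa [e.apply_symm_apply]), e.apply_symm_apply _⟩)

theorem exists_projection {W : Type*} [NormedAddCommGroup W] [NormedSpace ℝ W]
    [FiniteDimensional ℝ W] (P : Submodule ℝ W) : ∃ p : W →L[ℝ] P, ∀ x : P, p x = x := by
  obtain ⟨p, hp⟩ := P.subtype.exists_leftInverse_of_injective
    (LinearMap.ker_eq_bot.2 P.injective_subtype)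
  exact ⟨LinearMap.toContinuousLinearMap p, LinearMap.congr_fun hp⟩

theorem contMDiffOn_clm_comp {E : Type*} [NormedAddCommGroup E] [NormedSpace ℝ E] {H : Type*}
    [TopologicalSpace H] {I : ModelWithCorners ℝ E H} {Y : Type*} [TopologicalSpace Y]
    [ChartedSpace H Y] {G G' : Type*} [NormedAddCommGroup G] [NormedSpace ℝ G]
    [NormedAddCommGroup G'] [NormedSpace ℝ G'] (L : G →L[ℝ] G') (s : G' →L[ℝ] G) {U : Set Y}
    {f : Y × G → G} (hf : ContMDiffOn (I.prod 𝓘(ℝ, G)) 𝓘(ℝ, G) ∞ f (U ×ˢ univ)) :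
    ContMDiffOn (I.prod 𝓘(ℝ, G')) 𝓘(ℝ, G') ∞ (fun q : Y × G' => L (f (q.1, s q.2)))
      (U ×ˢ univ) :=
  L.contMDiff.comp_contMDiffOn (hf.comp (contMDiffOn_fst.prodMk
    (s.contMDiff.comp_contMDiffOn contMDiffOn_snd)) fun _ hq => ⟨hq.1, mem_univ _⟩)

end SubQuotient

section AlternatingForms

instance finiteDimensional_alternating (k : ℕ) (V : Type*) [NormedAddCommGroup V]
    [NormedSpace ℝ V] [FiniteDimensional ℝ V] : FiniteDimensional ℝ (V [⋀^Fin k]→L[ℝ] ℝ) := by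
  let F : (V [⋀^Fin k]→L[ℝ] ℝ) →ₗ[ℝ] MultilinearMap ℝ (fun _ : Fin k => V) ℝ :=
    { toFun := fun f => f.toMultilinearMap
      map_add' := fun _ _ => rfl
      map_smul' := fun _ _ => rfl }
  refine FiniteDimensional.of_injective F fun f g h => ?_
  ext v
  exact DFunLike.congr_fun h v

theorem contDiff_compContinuousLinearMap (k : ℕ) (V : Type*) [NormedAddCommGroup V]
    [NormedSpace ℝ V] [FiniteDimensional ℝ V] :
    ContDiff ℝ ∞ (fun p : (V [⋀^Fin k]→L[ℝ] ℝ) × (V →L[ℝ] V) =>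
      p.1.compContinuousLinearMap p.2) := by
  let J : (V [⋀^Fin k]→L[ℝ] ℝ) →L[ℝ] ContinuousMultilinearMap ℝ (fun _ : Fin k => V) ℝ :=
    ContinuousAlternatingMap.toContinuousMultilinearMapCLM ℝ
  have hJ : Function.Injective J :=
    ContinuousAlternatingMap.toContinuousMultilinearMap_injective
  have hfin : FiniteDimensional ℝ (ContinuousMultilinearMap ℝ (fun _ : Fin k => V) ℝ) := by
    let F : (ContinuousMultilinearMap ℝ (fun _ : Fin k => V) ℝ) →ₗ[ℝ]
        MultilinearMap ℝ (fun _ : Fin k => V) ℝ :=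
      { toFun := fun f => f.toMultilinearMap
        map_add' := fun _ _ => rfl
        map_smul' := fun _ _ => rfl }
    exact FiniteDimensional.of_injective F ContinuousMultilinearMap.toMultilinearMap_injective
  obtain ⟨L, hL⟩ := J.toLinearMap.exists_leftInverse_of_injective (LinearMap.ker_eq_bot.2 hJ)
  have hL' : ∀ f, LinearMap.toContinuousLinearMap L (J f) = f := fun f => LinearMap.congr_fun hL f
  have h1 : ContDiff ℝ ∞ (fun p : (V [⋀^Fin k]→L[ℝ] ℝ) × (V →L[ℝ] V) =>
      ContinuousMultilinearMap.compContinuousLinearMapContinuousMultilinear ℝ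
        (fun _ : Fin k => V) (fun _ => V) ℝ (fun _ => p.2) (J p.1)) :=
    ((ContinuousMultilinearMap.contDiff _).comp (contDiff_pi.2 fun _ => contDiff_snd)).clm_apply
      (J.contDiff.comp contDiff_fst)
  have h2 := (LinearMap.toContinuousLinearMap L).contDiff.comp h1
  convert h2 using 1
  ext1 p
  exact (hL' _).symm

variable {V W V' W' : Type*} [AddCommGroup V] [Module ℝ V] [TopologicalSpace V]
  [AddCommGroup W] [Module ℝ W] [TopologicalSpace W]
  [AddCommGroup V'] [Module ℝ V'] [TopologicalSpace V']
  [AddCommGroup W'] [Module ℝ W'] [TopologicalSpace W']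

/-- The alternating `k`-forms `θ` on `V` such that `ι_{v₁} ⋯ ι_{vᵣ} θ = 0` for all
`v₁, …, vᵣ ∈ ker T` ("vertical" vectors), i.e. which vanish as soon as `r` of their arguments
are vertical. -/
def semiForms (k r : ℕ) (T : V →L[ℝ] W) : Submodule ℝ (V [⋀^Fin k]→L[ℝ] ℝ) where
  carrier := {θ | ∀ v : Fin k → V, (∃ s : Finset (Fin k), r ≤ s.card ∧ ∀ i ∈ s, T (v i) = 0) →
    θ v = 0}
  add_mem' {θ θ'} h h' v hv := by
    rw [ContinuousAlternatingMap.add_apply, h v hv, h' v hv, add_zero]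
  zero_mem' _ _ := rfl
  smul_mem' c θ h v hv := by
    rw [ContinuousAlternatingMap.smul_apply, h v hv, smul_zero]

theorem semiForms_comp {k r : ℕ} {T : V →L[ℝ] W} {T' : V' →L[ℝ] W'} (e : V →L[ℝ] V')
    (h : ∀ v, T v = 0 → T' (e v) = 0) {θ : V' [⋀^Fin k]→L[ℝ] ℝ} (hθ : θ ∈ semiForms k r T') :
    θ.compContinuousLinearMap e ∈ semiForms k r T := fun _ ⟨s, hs, hv⟩ =>
  hθ _ ⟨s, hs, fun i hi => h _ (hv i hi)⟩

/-- Transport of `semiForms` along a linear isomorphism preserving vertical vectors. -/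
def semiFormsEquiv (k r : ℕ) {T : V →L[ℝ] W} {T' : V' →L[ℝ] W'} (e : V ≃L[ℝ] V')
    (h : ∀ v, T v = 0 ↔ T' (e v) = 0) : semiForms k r T ≃ₗ[ℝ] semiForms k r T' where
  toFun θ := ⟨θ.1.compContinuousLinearMap (e.symm : V' →L[ℝ] V),
    semiForms_comp _ (fun v hv => (h _).2 (by simpa using hv)) θ.2⟩
  invFun θ := ⟨θ.1.compContinuousLinearMap (e : V →L[ℝ] V'),
    semiForms_comp _ (fun v hv => (h _).1 hv) θ.2⟩
  map_add' _ _ := rfl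
  map_smul' _ _ := rfl
  left_inv θ := by
    apply Subtype.ext
    ext v
    change θ.1 _ = θ.1 v
    congr 1
    ext i
    simp
  right_inv θ := by
    apply Subtype.ext
    ext v
    change θ.1 _ = θ.1 v
    congr 1
    ext i
    simp

/-- Transport of the quotient `Λ₂ / Λ₁` along a linear isomorphism preserving vertical vectors. -/
def semiQuotientEquiv (k : ℕ) {T : V →L[ℝ] W} {T' : V' →L[ℝ] W'} (e : V ≃L[ℝ] V')
    (h : ∀ v, T v = 0 ↔ T' (e v) = 0) : SubQuotient (semiForms k 2 T) (semiForms k 1 T) ≃ₗ[ℝ]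
      SubQuotient (semiForms k 2 T') (semiForms k 1 T') :=
  SubQuotient.equiv (semiFormsEquiv k 2 e h) (by
    intro θ
    constructor
    · intro hθ
      exact semiForms_comp _ (fun v hv => (h _).2 (by simpa using hv)) hθ
    · intro hθ
      have h1 := semiForms_comp (e : V →L[ℝ] V') (fun v hv => (h v).1 hv) hθ
      have h2 : ((semiFormsEquiv k 2 e h).symm (semiFormsEquiv k 2 e h θ)).1 = θ.1 := by
        rw [LinearEquiv.symm_apply_apply]
      rw [← h2]
      exact h1)

end AlternatingForms

section MultimomentumBundles

variable {n m : ℕ}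
  {X : Type*} [TopologicalSpace X] [ChartedSpace (EuclideanHalfSpace (n + 1)) X]
  {Y : Type*} [TopologicalSpace Y] [ChartedSpace (TotalSpaceModel n m) Y]
  (π : Fibration n m X Y)

/-- The fibre over `y` of `Λ^{n+1}_r Y`: the `(n+1)`-forms on `T_y Y` annihilated by any `r`
vertical vectors. -/
abbrev FormFiber (r : ℕ) (y : Y) :
    Submodule ℝ (TangentSpace (totalModel n m) y [⋀^Fin (n + 1)]→L[ℝ] ℝ) :=
  semiForms (n + 1) r (π.deriv y)

/-- The fibre over `y` of the dual jet bundle: the quotient `Λ^{n+1}_2 Y / Λ^{n+1}_1 Y`. -/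
abbrev DualFiber (y : Y) : Type :=
  SubQuotient (FormFiber π 2 y) (FormFiber π 1 y)

/-- `Λ^{n+1}_r` of the trivial bundle `ℝ^{n+1} × ℝ^m → ℝ^{n+1}` at a point. -/
abbrev ModelForms (n m r : ℕ) :
    Submodule ℝ (TotalVectorModel n m [⋀^Fin (n + 1)]→L[ℝ] ℝ) :=
  semiForms (n + 1) r (ContinuousLinearMap.fst ℝ (EuclideanSpace ℝ (Fin (n + 1)))
    (EuclideanSpace ℝ (Fin m)))

abbrev FormFiberModel (n m : ℕ) : Type := ModelForms n m 2

def DualFiberModel (n m : ℕ) : Type := SubQuotient (ModelForms n m 2) (ModelForms n m 1)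

instance (n m : ℕ) : NormedAddCommGroup (DualFiberModel n m) :=
  inferInstanceAs (NormedAddCommGroup (SubQuotient (ModelForms n m 2) (ModelForms n m 1)))

instance (n m : ℕ) : NormedSpace ℝ (DualFiberModel n m) :=
  inferInstanceAs (NormedSpace ℝ (SubQuotient (ModelForms n m 2) (ModelForms n m 1)))

instance (n m : ℕ) : FiniteDimensional ℝ (DualFiberModel n m) :=
  inferInstanceAs (FiniteDimensional ℝ (SubQuotient (ModelForms n m 2) (ModelForms n m 1)))

def DualFiberModel.mk (n m : ℕ) : FormFiberModel n m →ₗ[ℝ] DualFiberModel n m :=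
  SubQuotient.mk (ModelForms n m 2) (ModelForms n m 1)

/-- The quotient map has a linear section. -/
theorem DualFiberModel.exists_section (n m : ℕ) :
    ∃ s : DualFiberModel n m →ₗ[ℝ] FormFiberModel n m, ∀ q, DualFiberModel.mk n m (s q) = q := by
  have hmk : Function.Surjective (DualFiberModel.mk n m) := Submodule.mkQ_surjective _
  obtain ⟨s, hs⟩ := LinearMap.exists_rightInverse_of_surjective _
    (LinearMap.range_eq_top.2 hmk)
  exact ⟨s, LinearMap.congr_fun hs⟩

theorem FibredChart.deriv_eq_zero_iff {π : Fibration n m X Y} (c : FibredChart π) {y : Y}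
    (hy : y ∈ c.tot.source) (v : TangentSpace (totalModel n m) y) :
    π.deriv y v = 0 ↔ ContinuousLinearMap.fst ℝ (EuclideanSpace ℝ (Fin (n + 1)))
      (EuclideanSpace ℝ (Fin m)) (c.dtot hy v) = 0 := by
  rw [ContinuousLinearMap.coe_fst', ← c.dbase_deriv hy v]
  exact (ContinuousLinearEquiv.map_eq_zero_iff _).symm

/-- Fibre coordinates on `Λ^{n+1}_2 Y`. -/
def FibredChart.formCoord {π : Fibration n m X Y} (c : FibredChart π) {y : Y}
    (hy : y ∈ c.tot.source) : FormFiber π 2 y ≃ₗ[ℝ] FormFiberModel n m :=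
  semiFormsEquiv (n + 1) 2 (c.dtot hy) (c.deriv_eq_zero_iff hy)

/-- Fibre coordinates on the dual jet bundle. -/
def FibredChart.dualCoord {π : Fibration n m X Y} (c : FibredChart π) {y : Y}
    (hy : y ∈ c.tot.source) : DualFiber π y ≃ₗ[ℝ] DualFiberModel n m :=
  semiQuotientEquiv (n + 1) (c.dtot hy) (c.deriv_eq_zero_iff hy)

/-- In fibred coordinates, the transition maps of the bundles of forms are smooth. -/
theorem exists_formTransition {π : Fibration n m X Y} (c c' : FibredChart π) :
    ∃ f : Y × FormFiberModel n m → FormFiberModel n m,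
      ContMDiffOn ((totalModel n m).prod 𝓘(ℝ, FormFiberModel n m)) 𝓘(ℝ, FormFiberModel n m) ∞ f
        ((c.tot.source ∩ c'.tot.source) ×ˢ univ) ∧
      ∀ y hi hj g, c'.formCoord hj ((c.formCoord (y := y) hi).symm g) = f (y, g) := by
  let T : Y → TotalVectorModel n m →L[ℝ] TotalVectorModel n m := fun y =>
    fderivWithin ℝ (c.tot.extend (totalModel n m) ∘ (c'.tot.extend (totalModel n m)).symm)
      (range (totalModel n m)) (c'.tot.extend (totalModel n m) y)
  have hT : ContMDiffOn (totalModel n m) 𝓘(ℝ, _) ∞ T (c.tot.source ∩ c'.tot.source) :=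
    (contMDiffOn_transition c'.tot_mem c.tot_mem).mono (fun y hy => ⟨hy.2, hy.1⟩)
  obtain ⟨p, hp'⟩ := exists_projection (ModelForms n m 2)
  refine ⟨fun q => p
    (q.2.1.compContinuousLinearMap (T q.1)), ?_, ?_⟩
  · have hfst : ContMDiffOn ((totalModel n m).prod 𝓘(ℝ, FormFiberModel n m)) (totalModel n m) ∞
        (fun q : Y × FormFiberModel n m => q.1)
        ((c.tot.source ∩ c'.tot.source) ×ˢ univ) := contMDiff_fst.contMDiffOn
    have hsnd : ContMDiffOn ((totalModel n m).prod 𝓘(ℝ, FormFiberModel n m))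
        𝓘(ℝ, FormFiberModel n m) ∞ (fun q : Y × FormFiberModel n m => q.2)
        ((c.tot.source ∩ c'.tot.source) ×ˢ univ) := contMDiff_snd.contMDiffOn
    have hT' := hT.comp hfst (fun q hq => hq.1)
    have hs : ContMDiffOn ((totalModel n m).prod 𝓘(ℝ, FormFiberModel n m))
        𝓘(ℝ, TotalVectorModel n m [⋀^Fin (n + 1)]→L[ℝ] ℝ) ∞
        (fun q : Y × FormFiberModel n m => q.2.1)
        ((c.tot.source ∩ c'.tot.source) ×ˢ univ) :=
      ((ModelForms n m 2).subtypeL.contDiff.contMDiff).comp_contMDiffOn hsnd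
    exact ((p.contDiff.comp
      (contDiff_compContinuousLinearMap (n + 1) (TotalVectorModel n m))).contMDiff).comp_contMDiffOn
        (hs.prodMk_space hT')
  · intro y hi hj g
    rw [← hp' (c'.formCoord hj ((c.formCoord hi).symm g))]
    congr 1
    ext v
    have hTy := chartDeriv_transition c'.tot_mem c.tot_mem hj hi
    change g.1 (fun i => c.dtot hi ((c'.dtot hj).symm (v i))) = g.1 (fun i => T y (v i))
    congr 1
    ext1 i
    exact DFunLike.congr_fun hTy (v i)

/-- The smooth structure of `Λ^{n+1}_2 Y`. -/
def formAtlas : FibreAtlas (totalModel n m) (FormFiberModel n m)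
    (fun y => FormFiber π 2 y) where
  ι := FibredChart π
  chart c := c.tot
  chart_mem c := c.tot_mem
  index := π.chartAround
  mem_index := π.mem_chartAround
  coord c _ hy := (c.formCoord hy).toEquiv
  smooth c c' := exists_formTransition c c'

/-- The smooth structure of the dual jet bundle. -/
def dualAtlas : FibreAtlas (totalModel n m) (DualFiberModel n m)
    (fun y => DualFiber π y) where
  ι := FibredChart π
  chart c := c.tot
  chart_mem c := c.tot_mem
  index := π.chartAround
  mem_index := π.mem_chartAround
  coord c _ hy := (c.dualCoord hy).toEquiv
  smooth c c' := by
    obtain ⟨f, hf, hfeq⟩ := exists_formTransition c c'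
    obtain ⟨s, hs⟩ := DualFiberModel.exists_section n m
    refine ⟨fun q => LinearMap.toContinuousLinearMap (DualFiberModel.mk n m)
      (f (q.1, LinearMap.toContinuousLinearMap s q.2)), ?_, ?_⟩
    · exact contMDiffOn_clm_comp _ _ hf
    · intro y hi hj q
      have hq : DualFiberModel.mk n m (s q) = q := hs q
      change c'.dualCoord hj ((c.dualCoord hi).symm q) = DualFiberModel.mk n m (f (y, s q))
      rw [← hfeq y hi hj (s q)]
      conv_lhs => rw [← hq]
      rfl

/-- The bundle `Λ^{n+1}_2 Y → Y` of `(n+1)`-forms annihilated by two vertical vectors. -/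
def FormBundle : Type _ := Σ y : Y, FormFiber π 2 y

/-- The dual jet bundle `Z^* = Λ^{n+1}_2 Y / Λ^{n+1}_1 Y`. -/
def DualJetBundle : Type _ := Σ y : Y, DualFiber π y

abbrev formModel (n m : ℕ) := (totalModel n m).prod 𝓘(ℝ, FormFiberModel n m)

abbrev dualModel (n m : ℕ) := (totalModel n m).prod 𝓘(ℝ, DualFiberModel n m)

instance : TopologicalSpace (FormBundle π) := (formAtlas π).core.toTopologicalSpace

instance : ChartedSpace (ModelProd (TotalSpaceModel n m) (FormFiberModel n m)) (FormBundle π) :=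
  (formAtlas π).core.toChartedSpace

instance : IsManifold (formModel n m) ∞ (FormBundle π) := (formAtlas π).isManifold

instance : TopologicalSpace (DualJetBundle π) := (dualAtlas π).core.toTopologicalSpace

instance : ChartedSpace (ModelProd (TotalSpaceModel n m) (DualFiberModel n m))
    (DualJetBundle π) :=
  (dualAtlas π).core.toChartedSpace

instance : IsManifold (dualModel n m) ∞ (DualJetBundle π) := (dualAtlas π).isManifold

end MultimomentumBundles
section Lagrangian

section InsertSum

variable {k : ℕ} {V V₁ V₂ : Type*} [NormedAddCommGroup V] [NormedSpace ℝ V]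
  [NormedAddCommGroup V₁] [NormedSpace ℝ V₁] [NormedAddCommGroup V₂] [NormedSpace ℝ V₂]

theorem insertSum_dual (η : V₁ [⋀^Fin k]→L[ℝ] ℝ) (P : V →L[ℝ] V₁) (Q : V →L[ℝ] V₂)
    (v : Fin k → V) (u : V₁) (l : V₂ →L[ℝ] ℝ) :
    l ((∑ i, (η.toContinuousMultilinearMap.toContinuousLinearMap (fun j => P (v j)) i).smulRight
      (Q (v i))) u) = η.fderivCompContinuousLinearMap P ((l.comp Q).smulRight u) v := by
  rw [ContinuousAlternatingMap.fderivCompContinuousLinearMap_apply]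
  simp only [sum_apply, map_sum, ContinuousLinearMap.smulRight_apply, map_smul,
    ContinuousMultilinearMap.toContinuousLinearMap_apply]
  refine Finset.sum_congr rfl fun i _ => ?_
  have h : (fun j => (Function.update (fun _ => P) i ((l.comp Q).smulRight u) j) (v j)) =
      Function.update (fun j => P (v j)) i (l (Q (v i)) • u) := by
    ext1 j
    by_cases h : j = i
    · subst h; simp
    · simp [h]
  rw [h, ContinuousAlternatingMap.map_update_smul, smul_eq_mul, smul_eq_mul, mul_comm]
  rfl

/-- For a `k`-form `η` on `V₁` and linear maps `P : V → V₁` and `Q : V → V₂`, the alternating map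
sending `v₁, …, v_k` to the linear map
`u ↦ ∑ i, η (P v₁, …, u, …, P v_k) • Q vᵢ` (`u` at the `i`-th place), i.e. to `∑ i, ηᵢ ⊗ Q vᵢ`
where `ηᵢ = η (P v₁, …, · , …, P v_k)`. -/
def insertSum [FiniteDimensional ℝ V₁]
    (η : V₁ [⋀^Fin k]→L[ℝ] ℝ) (P : V →L[ℝ] V₁) (Q : V →L[ℝ] V₂) :
    V [⋀^Fin k]→L[ℝ] (V₁ →L[ℝ] V₂) where
  toFun v := ∑ i, (η.toContinuousMultilinearMap.toContinuousLinearMap (fun j => P (v j)) i).smulRight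
    (Q (v i))
  map_update_add' {inst} v i x y := by
    obtain rfl : inst = instDecidableEqFin k := Subsingleton.elim _ _
    ext1 u
    refine (SeparatingDual.eq_iff_forall_dual_eq (R := ℝ)).2 fun l => ?_
    rw [add_apply, map_add]
    simp only [insertSum_dual]
    exact ContinuousAlternatingMap.map_update_add _ _ _ _ _
  map_update_smul' {inst} v i c x := by
    obtain rfl : inst = instDecidableEqFin k := Subsingleton.elim _ _
    ext1 u
    refine (SeparatingDual.eq_iff_forall_dual_eq (R := ℝ)).2 fun l => ?_
    rw [smul_apply, map_smul]
    simp only [insertSum_dual]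
    exact ContinuousAlternatingMap.map_update_smul _ _ _ _ _
  map_eq_zero_of_eq' v i j hv hij := by
    ext1 u
    refine (SeparatingDual.eq_iff_forall_dual_eq (R := ℝ)).2 fun l => ?_
    rw [zero_apply, map_zero]
    simp only [insertSum_dual]
    exact ContinuousAlternatingMap.map_eq_zero_of_eq _ _ hv hij
  cont := by
    refine continuous_clm_apply.2 fun u => ?_
    simp only [sum_apply, ContinuousLinearMap.smulRight_apply,
      ContinuousMultilinearMap.toContinuousLinearMap_apply]
    refine continuous_finsetSum _ fun i _ => ?_
    refine Continuous.smul ?_ (Q.continuous.comp (continuous_apply i))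
    exact η.cont.comp ((continuous_pi fun j => P.continuous.comp (continuous_apply j)).update i
      continuous_const)

end InsertSum

theorem hasMFDerivAt_of_chart {E : Type*} [NormedAddCommGroup E] [NormedSpace ℝ E] {H : Type*}
    [TopologicalSpace H] {I : ModelWithCorners ℝ E H} {M : Type*} [TopologicalSpace M]
    [ChartedSpace H M] {γ : ℝ → M} (hs : ∀ t, γ t ∈ (chartAt H (γ 0)).source)
    {u w : E} (h : ∀ t, extChartAt I (γ 0) (γ t) = u + t • w) :
    HasMFDerivAt 𝓘(ℝ, ℝ) I γ 0 ((1 : ℝ →L[ℝ] ℝ).smulRight (w : TangentSpace I (γ 0))) := by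
  have hc : Continuous (chartAt H (γ 0) ∘ γ) := by
    have h1 : Continuous (I ∘ chartAt H (γ 0) ∘ γ) := by
      have h2 : I ∘ chartAt H (γ 0) ∘ γ = fun t => u + t • w := funext h
      rw [h2]
      fun_prop
    exact I.isClosedEmbedding.isInducing.continuous_iff.2 h1
  refine ⟨((chartAt H (γ 0)).continuousAt_iff_continuousAt_comp_left (f := γ) (x := (0 : ℝ))
      (Filter.Eventually.of_forall hs)).2 hc.continuousAt, ?_⟩
  have h3 : writtenInExtChartAt 𝓘(ℝ, ℝ) I 0 γ = fun t => u + t • w := funext h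
  rw [h3]
  have h4 : HasFDerivAt (fun t : ℝ => u + t • w) ((1 : ℝ →L[ℝ] ℝ).smulRight w) 0 :=
    ((ContinuousLinearMap.smulRight (1 : ℝ →L[ℝ] ℝ) w).hasFDerivAt).const_add u
  exact h4.hasFDerivWithinAt
variable {n m : ℕ}
  {X : Type*} [TopologicalSpace X] [ChartedSpace (EuclideanHalfSpace (n + 1)) X]
  {Y : Type*} [TopologicalSpace Y] [ChartedSpace (TotalSpaceModel n m) Y]
  {π : Fibration n m X Y}

theorem FibredChart.jetCoord_add (c : FibredChart π) {y : Y} (hy : y ∈ c.tot.source)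
    (A : JetFiber π y)
    (f : TangentSpace (baseModel n) (π.toFun y) →L[ℝ] TangentSpace (totalModel n m) y)
    (t : ℝ) (hf : (π.deriv y).comp (A.1 + t • f) = ContinuousLinearMap.id ℝ _) : c.jetCoord hy ⟨A.1 + t • f, hf⟩ = c.jetCoord hy A +
      t • ((ContinuousLinearMap.snd ℝ _ _).comp
        (c.dtot hy : TangentSpace (totalModel n m) y →L[ℝ] TotalVectorModel n m)).comp
          (f.comp ((c.dbase hy).symm : EuclideanSpace ℝ (Fin (n + 1)) →L[ℝ] _)) := by
  ext1 v
  have h1 : c.dtot hy (A.1 ((c.dbase hy).symm v) + t • f ((c.dbase hy).symm v)) =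
      c.dtot hy (A.1 ((c.dbase hy).symm v)) + t • c.dtot hy (f ((c.dbase hy).symm v)) := by
    rw [map_add, map_smul]
  exact congrArg Prod.snd h1

namespace JetBundle

/-- The point `A` of the fibre over `y`. -/
abbrev mk (y : Y) (A : JetFiber π y) : JetBundle π := ⟨y, A⟩

/-- The projection `π_{YZ} : Z → Y`. -/
abbrev toTotal (z : JetBundle π) : Y := z.1

/-- The projection `π_{XZ} : Z → X`. -/
abbrev toBase (z : JetBundle π) : X := π.toFun z.1

/-- The vertical lift `f ↦ fᵛ` at `z`: for `f : T_x X → V_y Y`, the velocity at `t = 0` of the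
curve `t ↦ z + t f` in the fibre of `Z → Y` through `z` (see `hasMFDerivAt_verticalLift`). -/
def verticalLift (z : JetBundle π) :
    (TangentSpace (baseModel n) (π.toFun z.1) →L[ℝ] TangentSpace (totalModel n m) z.1) →L[ℝ]
      TangentSpace (jetModel n m) z :=
  let c := π.chartAround z.1
  let hc := π.mem_chartAround z.1
  (ContinuousLinearMap.inr ℝ (TotalVectorModel n m)
      (EuclideanSpace ℝ (Fin (n + 1)) →L[ℝ] EuclideanSpace ℝ (Fin m))).comp
    ((ContinuousLinearMap.postcomp _ ((ContinuousLinearMap.snd ℝ _ _).comp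
        (c.dtot hc : TangentSpace (totalModel n m) z.1 →L[ℝ] TotalVectorModel n m))).comp
      (ContinuousLinearMap.precomp _
        ((c.dbase hc).symm : EuclideanSpace ℝ (Fin (n + 1)) →L[ℝ] _)))

theorem hasMFDerivAt_verticalLift (z : JetBundle π)
    (f : TangentSpace (baseModel n) (π.toFun z.1) →L[ℝ] TangentSpace (totalModel n m) z.1)
    (hf : (π.deriv z.1).comp f = 0) :
    HasMFDerivAt 𝓘(ℝ, ℝ) (jetModel n m)
      (fun t : ℝ => mk (π := π) z.1 ⟨z.2.1 + t • f, by
        rw [ContinuousLinearMap.comp_add, ContinuousLinearMap.comp_smul, hf, smul_zero, add_zero]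
        exact z.2.2⟩) 0
      ((1 : ℝ →L[ℝ] ℝ).smulRight (verticalLift z f : TangentSpace (jetModel n m) z)) := by
  have hc := π.mem_chartAround z.1
  refine hasMFDerivAt_of_chart (fun _ => hc)
    (u := ((totalModel n m) ((π.chartAround z.1).tot z.1), (π.chartAround z.1).jetCoord hc z.2))
    fun t => ?_
  have h1 := (jetAtlas π).totalMap_of_mem (i := π.chartAround z.1) (z := mk (π := π) z.1
    ⟨z.2.1 + t • f, by
      rw [ContinuousLinearMap.comp_add, ContinuousLinearMap.comp_smul, hf, smul_zero, add_zero]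
      exact z.2.2⟩) hc
  refine (congrArg (jetModel n m) h1).trans (Prod.ext ?_ ?_)
  · have h2 : t • (0 : TotalVectorModel n m) = 0 := smul_zero t
    change (totalModel n m) ((π.chartAround z.1).tot z.1) = _ + t • (0 : TotalVectorModel n m)
    rw [h2, add_zero]
  · exact (π.chartAround z.1).jetCoord_add hc z.2 f t _

/-- The contact part `w ↦ Tπ_{YZ} w - z (Tπ_{XZ} w)` of the projection of a vector to `Y`. -/
def contact (z : JetBundle π) :
    TangentSpace (jetModel n m) z →L[ℝ] TangentSpace (totalModel n m) z.1 :=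
  mfderiv (jetModel n m) (totalModel n m) toTotal z -
    z.2.1.comp (mfderiv (jetModel n m) (baseModel n) toBase z)

/-- The vertical endomorphism `S_η`, the vector-valued `(n+1)`-form on `Z`
`S_η (V₀, …, V_n) = ∑ i, (ηᵢ ⊗ wᵢ)ᵛ` where `wᵢ` is the contact part of `Vᵢ` and
`ηᵢ u = η (Tπ V₀, …, u, …, Tπ V_n)` with `u` at the `i`-th place. In coordinates with
`η = dx⁰ ∧ ⋯ ∧ dxⁿ`, this is
`S_η = (dy^i - z^i_ν dx^ν) ∧ (ι_{∂/∂x^μ} η) ⊗ ∂/∂z^i_μ`. -/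
def verticalEndomorphism (η : DForm (baseModel n) X (n + 1)) (z : JetBundle π) :
    TangentSpace (jetModel n m) z [⋀^Fin (n + 1)]→L[ℝ] TangentSpace (jetModel n m) z :=
  (verticalLift z).compContinuousAlternatingMap
    (insertSum (V₁ := EuclideanSpace ℝ (Fin (n + 1))) (V₂ := TotalVectorModel n m)
      (V := TotalVectorModel n m ×
        (EuclideanSpace ℝ (Fin (n + 1)) →L[ℝ] EuclideanSpace ℝ (Fin m)))
      (η (toBase z)) (mfderiv (jetModel n m) (baseModel n) toBase z) (contact z))

/-- The Poincaré–Cartan `(n+1)`-form `Θ_L = L η + S_η^* (dL)`. -/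
def cartanForm (η : DForm (baseModel n) X (n + 1)) (L : JetBundle π → ℝ) :
    DForm (jetModel n m) (JetBundle π) (n + 1) := fun z =>
  L z • η.pullback toBase z +
    (mfderiv (jetModel n m) 𝓘(ℝ, ℝ) L z : TangentSpace (jetModel n m) z →L[ℝ] ℝ).compContinuousAlternatingMap (verticalEndomorphism η z)

end JetBundle
end Lagrangian

section Hamiltonian

variable {n m : ℕ}
  {X : Type*} [TopologicalSpace X] [ChartedSpace (EuclideanHalfSpace (n + 1)) X]
  {Y : Type*} [TopologicalSpace Y] [ChartedSpace (TotalSpaceModel n m) Y]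
  {π : Fibration n m X Y}

/-- The projection `ν₂ : Λ^{n+1}_2 Y → Y`. -/
abbrev FormBundle.toTotal (w : FormBundle π) : Y := w.1

/-- The projection `μ : Λ^{n+1}_2 Y → Z^*`. -/
abbrev FormBundle.toDual (w : FormBundle π) : DualJetBundle π := ⟨w.1, SubQuotient.mk _ _ w.2⟩

/-- The projection `π_{XZ^*} : Z^* → X`. -/
abbrev DualJetBundle.toBase (z : DualJetBundle π) : X := π.toFun z.1

variable (π) in
/-- The Liouville form `Θ` of `Λ^{n+1}_2 Y`,
`Θ_ω (V₀, …, V_n) = ω (Tν₂ V₀, …, Tν₂ V_n)`. -/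
def liouvilleForm : DForm (formModel n m) (FormBundle π) (n + 1) := fun w =>
  w.2.1.compContinuousLinearMap (mfderiv (formModel n m) (totalModel n m) FormBundle.toTotal w)

/-- Hamiltonians: smooth sections `h` of `μ : Λ^{n+1}_2 Y → Z^*`. -/
structure IsHamiltonian (h : DualJetBundle π → FormBundle π) : Prop where
  smooth : ContMDiff (dualModel n m) (formModel n m) ∞ h
  toDual_apply : ∀ z, (h z).toDual = z

/-- The form `Θ_h = h^* Θ` on `Z^*`. -/
def hamiltonForm (h : DualJetBundle π → FormBundle π) :
    DForm (dualModel n m) (DualJetBundle π) (n + 1) :=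
  (liouvilleForm π).pullback h

end Hamiltonian
section Solutions

variable {n : ℕ}
  {X : Type*} [TopologicalSpace X] [ChartedSpace (EuclideanHalfSpace (n + 1)) X]
  {E : Type*} [NormedAddCommGroup E] [NormedSpace ℝ E] {H : Type*} [TopologicalSpace H]
  {I : ModelWithCorners ℝ E H} {M : Type*} [TopologicalSpace M] [ChartedSpace H M]

/-- Volume forms: smooth nowhere vanishing forms of top degree. -/
structure IsVolumeForm (η : DForm (baseModel n) X (n + 1)) : Prop where
  smooth : η.IsSmooth
  ne_zero : ∀ x, η x ≠ 0

/-- A boundary condition for sections of `p : M → X`, with respect to the form `Θ`: a manifold `B`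
(without boundary) embedded in `M`, which `p` maps by a submersion onto the boundary `∂X`
(so that `B` lies in `∂M = p⁻¹(∂X)`), and an `n`-form `Π` on `B` such that `i_B^* Θ = dΠ`. -/
structure BoundaryCondition (p : M → X) (Θ : DForm I M (n + 1)) (d : ℕ) (B : Type*)
    [TopologicalSpace B] [ChartedSpace (EuclideanSpace ℝ (Fin d)) B] where
  incl : B → M
  isSmoothEmbedding : IsSmoothEmbedding (𝓡 d) I ∞ incl
  range_proj : range (p ∘ incl) = (baseModel n).boundary X
  submersion : ∀ b, Module.finrank ℝ (mfderiv (𝓡 d) (baseModel n) (p ∘ incl) b).range = n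
  potential : DForm (𝓡 d) B n
  potential_smooth : potential.IsSmooth
  pullback_eq : Θ.pullback incl = potential.d

/-- `ξ` is a Cartan symmetry: `£_ξ Θ = dα` for an `n`-form `α` which is exact on `B`, the vector
field `ξ` is tangent to `B`, and `£_{ξ|B} Π = 0`. -/
structure IsCartanSymmetry [IsManifold I 1 M] {p : M → X} {Θ : DForm I M (n + 1)} {d : ℕ}
    {B : Type*} [TopologicalSpace B] [ChartedSpace (EuclideanSpace ℝ (Fin d)) B]
    [IsManifold (𝓡 d) 1 B] (bc : BoundaryCondition p Θ d B) (ξ : VField I M) : Prop where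
  smooth : ξ.IsSmooth
  exists_potential : ∃ α : DForm I M n, α.IsSmooth ∧ DForm.lieDeriv ξ Θ = α.d ∧
    (α.pullback bc.incl : DForm (𝓡 d) B n).IsExact
  tangent : ∃ ξB : VField (𝓡 d) B, ξB.IsSmooth ∧
    (∀ b, mfderiv (𝓡 d) I bc.incl b (ξB b) = ξ (bc.incl b)) ∧
    DForm.lieDeriv ξB bc.potential = 0

/-- `φ`, defined on the open set `D` of `ℝ × M`, is a (local) flow of the vector field `ξ`. -/
structure IsLocalFlow (ξ : VField I M) (D : Set (ℝ × M)) (φ : ℝ → M → M) : Prop where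
  isOpen : IsOpen D
  interval : ∀ t z, (t, z) ∈ D → ∀ s ∈ uIcc 0 t, (s, z) ∈ D
  smooth : ContMDiffOn (𝓘(ℝ, ℝ).prod I) I ∞ (fun q : ℝ × M => φ q.1 q.2) D
  zero : ∀ z, (0, z) ∈ D → φ 0 z = z
  hasMFDerivAt : ∀ t z, (t, z) ∈ D → HasMFDerivAt 𝓘(ℝ, ℝ) I (fun s => φ s z) t
    ((1 : ℝ →L[ℝ] ℝ).smulRight (ξ (φ t z)))

/-- `σ` is a smooth section of `p` over the open set `U`, satisfying `σ^*(ι_ξ Ω) = 0` for all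
vector fields `ξ`. -/
structure SolvesFieldEquations [IsManifold I 1 M] (p : M → X) (Ω : DForm I M (n + 2)) (U : Set X)
    (σ : X → M) : Prop where
  isOpen : IsOpen U
  smooth : ContMDiffOn (baseModel n) I ∞ σ U
  section_eq : ∀ x ∈ U, p (σ x) = x
  equation : ∀ ξ : VField I M, ξ.IsSmooth → ∀ x ∈ U,
    ((DForm.interior ξ Ω).pullback σ : DForm (baseModel n) X (n + 1)) x = 0

/-- `σ(U ∩ ∂X) ⊆ B`. -/
def SatisfiesBoundaryCondition {p : M → X} {Θ : DForm I M (n + 1)} {d : ℕ} {B : Type*}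
    [TopologicalSpace B] [ChartedSpace (EuclideanSpace ℝ (Fin d)) B]
    (bc : BoundaryCondition p Θ d B) (U : Set X) (σ : X → M) : Prop :=
  ∀ x ∈ U, x ∈ (baseModel n).boundary X → σ x ∈ range bc.incl

/-- The form `Ω = -dΘ`. -/
def multisymplecticForm (Θ : DForm I M (n + 1)) : DForm I M (n + 2) := -Θ.d

/-- Solutions over `U` of the (De Donder or Hamilton) equations defined by the form `Θ`, i.e.
`σ^*(ι_ξ Ω) = 0` for all `ξ`, where `Ω = -dΘ`, and `σ(∂X) ⊆ B`. -/
def IsSolution [IsManifold I 1 M] {p : M → X} {Θ : DForm I M (n + 1)} {d : ℕ} {B : Type*}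
    [TopologicalSpace B] [ChartedSpace (EuclideanSpace ℝ (Fin d)) B]
    (bc : BoundaryCondition p Θ d B) (U : Set X) (σ : X → M) : Prop :=
  SolvesFieldEquations p (multisymplecticForm Θ) U σ ∧ SatisfiesBoundaryCondition bc U σ

/-- The map `ψ_t = p ∘ φ_t ∘ σ` is defined on the open set `Ψ.source ⊆ U` and restricts there to
the diffeomorphism `Ψ` onto the open set `Ψ.target`. -/
structure IsBaseMap (p : M → X) (D : Set (ℝ × M)) (φ : ℝ → M → M) (U : Set X) (σ : X → M) (t : ℝ)
    (Ψ : OpenPartialHomeomorph X X) : Prop where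
  source_subset : Ψ.source ⊆ U
  mem_domain : ∀ x ∈ Ψ.source, (t, σ x) ∈ D
  eq : ∀ x ∈ Ψ.source, Ψ x = p (φ t (σ x))
  smooth : ContMDiffOn (baseModel n) (baseModel n) ∞ Ψ Ψ.source
  smooth_symm : ContMDiffOn (baseModel n) (baseModel n) ∞ Ψ.symm Ψ.target

/-- The transformed section `φ_t ∘ σ ∘ ψ_t⁻¹`, over `Ψ.target`. -/
def transform (φ : ℝ → M → M) (σ : X → M) (t : ℝ) (Ψ : OpenPartialHomeomorph X X) (x : X) : M :=
  φ t (σ (Ψ.symm x))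

/-- The flow `φ` (with domain `D`) maps solutions to solutions. For every solution `σ` over an open
set `U`:
* whenever `ψ_t = p ∘ φ_t ∘ σ` restricts to a diffeomorphism of an open subset of `U` onto an open
  set, `φ_t ∘ σ ∘ ψ_t⁻¹` solves the field equations there, and also satisfies the boundary
  condition if `B` is closed;
* around each point `x₀` of `U` at which the flow is defined, for all sufficiently small `t` the map
  `ψ_t` is a diffeomorphism of a fixed neighbourhood of `x₀` onto an open set, on which
  `φ_t ∘ σ ∘ ψ_t⁻¹` is a solution, including the boundary condition. -/
def FlowPreservesSolutions [IsManifold I 1 M] {p : M → X} {Θ : DForm I M (n + 1)} {d : ℕ}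
    {B : Type*} [TopologicalSpace B] [ChartedSpace (EuclideanSpace ℝ (Fin d)) B]
    (bc : BoundaryCondition p Θ d B) (D : Set (ℝ × M)) (φ : ℝ → M → M) : Prop :=
  ∀ (U : Set X) (σ : X → M), IsSolution bc U σ →
    (∀ (t : ℝ) (Ψ : OpenPartialHomeomorph X X), IsBaseMap (n := n) p D φ U σ t Ψ →
      SolvesFieldEquations p (multisymplecticForm Θ) Ψ.target (transform φ σ t Ψ) ∧
      (IsClosed (range bc.incl) → IsSolution bc Ψ.target (transform φ σ t Ψ))) ∧
    ∀ x₀ ∈ U, ((0 : ℝ), σ x₀) ∈ D → ∃ ε > 0, ∃ W : Set X, x₀ ∈ W ∧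
      ∀ t : ℝ, |t| < ε → ∃ Ψ : OpenPartialHomeomorph X X, Ψ.source = W ∧
        IsBaseMap (n := n) p D φ U σ t Ψ ∧ IsSolution bc Ψ.target (transform φ σ t Ψ)

end Solutions

end FieldTheory

end

open FieldTheory

set_option linter.unusedSectionVars false

noncomputable section

namespace FieldTheory

section

section Calculus

variable {E : Type*} [NormedAddCommGroup E] [NormedSpace ℝ E]
  {V : Type*} [NormedAddCommGroup V] [NormedSpace ℝ V]

variable (E) in
theorem contDiff_curryLeft (k : ℕ) :
    ContDiff ℝ ∞ (fun θ : E [⋀^Fin (k + 1)]→L[ℝ] ℝ => θ.curryLeft) :=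
  IsBoundedLinearMap.contDiff (𝕜 := ℝ) (E := E [⋀^Fin (k + 1)]→L[ℝ] ℝ)
    (F := E →L[ℝ] E [⋀^Fin k]→L[ℝ] ℝ) ⟨⟨fun _ _ => rfl, fun _ _ => rfl⟩, 1, one_pos, fun θ => by
      rw [one_mul]
      exact θ.norm_curryLeft.le⟩

theorem neg_one_pow_smul_map_vecCons_removeNth {k : ℕ} (θ : E [⋀^Fin (k + 1)]→L[ℝ] ℝ) (a : E)
    (w : Fin (k + 1) → E) (i : Fin (k + 1)) :
    (-1 : ℤ) ^ (i : ℕ) • θ (Matrix.vecCons a (i.removeNth w)) = θ (Function.update w i a) := by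
  have h := ContinuousAlternatingMap.neg_one_pow_smul_map_insertNth θ i a (i.removeNth w)
  rw [Fin.insertNth_removeNth] at h
  rw [← h, smul_smul, ← mul_pow]
  simp

theorem hasFDerivWithinAt_curryLeft_apply {k : ℕ} {Ω : E → E [⋀^Fin (k + 1)]→L[ℝ] ℝ} {ξ : E → E}
    {s : Set E} {x : E} (hΩ : DifferentiableWithinAt ℝ Ω s x) (hξ : DifferentiableWithinAt ℝ ξ s x)
    (hs : UniqueDiffWithinAt ℝ s x) (v : Fin k → E) (a : E) :
    fderivWithin ℝ (fun y => (Ω y).curryLeft (ξ y) v) s x a =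
      fderivWithin ℝ Ω s x a (Matrix.vecCons (ξ x) v) +
        Ω x (Matrix.vecCons (fderivWithin ℝ ξ s x a) v) := by
  have h := fderivWithin_continuousAlternatingMap_apply_apply (f := Ω)
    (g := fun i y => (Matrix.vecCons (ξ y) v : Fin (k + 1) → E) i) hΩ (fun i => by
      refine Fin.cases ?_ (fun j => ?_) i
      · exact hξ
      · exact differentiableWithinAt_const _) hs a
  refine h.trans ?_
  congr 1
  rw [Fin.sum_univ_succ, Finset.sum_eq_zero, add_zero]
  · congr 1
    exact funext fun i => Fin.cases (by simp) (fun j => by simp) i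
  · intro j _
    have h0 : fderivWithin ℝ (fun y => (Matrix.vecCons (ξ y) v : Fin (k + 1) → E) j.succ) s x a
        = 0 := by
      simp
    rw [h0]
    exact (Ω x).map_coord_zero j.succ (by simp)

/-- If `Ω` and `ι_ξ Ω` are closed at `x`, then `£_ξ Ω = 0` there, in the form of the Leibniz rule
for the derivative along `ξ`. -/
theorem fderivWithin_add_sum_eq_zero_of_closed {k : ℕ} {Ω : E → E [⋀^Fin (k + 1)]→L[ℝ] ℝ}
    {ξ : E → E} {s : Set E} {x : E} (hΩ : DifferentiableWithinAt ℝ Ω s x)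
    (hξ : DifferentiableWithinAt ℝ ξ s x) (hs : UniqueDiffWithinAt ℝ s x)
    (h1 : extDerivWithin Ω s x = 0)
    (h2 : extDerivWithin (fun y => (Ω y).curryLeft (ξ y)) s x = 0) (w : Fin (k + 1) → E) :
    fderivWithin ℝ Ω s x (ξ x) w +
      ∑ i, Ω x (Function.update w i (fderivWithin ℝ ξ s x (w i))) = 0 := by
  have hι : DifferentiableWithinAt ℝ (fun y => (Ω y).curryLeft (ξ y)) s x := by
    have h := (contDiff_curryLeft E k).differentiable (by simp) (Ω x)
    exact (h.comp_differentiableWithinAt x hΩ).clm_apply hξ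
  have e1 := DFunLike.congr_fun h1 (Matrix.vecCons (ξ x) w)
  have e2 := DFunLike.congr_fun h2 w
  rw [extDerivWithin_apply hΩ hs, Fin.sum_univ_succ] at e1
  rw [extDerivWithin_apply hι hs] at e2
  simp only [hasFDerivWithinAt_curryLeft_apply hΩ hξ hs, smul_add,
    neg_one_pow_smul_map_vecCons_removeNth, Finset.sum_add_distrib] at e2
  simp only [fderivWithin_continuousAlternatingMap_apply_const_apply hs hΩ] at e1
  have e3 : ∀ i : Fin (k + 1), (-1 : ℤ) ^ (i.succ : ℕ) • (fderivWithin ℝ Ω s x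
      (Matrix.vecCons (ξ x) w i.succ)) (i.succ.removeNth (Matrix.vecCons (ξ x) w)) =
      - ((-1 : ℤ) ^ (i : ℕ) • (fderivWithin ℝ Ω s x (w i))
        (Matrix.vecCons (ξ x) (i.removeNth w))) := by
    intro i
    have : i.succ.removeNth (Matrix.vecCons (ξ x) w) = Matrix.vecCons (ξ x) (i.removeNth w) := by
      funext j
      refine Fin.cases ?_ (fun j => ?_) j <;> simp [Fin.removeNth]
    rw [this, Fin.val_succ, pow_succ]
    simp
  rw [Finset.sum_congr rfl fun i _ => e3 i, Finset.sum_neg_distrib] at e1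
  simp only [neg_one_pow_smul_map_vecCons_removeNth] at e1
  have e4 : (-1 : ℤ) ^ ((0 : Fin (k + 1 + 1)) : ℕ) • (fderivWithin ℝ Ω s x
      (Matrix.vecCons (ξ x) w 0)) ((0 : Fin (k + 1 + 1)).removeNth (Matrix.vecCons (ξ x) w)) =
      fderivWithin ℝ Ω s x (ξ x) w := by
    have : (0 : Fin (k + 1 + 1)).removeNth (Matrix.vecCons (ξ x) w) = w := by
      funext j
      simp [Fin.removeNth]
    rw [this]
    simp
  rw [e4] at e1
  change _ = (0 : ℝ) at e1 e2
  linarith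

theorem hasDerivAt_contraction {k : ℕ} {Ω : E → E [⋀^Fin (k + 1)]→L[ℝ] ℝ} {ξ : E → E}
    {R : Set E} {c : ℝ → E} {J : ℝ → V →L[ℝ] E} {s : ℝ}
    (hΩ : DifferentiableWithinAt ℝ Ω R (c s))
    (hlie : ∀ w : Fin (k + 1) → E, fderivWithin ℝ Ω R (c s) (ξ (c s)) w +
      ∑ i, Ω (c s) (Function.update w i (fderivWithin ℝ ξ R (c s) (w i))) = 0)
    (hc : HasDerivAt c (ξ (c s)) s) (hcR : ∀ᶠ s' in 𝓝 s, c s' ∈ R)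
    (hJ : HasDerivAt J ((fderivWithin ℝ ξ R (c s)).comp (J s)) s) (ζ : E) (v : Fin k → V) :
    HasDerivAt (fun s => Ω (c s) (Matrix.vecCons ζ fun j => J s (v j)))
      (-(Ω (c s) (Matrix.vecCons (fderivWithin ℝ ξ R (c s) ζ) fun j => J s (v j)))) s := by
  have h1 : HasDerivAt (fun s => Ω (c s)) (fderivWithin ℝ Ω R (c s) (ξ (c s))) s :=
    hΩ.hasFDerivWithinAt.comp_hasDerivAt s hc hcR
  have h2 : ∀ i : Fin (k + 1), HasFDerivAt
      (fun s => (Matrix.vecCons ζ (fun j => J s (v j)) : Fin (k + 1) → E) i)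
      (ContinuousLinearMap.toSpanSingleton ℝ
        ((Matrix.vecCons 0 (fun j => fderivWithin ℝ ξ R (c s) (J s (v j))) :
        Fin (k + 1) → E) i)) s := by
    intro i
    refine Fin.cases ?_ (fun j => ?_) i
    · simpa using hasFDerivAt_const ζ s
    · have := (hJ.clm_apply (hasDerivAt_const s (v j))).hasFDerivAt
      simpa using this
  have h3 := (h1.hasFDerivAt.continuousAlternatingMap_apply h2).hasDerivAt
  refine h3.congr_deriv ?_
  have h4 := hlie (Matrix.vecCons ζ fun j => J s (v j))
  rw [Fin.sum_univ_succ] at h4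
  simp only [add_apply, ContinuousLinearMap.comp_apply, sum_apply]
  rw [Fin.sum_univ_succ]
  simp only [Matrix.cons_val_zero, Matrix.cons_val_succ,
    ContinuousLinearMap.toSpanSingleton_apply, one_smul,
    ContinuousAlternatingMap.apply_apply] at h4 ⊢
  have h5 : Function.update (Matrix.vecCons ζ fun j => J s (v j)) 0 (fderivWithin ℝ ξ R (c s) ζ) =
      Matrix.vecCons (fderivWithin ℝ ξ R (c s) ζ) fun j => J s (v j) :=
    funext fun i => Fin.cases (by simp) (fun j => by simp) i
  rw [h5] at h4
  rw [map_zero, zero_add]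
  change _ + ∑ i : Fin k, (Ω (c s)) (Function.update (Matrix.vecCons ζ fun j => (J s) (v j)) i.succ
    (fderivWithin ℝ ξ R (c s) (J s (v i)))) = _
  linarith

/-- A solution of a linear equation `b' = -b ∘ A` on the dual space which vanishes at one point
vanishes at all nearby points, and conversely. -/
theorem eventually_eq_zero_iff_of_hasDerivAt [FiniteDimensional ℝ E] {b : ℝ → E →L[ℝ] ℝ}
    {A : ℝ → E →L[ℝ] E} {s₀ : ℝ} (hA : ContinuousAt A s₀)
    (hb : ∀ᶠ s in 𝓝 s₀, ∀ ζ, HasDerivAt (fun s => b s ζ) (-(b s (A s ζ))) s) :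
    ∀ᶠ s in 𝓝 s₀, (b s = 0 ↔ b s₀ = 0) := by
  let B := Module.finBasis ℝ E
  let Φ : (E →L[ℝ] ℝ) ≃L[ℝ] (Fin (Module.finrank ℝ E) → ℝ) :=
    ((LinearMap.toContinuousLinearMap (𝕜 := ℝ) (E := E) (F' := ℝ)).symm.trans
      (B.constr ℝ).symm).toContinuousLinearEquiv
  have hΦ : ∀ f i, Φ f i = f (B i) := fun f i => rfl
  have hb' : ∀ᶠ s in 𝓝 s₀, HasDerivAt b (-((b s).comp (A s))) s := by
    filter_upwards [hb] with s hs
    have h1 : HasDerivAt (fun s => Φ (b s)) (Φ (-((b s).comp (A s)))) s := by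
      rw [hasDerivAt_pi]
      intro i
      exact hs (B i)
    have h2 := Φ.symm.toContinuousLinearMap.hasFDerivAt.comp_hasDerivAt s h1
    simpa [Function.comp_def] using h2
  have hK : ∀ᶠ s in 𝓝 s₀, ‖A s‖ < ‖A s₀‖ + 1 :=
    hA.norm.eventually_lt_const (by linarith)
  obtain ⟨ε, hε, h⟩ := Metric.eventually_nhds_iff_ball.1 (hb'.and hK)
  have key : ∀ t₀ ∈ Metric.ball s₀ ε, b t₀ = 0 → ∀ t ∈ Metric.ball s₀ ε, b t = 0 := by
    intro t₀ ht₀ h0 t ht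
    rw [Real.ball_eq_Ioo] at *
    have hK0 : (0 : ℝ) ≤ ‖A s₀‖ + 1 := by positivity
    exact ODE_solution_unique_of_mem_Ioo (v := fun s x => -(x.comp (A s))) (s := fun _ => univ)
      (K := ⟨‖A s₀‖ + 1, hK0⟩) (f := b) (g := fun _ => 0)
      (fun s hs => by
        refine (LipschitzWith.of_dist_le_mul fun x y => ?_).lipschitzOnWith
        rw [dist_neg_neg, dist_eq_norm, dist_eq_norm, ← ContinuousLinearMap.sub_comp, mul_comm]
        refine (ContinuousLinearMap.opNorm_comp_le _ _).trans ?_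
        exact mul_le_mul_of_nonneg_left (h s hs).2.le (norm_nonneg _))
      ht₀ (fun s hs => ⟨(h s hs).1, mem_univ _⟩)
      (fun s _ => ⟨by simpa using hasDerivAt_const s (0 : E →L[ℝ] ℝ), mem_univ _⟩) h0 ht
  filter_upwards [Metric.ball_mem_nhds s₀ hε] with s hs
  exact ⟨fun h => key s hs h s₀ (Metric.mem_ball_self hε),
    fun h => key s₀ (Metric.mem_ball_self hε) h s hs⟩

theorem uniqueDiffOn_univ_prod {S : Set V} (hS : UniqueDiffOn ℝ S) :
    UniqueDiffOn ℝ ((univ : Set ℝ) ×ˢ S) := uniqueDiffOn_univ.prod hS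

theorem hasFDerivWithinAt_slice {G : ℝ × V → E} {S : Set V} {s : ℝ} {u : V}
    (hG : DifferentiableWithinAt ℝ G (univ ×ˢ S) (s, u)) :
    HasFDerivWithinAt (fun u => G (s, u)) ((fderivWithin ℝ G (univ ×ˢ S) (s, u)).comp
      (ContinuousLinearMap.inr ℝ ℝ V)) S u :=
  hG.hasFDerivWithinAt.comp u (hasFDerivAt_prodMk_right s u).hasFDerivWithinAt
    fun _ hu => ⟨mem_univ _, hu⟩

theorem hasDerivAt_slice {G : ℝ × V → E} {S : Set V} {s : ℝ} {u : V} (hu : u ∈ S)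
    (hG : DifferentiableWithinAt ℝ G (univ ×ˢ S) (s, u)) :
    HasDerivAt (fun s => G (s, u)) (fderivWithin ℝ G (univ ×ˢ S) (s, u) (1, 0)) s := by
  have h := hG.hasFDerivWithinAt.comp s (t := univ ×ˢ S) (s := univ)
    (f := fun s' => (s', u)) (hasFDerivAt_prodMk_left s u).hasFDerivWithinAt
    (fun _ _ => ⟨mem_univ _, hu⟩)
  rw [hasFDerivWithinAt_univ] at h
  exact h.hasDerivAt

/-- Symmetry of mixed second derivatives with respect to a parameter, up to the boundary. -/
theorem hasDerivAt_fderivWithin_slice {G : ℝ × V → E} {S : Set V} {s : ℝ} {u : V}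
    (hS : UniqueDiffOn ℝ S) (hu : u ∈ S) (hu' : u ∈ closure (interior S))
    (hG : ContDiffWithinAt ℝ 2 G (univ ×ˢ S) (s, u)) :
    HasDerivAt (fun s => fderivWithin ℝ (fun u => G (s, u)) S u)
      (fderivWithin ℝ (fun u => deriv (fun s => G (s, u)) s) S u) s := by
  set Q : Set (ℝ × V) := univ ×ˢ S with hQ
  have hQu : UniqueDiffOn ℝ Q := uniqueDiffOn_univ_prod hS
  have hmem : ∀ s', ∀ u' ∈ S, (s', u') ∈ Q := fun s' u' h => ⟨mem_univ _, h⟩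
  have hint : (s, u) ∈ closure (interior Q) := by
    rw [hQ, interior_prod_eq, closure_prod_eq]
    exact ⟨by simp, hu'⟩
  have hsymm := hG.isSymmSndFDerivWithinAt (by simp) hQu hint (hmem s u hu)
  set D := fderivWithin ℝ G Q with hD
  have hDd : DifferentiableWithinAt ℝ D Q (s, u) :=
    (hG.fderivWithin_right hQu (m := 1) (by norm_num) (hmem s u hu)).differentiableWithinAt (by simp)
  have hev : ∀ᶠ p in 𝓝[Q] (s, u), DifferentiableWithinAt ℝ G Q p := by
    obtain ⟨U, hU, hsU, h⟩ := hG.contDiffOn' le_rfl (by simp)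
    rw [insert_eq_of_mem (hmem s u hu)] at h
    filter_upwards [inter_mem_nhdsWithin Q (hU.mem_nhds hsU)] with p hp
    exact ((h.differentiableOn (by simp)) p hp).mono_of_mem_nhdsWithin
      (inter_mem_nhdsWithin Q (hU.mem_nhds hp.2))
  have hev1 : ∀ᶠ s' in 𝓝 s, DifferentiableWithinAt ℝ G Q (s', u) := by
    have ht : Filter.Tendsto (fun s' : ℝ => (s', u)) (𝓝 s) (𝓝[Q] (s, u)) :=
      tendsto_nhdsWithin_iff.2 ⟨(Continuous.prodMk_left u).tendsto s,
        Filter.Eventually.of_forall fun s' => hmem s' u hu⟩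
    exact ht.eventually hev
  have hev2 : ∀ᶠ u' in 𝓝[S] u, DifferentiableWithinAt ℝ G Q (s, u') := by
    have ht : Filter.Tendsto (fun u' : V => (s, u')) (𝓝[S] u) (𝓝[Q] (s, u)) :=
      tendsto_nhdsWithin_iff.2 ⟨((Continuous.prodMk_right s).tendsto u).mono_left
        nhdsWithin_le_nhds, by filter_upwards [self_mem_nhdsWithin] with u' h using hmem s u' h⟩
    exact ht.eventually hev
  have h1 : (fun s' => fderivWithin ℝ (fun u => G (s', u)) S u) =ᶠ[𝓝 s]
      fun s' => (D (s', u)).comp (ContinuousLinearMap.inr ℝ ℝ V) := by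
    filter_upwards [hev1] with s' h
    exact (hasFDerivWithinAt_slice h).fderivWithin (hS u hu)
  have h2 : (fun u' => deriv (fun s' => G (s', u')) s) =ᶠ[𝓝[S] u] fun u' => D (s, u') (1, 0) := by
    filter_upwards [hev2, self_mem_nhdsWithin] with u' h hu'
    exact (hasDerivAt_slice hu' h).deriv
  have h3 := (hasDerivAt_slice (G := D) hu hDd).clm_comp
    (hasDerivAt_const s (ContinuousLinearMap.inr ℝ ℝ V))
  have h4 : HasFDerivWithinAt (fun u' => D (s, u') (1, 0))
      (((fderivWithin ℝ D Q (s, u)).comp (ContinuousLinearMap.inr ℝ ℝ V)).flip (1, 0)) S u := by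
    have := (hasFDerivWithinAt_slice (G := D) hDd).clm_apply
      (hasFDerivWithinAt_const ((1, 0) : ℝ × V) u S)
    simpa using this
  rw [h2.fderivWithin_eq (h2.self_of_nhdsWithin hu), h4.fderivWithin (hS u hu)]
  refine (h3.congr_of_eventuallyEq h1).congr_deriv ?_
  ext v
  have := hsymm (1, 0) (0, v)
  simpa using this

end Calculus

end

section

section FormsInCharts

variable {E : Type*} [NormedAddCommGroup E] [NormedSpace ℝ E] {H : Type*} [TopologicalSpace H]
  {I : ModelWithCorners ℝ E H} {M : Type*} [TopologicalSpace M] [ChartedSpace H M] {k : ℕ}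

/-- The expression of the form `θ` in the chart `e`. -/
def DForm.inExtend (θ : DForm I M k) (e : OpenPartialHomeomorph M H) (u : E) :
    E [⋀^Fin k]→L[ℝ] ℝ :=
  (θ ((e.extend I).symm u)).compContinuousLinearMap
    (mfderivWithin 𝓘(ℝ, E) I (e.extend I).symm (range I) u)

theorem extend_target_mem_nhdsWithin_range {e : OpenPartialHomeomorph M H} {u : E}
    (hu : u ∈ (e.extend I).target) : (e.extend I).target ∈ 𝓝[range I] u := by
  have h := e.extend_target_mem_nhdsWithin (I := I) (y := (e.extend I).symm u)
    (by simpa using (e.extend I).map_target hu)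
  rwa [(e.extend I).right_inv hu] at h

theorem mem_range_of_mem_extend_target {e : OpenPartialHomeomorph M H} {u : E}
    (hu : u ∈ (e.extend I).target) : u ∈ range I := e.extend_target_subset_range hu

theorem extend_coe_mem_range (e : OpenPartialHomeomorph M H) (x : M) : e.extend I x ∈ range I :=
  ⟨e x, rfl⟩

theorem mem_closure_interior_range (u : E) (hu : u ∈ range I) :
    u ∈ closure (interior (range I)) := I.range_subset_closure_interior hu

theorem uniqueDiffWithinAt_range {u : E} (hu : u ∈ range I) : UniqueDiffWithinAt ℝ (range I) u :=
  I.uniqueDiffOn u hu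

variable [IsManifold I ∞ M]

theorem contMDiffWithinAt_extend_symm {e : OpenPartialHomeomorph M H}
    (he : e ∈ IsManifold.maximalAtlas I ∞ M) {u : E} (hu : u ∈ (e.extend I).target) :
    ContMDiffWithinAt 𝓘(ℝ, E) I ∞ (e.extend I).symm (range I) u := by
  have h := contMDiffOn_extend_symm he u (by rwa [← e.extend_target'])
  rw [← e.extend_target'] at h
  exact h.mono_of_mem_nhdsWithin (extend_target_mem_nhdsWithin_range hu)

theorem minSmoothness_two_le : minSmoothness ℝ 2 ≤ (∞ : WithTop ℕ∞) := by
  rw [minSmoothness_of_isRCLikeNormedField]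
  exact ENat.LEInfty.out

theorem contDiffWithinAt_coordChange {e e' : OpenPartialHomeomorph M H}
    (he : e ∈ IsManifold.maximalAtlas I ∞ M) (he' : e' ∈ IsManifold.maximalAtlas I ∞ M) {u : E}
    (hu : u ∈ (e.extend I).target) (hu' : (e.extend I).symm u ∈ e'.source) :
    ContDiffWithinAt ℝ ∞ (e'.extend I ∘ (e.extend I).symm) (range I) u :=
  I.contDiffWithinAt_extendCoordChange he he' ⟨hu, by simpa using hu'⟩

theorem mfderivWithin_extend_symm_comp {e e' : OpenPartialHomeomorph M H}
    (he : e ∈ IsManifold.maximalAtlas I ∞ M) (he' : e' ∈ IsManifold.maximalAtlas I ∞ M) {u : E}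
    (hu : u ∈ (e.extend I).target) (hu' : (e.extend I).symm u ∈ e'.source) (v : E) :
    (mfderivWithin 𝓘(ℝ, E) I (e'.extend I).symm (range I) (e'.extend I ((e.extend I).symm u))
      (fderivWithin ℝ (e'.extend I ∘ (e.extend I).symm) (range I) u v) : E) =
    mfderivWithin 𝓘(ℝ, E) I (e.extend I).symm (range I) u v := by
  set τ := e'.extend I ∘ (e.extend I).symm with hτ
  have hτu : τ u ∈ (e'.extend I).target := (e'.extend I).map_source (by simpa using hu')
  have hur := mem_range_of_mem_extend_target hu
  have hU : UniqueMDiffWithinAt 𝓘(ℝ, E) (range I) u := (I.uniqueDiffOn u hur).uniqueMDiffWithinAt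
  have hd1 : MDifferentiableWithinAt 𝓘(ℝ, E) I (e'.extend I).symm (range I) (τ u) :=
    (contMDiffWithinAt_extend_symm he' hτu).mdifferentiableWithinAt (by simp)
  have hd2 : MDifferentiableWithinAt 𝓘(ℝ, E) 𝓘(ℝ, E) τ (range I) u :=
    ((contDiffWithinAt_coordChange he he' hu hu').differentiableWithinAt
      (by simp)).mdifferentiableWithinAt
  have h1 := mfderivWithin_comp u hd1 hd2 (fun _ _ => extend_coe_mem_range _ _) hU
  have h2 : mfderivWithin 𝓘(ℝ, E) I ((e'.extend I).symm ∘ τ) (range I) u =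
      mfderivWithin 𝓘(ℝ, E) I (e.extend I).symm (range I) u := by
    apply Filter.EventuallyEq.mfderivWithin_eq_of_mem _ hur
    have hc : ContinuousWithinAt (e.extend I).symm (range I) u :=
      (contMDiffWithinAt_extend_symm he hu).continuousWithinAt
    filter_upwards [hc.preimage_mem_nhdsWithin (e'.open_source.mem_nhds hu')] with y hy
    exact e'.extend_left_inv hy
  rw [← h2, h1, mfderivWithin_eq_fderivWithin]
  rfl

/-- Change of charts for forms. -/
theorem DForm.inExtend_eq (θ : DForm I M k) {e e' : OpenPartialHomeomorph M H}
    (he : e ∈ IsManifold.maximalAtlas I ∞ M) (he' : e' ∈ IsManifold.maximalAtlas I ∞ M) {u : E}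
    (hu : u ∈ (e.extend I).target) (hu' : (e.extend I).symm u ∈ e'.source) :
    θ.inExtend e u = (θ.inExtend e' (e'.extend I ((e.extend I).symm u))).compContinuousLinearMap
      (fderivWithin ℝ (e'.extend I ∘ (e.extend I).symm) (range I) u) := by
  have key : ∀ x x' : M, x = x' → ∀ v v' : Fin k → E, v = v' →
      (θ x : E [⋀^Fin k]→L[ℝ] ℝ) v = (θ x' : E [⋀^Fin k]→L[ℝ] ℝ) v' := by
    rintro x _ rfl v _ rfl; rfl
  ext v
  refine key _ _ (e'.extend_left_inv hu').symm _ _ (funext fun i => ?_)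
  exact (mfderivWithin_extend_symm_comp he he' hu hu' (v i)).symm

theorem eventually_inExtend_eq (θ : DForm I M k) {e e' : OpenPartialHomeomorph M H}
    (he : e ∈ IsManifold.maximalAtlas I ∞ M) (he' : e' ∈ IsManifold.maximalAtlas I ∞ M) {u : E}
    (hu : u ∈ (e.extend I).target) (hu' : (e.extend I).symm u ∈ e'.source) :
    θ.inExtend e =ᶠ[𝓝[range I] u] fun u =>
      (θ.inExtend e' ((e'.extend I ∘ (e.extend I).symm) u)).compContinuousLinearMap
      (fderivWithin ℝ (e'.extend I ∘ (e.extend I).symm) (range I) u) := by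
  have hc : ContinuousWithinAt (e.extend I).symm (range I) u :=
    (contMDiffWithinAt_extend_symm he hu).continuousWithinAt
  filter_upwards [hc.preimage_mem_nhdsWithin (e'.open_source.mem_nhds hu'),
    extend_target_mem_nhdsWithin_range hu] with y hy hy'
  exact θ.inExtend_eq he he' hy' hy

theorem DForm.IsSmooth.contDiffWithinAt_inChart {θ : DForm I M k} (hθ : θ.IsSmooth) (x₀ : M)
    {u : E} (hu : u ∈ (extChartAt I x₀).target) :
    ContDiffWithinAt ℝ ∞ (θ.inChart x₀) (range I) u :=
  (hθ x₀ u hu).mono_of_mem_nhdsWithin (extChartAt_target_mem_nhdsWithin_of_mem hu)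

/-- A smooth form is smooth in every chart of the maximal atlas. -/
theorem DForm.IsSmooth.contDiffWithinAt_inExtend [FiniteDimensional ℝ E] {θ : DForm I M k}
    (hθ : θ.IsSmooth) {e : OpenPartialHomeomorph M H} (he : e ∈ IsManifold.maximalAtlas I ∞ M)
    {u : E} (hu : u ∈ (e.extend I).target) :
    ContDiffWithinAt ℝ ∞ (θ.inExtend e) (range I) u := by
  set x := (e.extend I).symm u with hx
  have hx' : x ∈ (chartAt H x).source := mem_chart_source H x
  have hc := IsManifold.chart_mem_maximalAtlas (I := I) (n := ∞) x
  have hτ := contDiffWithinAt_coordChange he hc hu hx'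
  have h1 := eventually_inExtend_eq θ he hc hu hx'
  have h2 : ContDiffWithinAt ℝ ∞ (θ.inExtend (chartAt H x) ∘
      ((chartAt H x).extend I ∘ (e.extend I).symm)) (range I) u :=
    (hθ.contDiffWithinAt_inChart x (u := ((chartAt H x).extend I ∘ (e.extend I).symm) u)
      (mem_extChartAt_target x)).comp u hτ fun _ _ => extend_coe_mem_range _ _
  have hur := mem_range_of_mem_extend_target hu
  have h3 := hτ.fderivWithin_right I.uniqueDiffOn (m := ∞) le_rfl hur
  exact (((contDiff_compContinuousLinearMap k E).contDiffAt.comp_contDiffWithinAt u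
    (h2.prodMk h3))).congr_of_eventuallyEq h1 (h1.self_of_nhdsWithin hur)

/-- In a chart, `DForm.d` is the exterior derivative of the coordinate expression. -/
theorem DForm.inChart_d [FiniteDimensional ℝ E] {θ : DForm I M k} (hθ : θ.IsSmooth) (x₀ : M)
    {u : E} (hu : u ∈ (extChartAt I x₀).target) :
    θ.d.inChart x₀ u = extDerivWithin (θ.inChart x₀) (range I) u := by
  set x := (extChartAt I x₀).symm u with hx
  have hx' : x ∈ (chartAt H x).source := mem_chart_source H x
  have hc₀ := IsManifold.chart_mem_maximalAtlas (I := I) (n := ∞) x₀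
  have hc := IsManifold.chart_mem_maximalAtlas (I := I) (n := ∞) x
  have hur : u ∈ range I := extChartAt_target_subset_range x₀ hu
  set τ := extChartAt I x ∘ (extChartAt I x₀).symm with hτdef
  have hτ : ContDiffWithinAt ℝ ∞ τ (range I) u := contDiffWithinAt_coordChange hc₀ hc hu hx'
  have h1 := eventually_inExtend_eq θ hc₀ hc hu hx'
  have h2 : extDerivWithin (θ.inChart x₀) (range I) u =
      (extDerivWithin (θ.inChart x) (range I) (τ u)).compContinuousLinearMap
        (fderivWithin ℝ τ (range I) u) := by
    refine (h1.extDerivWithin_eq_of_mem hur).trans ?_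
    exact extDerivWithin_pullback (r := ∞) (t := range I)
      ((hθ.contDiffWithinAt_inChart x (mem_extChartAt_target x)).differentiableWithinAt (by simp))
      hτ minSmoothness_two_le I.uniqueDiffOn (mem_closure_interior_range u hur) hur
      fun _ _ => extend_coe_mem_range _ _
  rw [h2]
  have h3 : ∀ v : E, mfderiv I 𝓘(ℝ, E) (extChartAt I x) x
      (mfderivWithin 𝓘(ℝ, E) I (extChartAt I x₀).symm (range I) u v) =
      fderivWithin ℝ τ (range I) u v := by
    intro v
    have := mfderiv_comp_mfderivWithin u (mdifferentiableAt_extChartAt hx')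
      (mdifferentiableWithinAt_extChartAt_symm hu) (I.uniqueDiffOn u hur).uniqueMDiffWithinAt
    rw [mfderivWithin_eq_fderivWithin] at this
    rw [hτdef, this]
    rfl
  ext v
  change extDerivWithin (θ.inChart x) (range I) (τ u) _ = extDerivWithin (θ.inChart x) (range I) (τ u) _
  refine congrArg _ (funext fun i => ?_)
  exact h3 (v i)

theorem contDiffWithinAt_extDerivWithin {θ : E → E [⋀^Fin k]→L[ℝ] ℝ} {s : Set E} {u : E}
    (hθ : ContDiffWithinAt ℝ ∞ θ s u) (hs : UniqueDiffOn ℝ s) (hu : u ∈ s) :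
    ContDiffWithinAt ℝ ∞ (extDerivWithin θ s) s u := by
  have h := hθ.fderivWithin_right hs (m := ∞) le_rfl hu
  exact (ContinuousAlternatingMap.alternatizeUncurryFinCLM ℝ E ℝ
    (n := k)).contDiff.contDiffAt.comp_contDiffWithinAt u h

theorem DForm.IsSmooth.d [FiniteDimensional ℝ E] {θ : DForm I M k} (hθ : θ.IsSmooth) :
    θ.d.IsSmooth := fun x₀ u hu => by
  have hur : u ∈ range I := extChartAt_target_subset_range x₀ hu
  have h := (contDiffWithinAt_extDerivWithin (hθ.contDiffWithinAt_inChart x₀ hu)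
    I.uniqueDiffOn hur).mono (extChartAt_target_subset_range x₀)
  exact h.congr (fun y hy => DForm.inChart_d hθ x₀ hy) (DForm.inChart_d hθ x₀ hu)

end FormsInCharts

section VectorFieldsInCharts

variable {E : Type*} [NormedAddCommGroup E] [NormedSpace ℝ E] {H : Type*} [TopologicalSpace H]
  {I : ModelWithCorners ℝ E H} {M : Type*} [TopologicalSpace M] [ChartedSpace H M] {k : ℕ}

/-- The expression of a vector field in the preferred chart around `x₀`. -/
def VField.inChart (ξ : VField I M) (x₀ : M) (u : E) : E :=
  VectorField.mpullbackWithin 𝓘(ℝ, E) I (extChartAt I x₀).symm ξ (range I) u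

variable [IsManifold I ∞ M]

theorem VField.mfderivWithin_inChart (ξ : VField I M) (x₀ : M) {u : E}
    (hu : u ∈ (extChartAt I x₀).target) :
    mfderivWithin 𝓘(ℝ, E) I (extChartAt I x₀).symm (range I) u (ξ.inChart x₀ u) =
      ξ ((extChartAt I x₀).symm u) :=
  (isInvertible_mfderivWithin_extChartAt_symm hu).self_apply_inverse _

theorem VField.mfderiv_extChartAt_apply (ξ : VField I M) (x₀ : M) {x : M}
    (hx : x ∈ (chartAt H x₀).source) :
    mfderiv I 𝓘(ℝ, E) (extChartAt I x₀) x (ξ x) = ξ.inChart x₀ (extChartAt I x₀ x) := by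
  have hx' : x ∈ (extChartAt I x₀).source := by rwa [extChartAt_source]
  have hu := (extChartAt I x₀).map_source hx'
  have h1 := ξ.mfderivWithin_inChart x₀ hu
  have h2 := DFunLike.congr_fun (mfderiv_extChartAt_comp_mfderivWithin_extChartAt_symm hu)
    (ξ.inChart x₀ (extChartAt I x₀ x))
  have key : ∀ x' : M, x' = x → (mfderiv I 𝓘(ℝ, E) (extChartAt I x₀) x' (ξ x') : E) =
      mfderiv I 𝓘(ℝ, E) (extChartAt I x₀) x (ξ x) := by rintro _ rfl; rfl
  rw [← key _ ((extChartAt I x₀).left_inv hx'), ← h1]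
  exact h2

theorem VField.IsSmooth.contDiffWithinAt_inChart [CompleteSpace E] {ξ : VField I M}
    (hξ : ξ.IsSmooth) (x₀ : M) {u : E} (hu : u ∈ (extChartAt I x₀).target) :
    ContDiffWithinAt ℝ ∞ (ξ.inChart x₀) (range I) u := by
  have hur : u ∈ range I := extChartAt_target_subset_range x₀ hu
  have h := ContMDiffWithinAt.mpullbackWithin_vectorField_of_mem (m := ∞) (n := ∞)
    (f := (extChartAt I x₀).symm) (s := range I) (t := univ) (x₀ := u)
    (hξ _).contMDiffWithinAt (contMDiffWithinAt_extChartAt_symm_range x₀ hu)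
    (isInvertible_mfderivWithin_extChartAt_symm hu) hur
    (fun y hy => (I.uniqueDiffOn y hy).uniqueMDiffWithinAt) le_rfl Filter.univ_mem
  exact contMDiffWithinAt_vectorSpace_iff_contDiffWithinAt.1 h

theorem DForm.inChart_interior (ξ : VField I M) (θ : DForm I M (k + 1)) (x₀ : M) {u : E}
    (hu : u ∈ (extChartAt I x₀).target) :
    (θ.interior ξ).inChart x₀ u = (θ.inChart x₀ u).curryLeft (ξ.inChart x₀ u) := by
  ext v
  change θ _ (Matrix.vecCons (ξ _) _) = θ _ _
  rw [← ξ.mfderivWithin_inChart x₀ hu]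
  refine congrArg _ (funext fun i => ?_)
  exact Fin.cases rfl (fun j => rfl) i

theorem contDiffWithinAt_curryLeft_apply {θ : E → E [⋀^Fin (k + 1)]→L[ℝ] ℝ} {ξ : E → E}
    {s : Set E} {u : E} (hθ : ContDiffWithinAt ℝ ∞ θ s u) (hξ : ContDiffWithinAt ℝ ∞ ξ s u) :
    ContDiffWithinAt ℝ ∞ (fun u => (θ u).curryLeft (ξ u)) s u :=
  ((contDiff_curryLeft E k).contDiffAt.comp_contDiffWithinAt u hθ).clm_apply hξ

theorem DForm.IsSmooth.interior [CompleteSpace E] {ξ : VField I M} {θ : DForm I M (k + 1)}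
    (hθ : θ.IsSmooth) (hξ : ξ.IsSmooth) : (θ.interior ξ).IsSmooth := fun x₀ u hu => by
  have h := (contDiffWithinAt_curryLeft_apply (hθ.contDiffWithinAt_inChart x₀ hu)
    (hξ.contDiffWithinAt_inChart x₀ hu)).mono (extChartAt_target_subset_range x₀)
  exact h.congr (fun y hy => DForm.inChart_interior ξ θ x₀ hy) (DForm.inChart_interior ξ θ x₀ hu)

theorem DForm.inChart_add (θ θ' : DForm I M k) (x₀ : M) (u : E) :
    (θ + θ').inChart x₀ u = θ.inChart x₀ u + θ'.inChart x₀ u := rfl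

theorem extDerivWithin_extDerivWithin_inChart {θ : DForm I M k} (hθ : θ.IsSmooth) (x₀ : M) {u : E}
    (hu : u ∈ (extChartAt I x₀).target) :
    extDerivWithin (extDerivWithin (θ.inChart x₀) (range I)) (range I) u = 0 :=
  extDerivWithin_extDerivWithin_apply (hθ.contDiffWithinAt_inChart x₀ hu) minSmoothness_two_le
    I.uniqueDiffOn (mem_closure_interior_range u (extChartAt_target_subset_range x₀ hu))
    (extChartAt_target_subset_range x₀ hu)

/-- In a chart, `£_ξ dΘ = 0` if `£_ξ Θ` is exact. -/
theorem fderivWithin_add_sum_eq_zero_of_lieDeriv_eq_d [FiniteDimensional ℝ E] {ξ : VField I M}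
    (hξ : ξ.IsSmooth) {Θ : DForm I M (k + 1)} (hΘ : Θ.IsSmooth) {α : DForm I M k}
    (hα : α.IsSmooth) (h : DForm.lieDeriv ξ Θ = α.d) (x₀ : M) {u : E}
    (hu : u ∈ (extChartAt I x₀).target) (w : Fin (k + 2) → E) :
    fderivWithin ℝ (Θ.d.inChart x₀) (range I) u (ξ.inChart x₀ u) w +
      ∑ i, Θ.d.inChart x₀ u
        (Function.update w i (fderivWithin ℝ (ξ.inChart x₀) (range I) u (w i))) = 0 := by
  have : CompleteSpace E := FiniteDimensional.complete ℝ E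
  have hur : u ∈ range I := extChartAt_target_subset_range x₀ hu
  have hs := I.uniqueDiffOn u hur
  have hd := fun {l : ℕ} {θ : DForm I M l} (hθ : θ.IsSmooth) =>
    (hθ.contDiffWithinAt_inChart x₀ hu).differentiableWithinAt (n := ∞) (by simp)
  have hev : ∀ {l : ℕ} {θ : DForm I M l} (_ : θ.IsSmooth),
      θ.d.inChart x₀ =ᶠ[𝓝[range I] u] extDerivWithin (θ.inChart x₀) (range I) := by
    intro l θ hθ
    filter_upwards [extChartAt_target_mem_nhdsWithin_of_mem hu] with y hy
    exact DForm.inChart_d hθ x₀ hy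
  have hdd : ∀ {l : ℕ} {θ : DForm I M l} (_ : θ.IsSmooth),
      extDerivWithin (θ.d.inChart x₀) (range I) u = 0 := fun hθ =>
    ((hev hθ).extDerivWithin_eq_of_mem hur).trans (extDerivWithin_extDerivWithin_inChart hθ x₀ hu)
  refine fderivWithin_add_sum_eq_zero_of_closed (hd hΘ.d)
    ((hξ.contDiffWithinAt_inChart x₀ hu).differentiableWithinAt (by simp)) hs (hdd hΘ) ?_ w
  have h1 : (fun y => (Θ.d.inChart x₀ y).curryLeft (ξ.inChart x₀ y)) =ᶠ[𝓝[range I] u]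
      fun y => (α.d.inChart x₀ y) + (-1 : ℝ) • ((Θ.interior ξ).d.inChart x₀ y) := by
    filter_upwards [extChartAt_target_mem_nhdsWithin_of_mem hu] with y hy
    have h2 : (Θ.d.interior ξ).inChart x₀ y + (Θ.interior ξ).d.inChart x₀ y =
      α.d.inChart x₀ y := by rw [← DForm.inChart_add, ← h]; rfl
    rw [← DForm.inChart_interior ξ Θ.d x₀ hy, ← h2]
    have key : ∀ a b : E [⋀^Fin (k + 1)]→L[ℝ] ℝ, a = a + b + (-1 : ℝ) • b := fun a b => by
      ext v
      simp
    exact key _ _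
  have hι := (hΘ.interior hξ)
  rw [h1.extDerivWithin_eq_of_mem hur, extDerivWithin_fun_add (ω₂ := fun y => (-1 : ℝ) • ((Θ.interior ξ).d.inChart x₀ y)) hs (hd hα.d)
    ((hd hι.d).const_smul (-1 : ℝ)), extDerivWithin_fun_smul _ _ hs, hdd hα, hdd hι]
  simp

end VectorFieldsInCharts

end

section

section Families

variable {V : Type*} [NormedAddCommGroup V] [NormedSpace ℝ V] {H' : Type*} [TopologicalSpace H']
  {J : ModelWithCorners ℝ V H'} {X : Type*} [TopologicalSpace X] [ChartedSpace H' X]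
  {E : Type*} [NormedAddCommGroup E] [NormedSpace ℝ E] {H : Type*} [TopologicalSpace H]
  {I : ModelWithCorners ℝ E H} {M : Type*} [TopologicalSpace M] [ChartedSpace H M]

/-- The expression of a one-parameter family of maps in the preferred charts around `x₀`, `y₀`. -/
def familyInChart (J : ModelWithCorners ℝ V H') (I : ModelWithCorners ℝ E H) (F : ℝ → X → M)
    (x₀ : X) (y₀ : M) (p : ℝ × V) : E :=
  extChartAt I y₀ (F p.1 ((extChartAt J x₀).symm p.2))

theorem contDiffWithinAt_familyInChart {F : ℝ → X → M} {s₀ : ℝ} {x₀ : X}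
    (hF : ContMDiffAt (𝓘(ℝ, ℝ).prod J) I ∞ (fun q : ℝ × X => F q.1 q.2) (s₀, x₀)) :
    ContDiffWithinAt ℝ ∞ (familyInChart J I F x₀ (F s₀ x₀)) (univ ×ˢ range J)
      (s₀, extChartAt J x₀ x₀) := by
  have h := (contMDiffAt_iff.1 hF).2
  rw [extChartAt_prod, ModelWithCorners.range_prod, modelWithCornersSelf_coe, range_id] at h
  exact h

theorem eventually_slice {S : Set V} {s₀ : ℝ} {u₀ : V} (hu₀ : u₀ ∈ S) {P : ℝ × V → Prop}
    (h : ∀ᶠ p in 𝓝[univ ×ˢ S] (s₀, u₀), P p) :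
    ∀ᶠ s in 𝓝 s₀, P (s, u₀) ∧ ∀ᶠ u in 𝓝[S] u₀, P (s, u) := by
  have h1 := (eventually_eventually_nhdsWithin.2 h)
  have ht : Filter.Tendsto (fun s' : ℝ => (s', u₀)) (𝓝 s₀) (𝓝[univ ×ˢ S] (s₀, u₀)) :=
    tendsto_nhdsWithin_iff.2 ⟨(Continuous.prodMk_left u₀).tendsto s₀,
      Filter.Eventually.of_forall fun s' => ⟨mem_univ _, hu₀⟩⟩
  filter_upwards [ht.eventually h1] with s hs
  have ht' : Filter.Tendsto (fun u' : V => (s, u')) (𝓝[S] u₀) (𝓝[univ ×ˢ S] (s, u₀)) :=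
    tendsto_nhdsWithin_iff.2 ⟨((Continuous.prodMk_right s).tendsto u₀).mono_left
      nhdsWithin_le_nhds, by
        filter_upwards [self_mem_nhdsWithin] with u' h using ⟨mem_univ _, h⟩⟩
  exact ⟨hs.self_of_nhdsWithin ⟨mem_univ _, hu₀⟩, ht'.eventually hs⟩

theorem tendsto_prodMap_extChartAt_symm (J : ModelWithCorners ℝ V H') (s₀ : ℝ) (x₀ : X) :
    Filter.Tendsto (fun p : ℝ × V => (p.1, (extChartAt J x₀).symm p.2))
      (𝓝[univ ×ˢ range J] (s₀, extChartAt J x₀ x₀)) (𝓝 (s₀, x₀)) := by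
  rw [nhdsWithin_prod_eq, nhdsWithin_univ, nhds_prod_eq]
  refine Filter.tendsto_id.prodMap ?_
  have := (continuousAt_extChartAt_symm (I := J) x₀).tendsto
  rw [extChartAt_to_inv] at this
  exact this.mono_left nhdsWithin_le_nhds

theorem mfderiv_eq_fderivWithin_extChartAt_symm {f : X → E} {x₀ : X}
    (hf : MDifferentiableAt J 𝓘(ℝ, E) f x₀) :
    (mfderiv J 𝓘(ℝ, E) f x₀ : V →L[ℝ] E) =
      fderivWithin ℝ (fun u => f ((extChartAt J x₀).symm u)) (range J) (extChartAt J x₀ x₀) :=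
  hf.mfderiv

variable [IsManifold I ∞ M] [IsManifold J ∞ X]

theorem VField.hasDerivAt_extChartAt_comp {ξ : VField I M} {γ : ℝ → M} {s : ℝ} {y₀ : M}
    (hy : γ s ∈ (chartAt H y₀).source)
    (hγ : HasMFDerivAt 𝓘(ℝ, ℝ) I γ s ((1 : ℝ →L[ℝ] ℝ).smulRight (ξ (γ s)))) :
    HasDerivAt (fun s => extChartAt I y₀ (γ s)) (ξ.inChart y₀ (extChartAt I y₀ (γ s))) s := by
  have h0 := HasMFDerivAt.comp s (mdifferentiableAt_extChartAt (I := I) hy).hasMFDerivAt hγ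
  let D : ℝ →L[ℝ] E := (mfderiv I 𝓘(ℝ, E) (extChartAt I y₀) (γ s)).comp
    ((1 : ℝ →L[ℝ] ℝ).smulRight (ξ (γ s)))
  have h1 : HasFDerivAt (fun s => extChartAt I y₀ (γ s)) D s := h0.hasFDerivAt
  refine (HasFDerivAt.hasDerivAt (F := E) h1).congr_deriv ?_
  have h2 := ξ.mfderiv_extChartAt_apply y₀ hy
  have h3 : ∀ v : E, (1 : ℝ) • v = v := one_smul ℝ
  exact (congrArg (mfderiv I 𝓘(ℝ, E) (extChartAt I y₀) _) (h3 (ξ _))).trans h2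

theorem hasDerivAt_fderivWithin_familyInChart [CompleteSpace E] {F : ℝ → X → M} {ξ : VField I M}
    (hξ : ξ.IsSmooth) {s₀ : ℝ} {x₀ : X}
    (hF : ContMDiffAt (𝓘(ℝ, ℝ).prod J) I ∞ (fun q : ℝ × X => F q.1 q.2) (s₀, x₀))
    (hflow : ∀ᶠ q : ℝ × X in 𝓝 (s₀, x₀), HasMFDerivAt 𝓘(ℝ, ℝ) I (fun s => F s q.2) q.1
      ((1 : ℝ →L[ℝ] ℝ).smulRight (ξ (F q.1 q.2)))) :
    ∀ᶠ s in 𝓝 s₀, F s x₀ ∈ (chartAt H (F s₀ x₀)).source ∧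
      MDifferentiableAt J I (F s) x₀ ∧
      HasDerivAt (fun s => familyInChart J I F x₀ (F s₀ x₀) (s, extChartAt J x₀ x₀))
        (ξ.inChart (F s₀ x₀) (familyInChart J I F x₀ (F s₀ x₀) (s, extChartAt J x₀ x₀))) s ∧
      HasDerivAt (fun s => fderivWithin ℝ (fun u => familyInChart J I F x₀ (F s₀ x₀) (s, u))
          (range J) (extChartAt J x₀ x₀))
        ((fderivWithin ℝ (ξ.inChart (F s₀ x₀)) (range I)
          (familyInChart J I F x₀ (F s₀ x₀) (s, extChartAt J x₀ x₀))).comp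
          (fderivWithin ℝ (fun u => familyInChart J I F x₀ (F s₀ x₀) (s, u))
          (range J) (extChartAt J x₀ x₀))) s := by
  set u₀ := extChartAt J x₀ x₀ with hu₀
  set y₀ := F s₀ x₀ with hy₀
  set G := familyInChart J I F x₀ y₀ with hG
  have hu₀r : u₀ ∈ range J := extend_coe_mem_range _ _
  have hu₀s : (extChartAt J x₀).symm u₀ = x₀ := extChartAt_to_inv x₀
  have hGs := contDiffWithinAt_familyInChart hF
  have e1 : ∀ᶠ p in 𝓝[univ ×ˢ range J] (s₀, u₀), ContDiffWithinAt ℝ 2 G (univ ×ˢ range J) p := by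
    have := (hGs.of_le (m := 2) ENat.LEInfty.out).eventually (by simp)
    rwa [insert_eq_of_mem (show (s₀, u₀) ∈ univ ×ˢ range J from ⟨mem_univ _, hu₀r⟩)] at this
  have e2 : ∀ᶠ q : ℝ × X in 𝓝 (s₀, x₀), F q.1 q.2 ∈ (chartAt H y₀).source :=
    hF.continuousAt.eventually ((chartAt H y₀).open_source.mem_nhds (mem_chart_source H y₀))
  have e3 : ∀ᶠ p : ℝ × V in 𝓝[univ ×ˢ range J] (s₀, u₀),
      F p.1 ((extChartAt J x₀).symm p.2) ∈ (chartAt H y₀).source ∧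
      HasDerivAt (fun s => G (s, p.2)) (ξ.inChart y₀ (G p)) p.1 := by
    filter_upwards [(tendsto_prodMap_extChartAt_symm J s₀ x₀).eventually (hflow.and e2)] with p hp
    exact ⟨hp.2, VField.hasDerivAt_extChartAt_comp hp.2 hp.1⟩
  have e4 : ∀ᶠ s in 𝓝 s₀, MDifferentiableAt J I (F s) x₀ := by
    have h1 := (contMDiffAt_iff_contMDiffAt_nhds (by simp)).1
      (hF.of_le (m := 1) ENat.LEInfty.out)
    have ht : Filter.Tendsto (fun s' : ℝ => (s', x₀)) (𝓝 s₀) (𝓝 (s₀, x₀)) :=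
      (Continuous.prodMk_left x₀).tendsto s₀
    filter_upwards [ht.eventually h1] with s hs
    exact MDifferentiableAt.comp (I' := 𝓘(ℝ, ℝ).prod J) (f := fun x => (s, x))
      (g := fun q : ℝ × X => F q.1 q.2) x₀ (hs.mdifferentiableAt (by simp))
      (mdifferentiableAt_const.prodMk mdifferentiableAt_id)
  filter_upwards [eventually_slice hu₀r (e1.and e3), e4] with s hs hs4
  obtain ⟨⟨h1, h2, h3⟩, h4⟩ := hs
  refine ⟨by rwa [hu₀s] at h2, hs4, h3, ?_⟩
  have h5 := hasDerivAt_fderivWithin_slice J.uniqueDiffOn hu₀r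
    (mem_closure_interior_range u₀ hu₀r) h1
  refine h5.congr_deriv ?_
  have h6 : (fun u => deriv (fun s => G (s, u)) s) =ᶠ[𝓝[range J] u₀]
      (ξ.inChart y₀) ∘ fun u => G (s, u) := by
    filter_upwards [h4] with u hu
    exact hu.2.2.deriv
  rw [h6.fderivWithin_eq (h6.self_of_nhdsWithin hu₀r)]
  have htar : G (s, u₀) ∈ (extChartAt I y₀).target :=
    (extChartAt I y₀).map_source (by rwa [extChartAt_source])
  exact fderivWithin_comp u₀
    ((hξ.contDiffWithinAt_inChart y₀ htar).differentiableWithinAt (by simp))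
    (hasFDerivWithinAt_slice (h1.differentiableWithinAt (by simp))).differentiableWithinAt
    (fun _ _ => extend_coe_mem_range _ _) (J.uniqueDiffOn u₀ hu₀r)

/-- The form `Ω` vanishes at `f x` as soon as its last arguments are the images of `w` under the
differential of `f`. -/
def AnnihilatesAlong {k : ℕ} (Ω : DForm I M (k + 1)) (f : X → M) (x : X)
    (w : Fin k → TangentSpace J x) : Prop :=
  ∀ ζ : TangentSpace I (f x),
    Ω (f x) (Matrix.vecCons ζ fun j => mfderiv J I f x (w j)) = 0

theorem annihilatesAlong_iff_inChart {k : ℕ} (Ω : DForm I M (k + 1)) {F : ℝ → X → M} {s : ℝ} {x₀ : X}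
    {y₀ : M} (hy : F s x₀ ∈ (chartAt H y₀).source) (hF : MDifferentiableAt J I (F s) x₀)
    (w : Fin k → TangentSpace J x₀) :
    AnnihilatesAlong Ω (F s) x₀ w ↔ ∀ ζ : E,
      Ω.inChart y₀ (familyInChart J I F x₀ y₀ (s, extChartAt J x₀ x₀)) (Matrix.vecCons ζ fun j =>
        fderivWithin ℝ (fun u => familyInChart J I F x₀ y₀ (s, u))
          (range J) (extChartAt J x₀ x₀) (w j)) = 0 := by
  have hy' : F s x₀ ∈ (extChartAt I y₀).source := by rwa [extChartAt_source]
  have hsymm : (extChartAt J x₀).symm (extChartAt J x₀ x₀) = x₀ := extChartAt_to_inv x₀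
  set c := familyInChart J I F x₀ y₀ (s, extChartAt J x₀ x₀) with hc
  have hc' : c = extChartAt I y₀ (F s x₀) := by
    rw [hc, familyInChart]
    simp only [hsymm]
  have hct : c ∈ (extChartAt I y₀).target := hc' ▸ (extChartAt I y₀).map_source hy'
  have hcs : (extChartAt I y₀).symm c = F s x₀ := by rw [hc', (extChartAt I y₀).left_inv hy']
  have h1 : ∀ v : V, fderivWithin ℝ (fun u => familyInChart J I F x₀ y₀ (s, u))
      (range J) (extChartAt J x₀ x₀) v =
      mfderiv I 𝓘(ℝ, E) (extChartAt I y₀) (F s x₀) (mfderiv J I (F s) x₀ v) := by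
    intro v
    have hd := mdifferentiableAt_extChartAt (I := I) hy
    have h2 := mfderiv_comp x₀ hd hF
    have h3 := mfderiv_eq_fderivWithin_extChartAt_symm (hd.comp x₀ hF)
    exact DFunLike.congr_fun (h3.symm.trans h2) v
  have key : ∀ y : M, y = F s x₀ → ∀ v v' : Fin (k + 1) → E, v = v' →
      (Ω y : E [⋀^Fin (k + 1)]→L[ℝ] ℝ) v = (Ω (F s x₀) : E [⋀^Fin (k + 1)]→L[ℝ] ℝ) v' := by
    rintro y rfl v _ rfl; rfl
  have h4 : ∀ v : E, (mfderivWithin 𝓘(ℝ, E) I (extChartAt I y₀).symm (range I) c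
      (mfderiv I 𝓘(ℝ, E) (extChartAt I y₀) (F s x₀) v) : E) = v := by
    intro v
    rw [hc']
    exact DFunLike.congr_fun (mfderivWithin_extChartAt_symm_comp_mfderiv_extChartAt' hy') v
  have h5 : ∀ ζ : E, Ω.inChart y₀ c (Matrix.vecCons
      ((mfderiv I 𝓘(ℝ, E) (extChartAt I y₀) (F s x₀) ζ : E)) fun j =>
        fderivWithin ℝ (fun u => familyInChart J I F x₀ y₀ (s, u))
          (range J) (extChartAt J x₀ x₀) (w j)) =
      Ω (F s x₀) (Matrix.vecCons ζ fun j => mfderiv J I (F s) x₀ (w j)) := by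
    intro ζ
    refine key _ hcs _ _ (funext fun i => ?_)
    refine Fin.cases ?_ (fun j => ?_) i
    · exact h4 ζ
    · change (mfderivWithin 𝓘(ℝ, E) I (extChartAt I y₀).symm (range I) c
        (fderivWithin ℝ (fun u => familyInChart J I F x₀ y₀ (s, u))
          (range J) (extChartAt J x₀ x₀) (w j)) : E) = _
      exact (congrArg _ (h1 (w j))).trans (h4 _)
  constructor
  · intro h ζ
    obtain ⟨ζ', rfl⟩ := (isInvertible_mfderiv_extChartAt (I := I) hy').surjective ζ
    exact (h5 ζ').trans (h ζ')
  · intro h ζ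
    exact (h5 ζ).symm.trans (h _)

/-- Along the flow of `ξ`, where `£_ξ Θ` is exact, contractions of `dΘ` stay zero. -/
theorem eventually_annihilatesAlong_iff [FiniteDimensional ℝ E] {k : ℕ} {ξ : VField I M}
    (hξ : ξ.IsSmooth) {Θ : DForm I M (k + 1)} (hΘ : Θ.IsSmooth) {α : DForm I M k}
    (hα : α.IsSmooth) (h : DForm.lieDeriv ξ Θ = α.d) {F : ℝ → X → M} {s₀ : ℝ} {x₀ : X}
    (hF : ContMDiffAt (𝓘(ℝ, ℝ).prod J) I ∞ (fun q : ℝ × X => F q.1 q.2) (s₀, x₀))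
    (hflow : ∀ᶠ q : ℝ × X in 𝓝 (s₀, x₀), HasMFDerivAt 𝓘(ℝ, ℝ) I (fun s => F s q.2) q.1
      ((1 : ℝ →L[ℝ] ℝ).smulRight (ξ (F q.1 q.2))))
    (w : Fin (k + 1) → TangentSpace J x₀) :
    ∀ᶠ s in 𝓝 s₀, (AnnihilatesAlong Θ.d (F s) x₀ w ↔ AnnihilatesAlong Θ.d (F s₀) x₀ w) := by
  have : CompleteSpace E := FiniteDimensional.complete ℝ E
  set y₀ := F s₀ x₀ with hy₀
  set u₀ := extChartAt J x₀ x₀ with hu₀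
  have hev := hasDerivAt_fderivWithin_familyInChart hξ hF hflow
  set G := familyInChart J I F x₀ y₀ with hG
  set Ω := Θ.d.inChart y₀ with hΩ
  set K : ℝ → V →L[ℝ] E := fun s => fderivWithin ℝ (fun u => G (s, u)) (range J) u₀ with hK
  let b : ℝ → E →L[ℝ] ℝ := fun s => LinearMap.toContinuousLinearMap
    { toFun := fun ζ => Ω (G (s, u₀)) (Matrix.vecCons ζ fun j => K s (w j))
      map_add' := fun ζ ζ' => (Ω (G (s, u₀))).map_vecCons_add _ _ _
      map_smul' := fun r ζ => (Ω (G (s, u₀))).map_vecCons_smul _ _ _ }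
  have hb : ∀ s ζ, b s ζ = Ω (G (s, u₀)) (Matrix.vecCons ζ fun j => K s (w j)) := fun _ _ => rfl
  have htar : ∀ s, F s x₀ ∈ (chartAt H y₀).source → G (s, u₀) ∈ (extChartAt I y₀).target := by
    intro s hs
    refine (extChartAt I y₀).map_source ?_
    rwa [hu₀, extChartAt_to_inv, extChartAt_source]
  have hA : ContinuousAt (fun s => fderivWithin ℝ (ξ.inChart y₀) (range I) (G (s, u₀))) s₀ := by
    obtain ⟨h1, -, h2, -⟩ := hev.self_of_nhds
    have h3 := ((hξ.contDiffWithinAt_inChart y₀ (htar s₀ h1)).fderivWithin_right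
      I.uniqueDiffOn (m := ∞) le_rfl (extend_coe_mem_range _ _)).continuousWithinAt
    refine ContinuousWithinAt.tendsto h3 |>.comp (tendsto_nhdsWithin_iff.2
      ⟨h2.continuousAt, Filter.Eventually.of_forall fun _ => extend_coe_mem_range _ _⟩)
  have hb' : ∀ᶠ s in 𝓝 s₀, ∀ ζ, HasDerivAt (fun s => b s ζ)
      (-(b s (fderivWithin ℝ (ξ.inChart y₀) (range I) (G (s, u₀)) ζ))) s := by
    filter_upwards [hev] with s ⟨h1, _, h2, h3⟩ ζ
    exact hasDerivAt_contraction (Ω := Ω) (R := range I) (ξ := ξ.inChart y₀)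
      (c := fun s => G (s, u₀)) (J := K)
      ((hΘ.d.contDiffWithinAt_inChart y₀ (htar s h1)).differentiableWithinAt (by simp))
      (fderivWithin_add_sum_eq_zero_of_lieDeriv_eq_d hξ hΘ hα h y₀ (htar s h1)) h2
      (Filter.Eventually.of_forall fun _ => extend_coe_mem_range _ _) h3 ζ w
  have hiff : ∀ᶠ s in 𝓝 s₀, (AnnihilatesAlong Θ.d (F s) x₀ w ↔ b s = 0) := by
    filter_upwards [hev] with s ⟨h1, h2, _⟩
    rw [annihilatesAlong_iff_inChart Θ.d h1 h2, ContinuousLinearMap.ext_iff]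
    rfl
  have hiff₀ := hiff.self_of_nhds
  filter_upwards [eventually_eq_zero_iff_of_hasDerivAt hA hb', hiff] with s h1 h2
  rw [h2, h1, hiff₀]

theorem annihilatesAlong_iff_of_flow [FiniteDimensional ℝ E] {k : ℕ} {ξ : VField I M}
    (hξ : ξ.IsSmooth) {Θ : DForm I M (k + 1)} (hΘ : Θ.IsSmooth) {α : DForm I M k}
    (hα : α.IsSmooth) (h : DForm.lieDeriv ξ Θ = α.d) {F : ℝ → X → M} {t : ℝ} {x₀ : X}
    (hF : ∀ s ∈ uIcc 0 t, ContMDiffAt (𝓘(ℝ, ℝ).prod J) I ∞ (fun q : ℝ × X => F q.1 q.2) (s, x₀))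
    (hflow : ∀ s ∈ uIcc 0 t, ∀ᶠ q : ℝ × X in 𝓝 (s, x₀),
      HasMFDerivAt 𝓘(ℝ, ℝ) I (fun s => F s q.2) q.1 ((1 : ℝ →L[ℝ] ℝ).smulRight (ξ (F q.1 q.2))))
    (w : Fin (k + 1) → TangentSpace J x₀) :
    AnnihilatesAlong Θ.d (F t) x₀ w ↔ AnnihilatesAlong Θ.d (F 0) x₀ w := by
  refine isPreconnected_uIcc.induction₂ (s := uIcc 0 t)
    (fun s s' => AnnihilatesAlong Θ.d (F s') x₀ w ↔ AnnihilatesAlong Θ.d (F s) x₀ w)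
    (fun s hs => ?_) (fun _ _ _ _ _ _ h1 h2 => h2.trans h1) (fun _ _ _ _ h1 => h1.symm)
    left_mem_uIcc right_mem_uIcc
  exact nhdsWithin_le_nhds
    (eventually_annihilatesAlong_iff hξ hΘ hα h (hF s hs) (hflow s hs) w)

end Families

end

section

section Extension

variable {E : Type*} [NormedAddCommGroup E] [NormedSpace ℝ E] [FiniteDimensional ℝ E]
  {H : Type*} [TopologicalSpace H]
  {I : ModelWithCorners ℝ E H} {M : Type*} [TopologicalSpace M] [ChartedSpace H M] [T2Space M]
  [IsManifold I ∞ M]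

theorem VField.exists_isSmooth_apply_eq (x : M) (v : TangentSpace I x) :
    ∃ ζ : VField I M, ζ.IsSmooth ∧ ζ x = v := by
  obtain ⟨s, hs, hσ⟩ := FiberBundle.exists_contMDiffOn_extend (k := ∞) I E
    (V := (TangentSpace I : M → Type _)) v
  set σ : VField I M := FiberBundle.extend E v with hσdef
  obtain ⟨f, -, hf⟩ := ((SmoothBumpFunction.nhds_basis_tsupport (I := I) x).mem_iff).1
    (interior_mem_nhds.2 hs)
  refine ⟨fun y => f y • σ y, fun y => ?_, ?_⟩
  · by_cases hy : y ∈ interior s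
    · exact (f.contMDiff y).smul_section ((hσ y (interior_subset hy)).contMDiffAt
        (mem_interior_iff_mem_nhds.1 hy))
    · have h0 : ∀ᶠ z in 𝓝 y, f z = 0 :=
        notMem_tsupport_iff_eventuallyEq.1 (fun h => hy (hf h))
      refine (Bundle.contMDiff_zeroSection ℝ (TangentSpace I : M → Type _) y).congr_of_eventuallyEq
        ?_
      filter_upwards [h0] with z hz
      simp only [hz, zero_smul]
      rfl
  · simp [σ]

end Extension

section FieldEquations

variable {n : ℕ}
  {X : Type*} [TopologicalSpace X] [ChartedSpace (EuclideanHalfSpace (n + 1)) X]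
  {E : Type*} [NormedAddCommGroup E] [NormedSpace ℝ E] {H : Type*} [TopologicalSpace H]
  {I : ModelWithCorners ℝ E H} {M : Type*} [TopologicalSpace M] [ChartedSpace H M]

theorem pullback_interior_multisymplecticForm_eq_zero_iff (Θ : DForm I M (n + 1)) (ζ : VField I M)
    (σ : X → M) (x : X) :
    ((DForm.interior ζ (multisymplecticForm Θ)).pullback σ : DForm (baseModel n) X (n + 1)) x = 0 ↔
      ∀ w : Fin (n + 1) → TangentSpace (baseModel n) x,
        Θ.d (σ x) (Matrix.vecCons (ζ (σ x)) fun j => mfderiv (baseModel n) I σ x (w j)) = 0 := by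
  rw [ContinuousAlternatingMap.ext_iff]
  exact forall_congr' fun w => neg_eq_zero

variable [IsManifold I ∞ M]

theorem SolvesFieldEquations.annihilatesAlong [FiniteDimensional ℝ E] [T2Space M] {p : M → X}
    {Θ : DForm I M (n + 1)} {U : Set X} {σ : X → M}
    (h : SolvesFieldEquations p (multisymplecticForm Θ) U σ) {x : X} (hx : x ∈ U)
    (w : Fin (n + 1) → TangentSpace (baseModel n) x) : AnnihilatesAlong Θ.d σ x w := by
  intro ζ
  obtain ⟨ζ', hζ', rfl⟩ := VField.exists_isSmooth_apply_eq (I := I) (σ x) ζ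
  exact (pullback_interior_multisymplecticForm_eq_zero_iff Θ ζ' σ x).1 (h.equation ζ' hζ' x hx) w

theorem IsLocalFlow.contMDiffAt_comp {ξ : VField I M} {D : Set (ℝ × M)} {φ : ℝ → M → M}
    (hφ : IsLocalFlow ξ D φ) {σ : X → M} {s : ℝ} {x : X} (hσ : ContMDiffAt (baseModel n) I ∞ σ x)
    (hs : (s, σ x) ∈ D) :
    ContMDiffAt (𝓘(ℝ, ℝ).prod (baseModel n)) I ∞ (fun q : ℝ × X => φ q.1 (σ q.2)) (s, x) := by
  have h1 : ContMDiffAt (𝓘(ℝ, ℝ).prod I) I ∞ (fun q : ℝ × M => φ q.1 q.2) (s, σ x) :=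
    (hφ.smooth (s, σ x) hs).contMDiffAt (hφ.isOpen.mem_nhds hs)
  exact h1.comp (g := fun q : ℝ × M => φ q.1 q.2) (f := fun q : ℝ × X => (q.1, σ q.2)) (s, x)
    (contMDiffAt_fst.prodMk (hσ.comp (s, x) contMDiffAt_snd))

theorem IsLocalFlow.eventually_mem {ξ : VField I M} {D : Set (ℝ × M)} {φ : ℝ → M → M}
    (hφ : IsLocalFlow ξ D φ) {σ : X → M} {s : ℝ} {x : X} (hσ : ContinuousAt σ x)
    (hs : (s, σ x) ∈ D) : ∀ᶠ q : ℝ × X in 𝓝 (s, x), (q.1, σ q.2) ∈ D := by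
  have h : ContinuousAt (fun q : ℝ × X => (q.1, σ q.2)) (s, x) :=
    continuousAt_fst.prodMk (ContinuousAt.comp (f := Prod.snd) (x := (s, x)) hσ continuousAt_snd)
  exact h.eventually (hφ.isOpen.mem_nhds hs)

theorem IsBaseMap.solvesFieldEquations [IsManifold (baseModel n) ∞ X] [FiniteDimensional ℝ E]
    [T2Space M] {p : M → X} {Θ : DForm I M (n + 1)} (hΘ : Θ.IsSmooth) {ξ : VField I M}
    (hξ : ξ.IsSmooth) {α : DForm I M n} (hα : α.IsSmooth) (hLie : DForm.lieDeriv ξ Θ = α.d)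
    {D : Set (ℝ × M)} {φ : ℝ → M → M} (hφ : IsLocalFlow ξ D φ) {U : Set X} {σ : X → M}
    (hσ : SolvesFieldEquations p (multisymplecticForm Θ) U σ) {t : ℝ}
    {Ψ : OpenPartialHomeomorph X X} (hΨ : IsBaseMap (n := n) p D φ U σ t Ψ) :
    SolvesFieldEquations p (multisymplecticForm Θ) Ψ.target (transform φ σ t Ψ) := by
  have hσ' : ∀ x ∈ Ψ.source, ContMDiffAt (baseModel n) I ∞ σ x := fun x hx =>
    (hσ.smooth x (hΨ.source_subset hx)).contMDiffAt (hσ.isOpen.mem_nhds (hΨ.source_subset hx))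
  have hFt : ∀ x ∈ Ψ.source, ContMDiffAt (baseModel n) I ∞ (fun x => φ t (σ x)) x := fun x hx =>
    (hφ.contMDiffAt_comp (hσ' x hx) (hΨ.mem_domain x hx)).comp
      (g := fun q : ℝ × X => φ q.1 (σ q.2)) (f := fun x => (t, x)) x
      (contMDiffAt_const.prodMk contMDiffAt_id)
  have hsymm : ∀ x ∈ Ψ.target, ContMDiffAt (baseModel n) (baseModel n) ∞ Ψ.symm x := fun x hx =>
    (hΨ.smooth_symm x hx).contMDiffAt (Ψ.open_target.mem_nhds hx)
  refine ⟨Ψ.open_target, fun x hx => ?_, fun x hx => ?_, fun ζ _ x hx => ?_⟩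
  · exact ((hFt _ (Ψ.map_target hx)).comp x (hsymm x hx)).contMDiffWithinAt
  · exact (hΨ.eq _ (Ψ.map_target hx)).symm.trans (Ψ.right_inv hx)
  · rw [pullback_interior_multisymplecticForm_eq_zero_iff]
    intro w
    set x' := Ψ.symm x with hx'
    have hxs : x' ∈ Ψ.source := Ψ.map_target hx
    have hD : ∀ s ∈ uIcc 0 t, (s, σ x') ∈ D := hφ.interval t _ (hΨ.mem_domain _ hxs)
    have h0 : (fun x => φ 0 (σ x)) =ᶠ[𝓝 x'] σ := by
      have h1 : ∀ᶠ y in 𝓝 x', ((0 : ℝ), σ y) ∈ D :=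
        (Continuous.prodMk_right (0 : ℝ)).tendsto x' |>.eventually
          (hφ.eventually_mem (hσ' _ hxs).continuousAt (hD 0 left_mem_uIcc))
      filter_upwards [h1] with y hy using hφ.zero _ hy
    have key := annihilatesAlong_iff_of_flow hξ hΘ hα hLie (F := fun s x => φ s (σ x)) (t := t)
      (x₀ := x') (fun s hs => hφ.contMDiffAt_comp (hσ' _ hxs) (hD s hs))
      (fun s hs => (hφ.eventually_mem (hσ' _ hxs).continuousAt (hD s hs)).mono
        fun q hq => hφ.hasMFDerivAt _ _ hq)
      (fun j => mfderiv (baseModel n) (baseModel n) Ψ.symm x (w j))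
    have key0 : AnnihilatesAlong Θ.d (fun x => φ 0 (σ x)) x'
        (fun j => mfderiv (baseModel n) (baseModel n) Ψ.symm x (w j)) := by
      have h2 := hσ.annihilatesAlong (hΨ.source_subset hxs)
        (fun j => mfderiv (baseModel n) (baseModel n) Ψ.symm x (w j))
      have hgen : ∀ (f : X → M), f =ᶠ[𝓝 x'] σ → ∀ w : Fin (n + 1) → TangentSpace (baseModel n) x',
          AnnihilatesAlong Θ.d σ x' w → AnnihilatesAlong Θ.d f x' w := by
        intro f hf w h ζ
        have h3 : ∀ y : M, y = σ x' → ∀ ζ : E, ∀ L : EuclideanSpace ℝ (Fin (n + 1)) →L[ℝ] E,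
            L = mfderiv (baseModel n) I σ x' →
            (Θ.d y : E [⋀^Fin (n + 2)]→L[ℝ] ℝ) (Matrix.vecCons ζ fun j => L (w j)) = 0 := by
          rintro _ rfl ζ _ rfl
          exact h ζ
        exact h3 _ hf.self_of_nhds ζ _ hf.mfderiv_eq
      exact hgen _ h0 _ h2
    have hchain : mfderiv (baseModel n) I (transform φ σ t Ψ) x =
        (mfderiv (baseModel n) I (fun x => φ t (σ x)) x').comp
          (mfderiv (baseModel n) (baseModel n) Ψ.symm x) :=
      mfderiv_comp x (g := fun x => φ t (σ x)) (f := Ψ.symm)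
        ((hFt _ hxs).mdifferentiableAt (by simp)) ((hsymm x hx).mdifferentiableAt (by simp))
    have := key.2 key0 (ζ (φ t (σ x')))
    rw [hchain]
    exact this

end FieldEquations

end

section

section IntegralCurves

variable {E : Type*} [NormedAddCommGroup E] [NormedSpace ℝ E]
  {H : Type*} [TopologicalSpace H]
  {I : ModelWithCorners ℝ E H} {M : Type*} [TopologicalSpace M] [ChartedSpace H M]
  [IsManifold I ∞ M]

/-- Uniqueness of integral curves, valid up to the boundary. -/
theorem VField.eventuallyEq_of_hasMFDerivAt [CompleteSpace E] {ξ : VField I M} (hξ : ξ.IsSmooth)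
    {γ γ' : ℝ → M} {t₀ : ℝ}
    (hγ : ∀ᶠ t in 𝓝 t₀, HasMFDerivAt 𝓘(ℝ, ℝ) I γ t ((1 : ℝ →L[ℝ] ℝ).smulRight (ξ (γ t))))
    (hγ' : ∀ᶠ t in 𝓝 t₀, HasMFDerivAt 𝓘(ℝ, ℝ) I γ' t ((1 : ℝ →L[ℝ] ℝ).smulRight (ξ (γ' t))))
    (h : γ t₀ = γ' t₀) : γ =ᶠ[𝓝 t₀] γ' := by
  set y₀ := γ t₀ with hy₀
  obtain ⟨K, S, hS, hlip⟩ := ((hξ.contDiffWithinAt_inChart y₀ (mem_extChartAt_target y₀)).of_le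
    (m := 1) ENat.LEInfty.out).exists_lipschitzOnWith I.convex_range
  have hmem : ∀ {g : ℝ → M}, (∀ᶠ t in 𝓝 t₀, HasMFDerivAt 𝓘(ℝ, ℝ) I g t
      ((1 : ℝ →L[ℝ] ℝ).smulRight (ξ (g t)))) → y₀ = g t₀ →
      (∀ᶠ t in 𝓝 t₀, g t ∈ (chartAt H y₀).source) ∧
      ∀ᶠ t in 𝓝 t₀, HasDerivAt (fun s => extChartAt I y₀ (g s))
        (ξ.inChart y₀ (extChartAt I y₀ (g t))) t ∧ extChartAt I y₀ (g t) ∈ S := by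
    intro g hg hgt
    have hc := hg.self_of_nhds.continuousAt
    have h1 : ∀ᶠ t in 𝓝 t₀, g t ∈ (chartAt H y₀).source :=
      hc.eventually ((chartAt H y₀).open_source.mem_nhds (hgt ▸ mem_chart_source H y₀))
    refine ⟨h1, ?_⟩
    have h2 : Filter.Tendsto (fun t => extChartAt I y₀ (g t)) (𝓝 t₀)
        (𝓝[range I] (extChartAt I y₀ y₀)) := by
      refine tendsto_nhdsWithin_iff.2 ⟨?_, Filter.Eventually.of_forall fun t => mem_range_self _⟩
      exact (continuousAt_extChartAt (I := I) y₀).tendsto.comp (hgt ▸ hc.tendsto)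
    filter_upwards [hg, h1, h2.eventually hS] with t ht1 ht2 ht3
    exact ⟨VField.hasDerivAt_extChartAt_comp ht2 ht1, ht3⟩
  obtain ⟨h1, h2⟩ := hmem hγ rfl
  obtain ⟨h1', h2'⟩ := hmem hγ' h
  have h3 := ODE_solution_unique_of_eventually (v := fun _ => ξ.inChart y₀) (s := fun _ => S)
    (Filter.Eventually.of_forall fun _ => hlip) h2 h2' (congrArg (extChartAt I y₀) h)
  filter_upwards [h3, h1, h1'] with t ht ht1 ht2
  exact (extChartAt I y₀).injOn (by rwa [extChartAt_source]) (by rwa [extChartAt_source]) ht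

theorem VField.eventually_mem_range [CompleteSpace E] {ξ : VField I M} (hξ : ξ.IsSmooth)
    {d : ℕ} {B : Type*} [TopologicalSpace B] [ChartedSpace (EuclideanSpace ℝ (Fin d)) B]
    [IsManifold (𝓡 d) ∞ B] {f : B → M} (hf : ContMDiff (𝓡 d) I ∞ f) {ξB : VField (𝓡 d) B}
    (hξB : ξB.IsSmooth) (hfξ : ∀ b, mfderiv (𝓡 d) I f b (ξB b) = ξ (f b)) {γ : ℝ → M} {t₀ : ℝ}
    (hγ : ∀ᶠ t in 𝓝 t₀, HasMFDerivAt 𝓘(ℝ, ℝ) I γ t ((1 : ℝ →L[ℝ] ℝ).smulRight (ξ (γ t))))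
    (h : γ t₀ ∈ range f) : ∀ᶠ t in 𝓝 t₀, γ t ∈ range f := by
  obtain ⟨b, hb⟩ := h
  obtain ⟨β, hβ0, hβ⟩ := exists_isMIntegralCurveAt_of_contMDiffAt_boundaryless (I := 𝓡 d) t₀
    ((hξB b).of_le (m := 1) ENat.LEInfty.out)
  have h1 : ∀ᶠ t in 𝓝 t₀, HasMFDerivAt 𝓘(ℝ, ℝ) I (f ∘ β) t
      ((1 : ℝ →L[ℝ] ℝ).smulRight (ξ ((f ∘ β) t))) := by
    filter_upwards [show ∀ᶠ t in 𝓝 t₀, HasMFDerivAt 𝓘(ℝ, ℝ) (𝓡 d) β t _ from hβ] with t ht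
    have h2 := HasMFDerivAt.comp t ((hf (β t)).mdifferentiableAt (by simp)).hasMFDerivAt ht
    refine h2.congr_mfderiv ?_
    ext1
    change mfderiv (𝓡 d) I f (β t) ((1 : ℝ) • ξB (β t)) = (1 : ℝ) • ξ (f (β t))
    rw [map_smul, hfξ]
  have h2 := VField.eventuallyEq_of_hasMFDerivAt hξ hγ h1 (by simp [hβ0, hb])
  filter_upwards [h2] with t ht
  exact ht ▸ mem_range_self _

/-- An integral curve of a vector field tangent to a submanifold does not leave it before it leaves
a set in which the submanifold is closed. -/
theorem VField.mem_range_iff [CompleteSpace E] {ξ : VField I M} (hξ : ξ.IsSmooth)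
    {d : ℕ} {B : Type*} [TopologicalSpace B] [ChartedSpace (EuclideanSpace ℝ (Fin d)) B]
    [IsManifold (𝓡 d) ∞ B] {f : B → M} (hf : ContMDiff (𝓡 d) I ∞ f) {ξB : VField (𝓡 d) B}
    (hξB : ξB.IsSmooth) (hfξ : ∀ b, mfderiv (𝓡 d) I f b (ξB b) = ξ (f b)) {γ : ℝ → M} {t : ℝ}
    (hγ : ∀ s ∈ uIcc 0 t, ∀ᶠ s in 𝓝 s,
      HasMFDerivAt 𝓘(ℝ, ℝ) I γ s ((1 : ℝ →L[ℝ] ℝ).smulRight (ξ (γ s))))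
    {K O : Set M} (hK : IsClosed K) (hKf : K ⊆ range f) (hO : range f ∩ O ⊆ K)
    (hγO : ∀ s ∈ uIcc 0 t, γ s ∈ O) : γ t ∈ range f ↔ γ 0 ∈ range f := by
  refine isPreconnected_uIcc.induction₂ (s := uIcc 0 t)
    (fun s s' => γ s' ∈ range f ↔ γ s ∈ range f)
    (fun s hs => ?_) (fun _ _ _ _ _ _ h1 h2 => h2.trans h1) (fun _ _ _ _ h1 => h1.symm)
    left_mem_uIcc right_mem_uIcc
  by_cases h : γ s ∈ range f
  · filter_upwards [nhdsWithin_le_nhds (VField.eventually_mem_range hξ hf hξB hfξ (hγ s hs) h)]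
      with s' hs' using iff_of_true hs' h
  · have h1 : ∀ᶠ s' in 𝓝 s, γ s' ∉ K :=
      (hγ s hs).self_of_nhds.continuousAt.eventually (hK.isOpen_compl.mem_nhds fun hk => h (hKf hk))
    filter_upwards [nhdsWithin_le_nhds h1, self_mem_nhdsWithin] with s' hs' hs''
    exact iff_of_false (fun h' => hs' (hO ⟨h', hγO s' hs''⟩)) h

end IntegralCurves

section Boundary

variable {n : ℕ}
  {X : Type*} [TopologicalSpace X] [ChartedSpace (EuclideanHalfSpace (n + 1)) X]
  [IsManifold (baseModel n) ∞ X]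
  {E : Type*} [NormedAddCommGroup E] [NormedSpace ℝ E] {H : Type*} [TopologicalSpace H]
  {I : ModelWithCorners ℝ E H} {M : Type*} [TopologicalSpace M] [ChartedSpace H M]
  {d : ℕ} {B : Type*} [TopologicalSpace B] [ChartedSpace (EuclideanSpace ℝ (Fin d)) B]

theorem mem_boundary_iff_of_contMDiffOn {Ψ : OpenPartialHomeomorph X X}
    (h : ContMDiffOn (baseModel n) (baseModel n) ∞ Ψ Ψ.source)
    (h' : ContMDiffOn (baseModel n) (baseModel n) ∞ Ψ.symm Ψ.target) {x : X} (hx : x ∈ Ψ.source) :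
    x ∈ (baseModel n).boundary X ↔ Ψ x ∈ (baseModel n).boundary X := by
  let Φ : PartialDiffeomorph (baseModel n) (baseModel n) X X ∞ :=
    { Ψ.toPartialEquiv with
      open_source := Ψ.open_source
      open_target := Ψ.open_target
      contMDiffOn_toFun := h
      contMDiffOn_invFun := h' }
  exact (Φ.isLocalDiffeomorphAt _ _ _ hx).isBoundaryPoint_iff (by simp)

theorem IsBaseMap.satisfiesBoundaryCondition {p : M → X} {Θ : DForm I M (n + 1)}
    {bc : BoundaryCondition p Θ d B} {D : Set (ℝ × M)} {φ : ℝ → M → M} {U : Set X} {σ : X → M}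
    {t : ℝ} {Ψ : OpenPartialHomeomorph X X} (hΨ : IsBaseMap (n := n) p D φ U σ t Ψ)
    (h : ∀ x ∈ Ψ.source, x ∈ (baseModel n).boundary X → φ t (σ x) ∈ range bc.incl) :
    SatisfiesBoundaryCondition bc Ψ.target (transform φ σ t Ψ) := by
  intro x hx hxb
  refine h _ (Ψ.map_target hx) ?_
  rwa [mem_boundary_iff_of_contMDiffOn hΨ.smooth hΨ.smooth_symm (Ψ.map_target hx),
    Ψ.right_inv hx]

variable [IsManifold I ∞ M] [IsManifold (𝓡 d) ∞ B]

theorem IsCartanSymmetry.mem_range_iff [CompleteSpace E] {p : M → X} {Θ : DForm I M (n + 1)}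
    {bc : BoundaryCondition p Θ d B} {ξ : VField I M} (hξ : IsCartanSymmetry bc ξ)
    {D : Set (ℝ × M)} {φ : ℝ → M → M} (hφ : IsLocalFlow ξ D φ) {t : ℝ} {z : M} (hz : (t, z) ∈ D)
    {K O : Set M} (hK : IsClosed K) (hKf : K ⊆ range bc.incl) (hO : range bc.incl ∩ O ⊆ K)
    (hγO : ∀ s ∈ uIcc 0 t, φ s z ∈ O) : φ t z ∈ range bc.incl ↔ z ∈ range bc.incl := by
  obtain ⟨ξB, hξB, hfξ, -⟩ := hξ.tangent
  have h := VField.mem_range_iff hξ.smooth bc.isSmoothEmbedding.contMDiff hξB hfξ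
    (γ := fun s => φ s z) (t := t) (fun s hs => by
      have h1 : ∀ᶠ s' in 𝓝 s, (s', z) ∈ D :=
        (Continuous.prodMk_left z).tendsto s |>.eventually
          (hφ.isOpen.mem_nhds (hφ.interval t z hz s hs))
      filter_upwards [h1] with s' hs' using hφ.hasMFDerivAt _ _ hs') hK hKf hO hγO
  rwa [hφ.zero z (hφ.interval t z hz 0 left_mem_uIcc)] at h

end Boundary

end

section

section Inverse

variable {E F : Type*} [NormedAddCommGroup E] [NormedSpace ℝ E] [CompleteSpace E]
  [NormedAddCommGroup F] [NormedSpace ℝ F]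

/-- A continuous inverse of a smooth map with invertible derivative is smooth, relatively to sets
with unique derivatives. -/
theorem contDiffOn_of_rightInverse {f : E → F} {g : F → E} {s : Set E} {t : Set F}
    (hs : UniqueDiffOn ℝ s) (ht : UniqueDiffOn ℝ t) (hf : ContDiffOn ℝ ∞ f s)
    (hg : ContinuousOn g t) (hgs : MapsTo g t s) (hfg : ∀ y ∈ t, f (g y) = y)
    (hinv : ∀ y ∈ t, (fderivWithin ℝ f s (g y)).IsInvertible) : ContDiffOn ℝ ∞ g t := by
  have hd : ∀ y ∈ t, HasFDerivWithinAt g (fderivWithin ℝ f s (g y)).inverse t y := by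
    intro y hy
    obtain ⟨f', hf'⟩ := hinv y hy
    have h1 := (hf.differentiableOn (by simp) (g y) (hgs hy)).hasFDerivWithinAt
    rw [← hf'] at h1
    rw [← hf', ContinuousLinearMap.inverse_equiv]
    exact h1.of_local_left_inverse (tendsto_nhdsWithin_iff.2
      ⟨hg y hy, eventually_mem_nhdsWithin.mono fun z hz => hgs hz⟩) hy
      (eventually_mem_nhdsWithin.mono hfg)
  have hd' : ∀ y ∈ t, fderivWithin ℝ g t y = (fderivWithin ℝ f s (g y)).inverse := fun y hy =>
    (hd y hy).fderivWithin (ht y hy)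
  refine contDiffOn_infty.2 fun k => ?_
  induction k with
  | zero => exact contDiffOn_zero.2 hg
  | succ k ih =>
    refine (contDiffOn_succ_iff_fderivWithin ht).2
      ⟨fun y hy => (hd y hy).differentiableWithinAt, fun h => (WithTop.natCast_ne_top k h).elim, ?_⟩
    refine ContDiffOn.congr (fun y hy => ?_) hd'
    exact ((hinv y hy).contDiffAt_map_inverse).comp_contDiffWithinAt y
      (((hf.fderivWithin hs (m := k) (by exact_mod_cast le_top)).comp ih hgs) y hy)

theorem isInvertible_of_norm_sub_id_lt_one {f : E →L[ℝ] E}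
    (h : ‖f - ContinuousLinearMap.id ℝ E‖ < 1) : f.IsInvertible := by
  have h1 : ‖1 - f‖ < 1 := by rw [norm_sub_rev]; exact h
  refine ⟨ContinuousLinearEquiv.unitsEquiv ℝ E (Units.oneSub (1 - f) h1), ?_⟩
  ext x
  simp

end Inverse

section HalfSpace

variable {n : ℕ}

/-- The retraction onto the half space. -/
def halfSpaceRetraction (n : ℕ) (u : EuclideanSpace ℝ (Fin (n + 1))) :
    EuclideanSpace ℝ (Fin (n + 1)) := baseModel n ((baseModel n).symm u)

theorem halfSpaceRetraction_eq (u : EuclideanSpace ℝ (Fin (n + 1))) : halfSpaceRetraction n u =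
    WithLp.toLp 2 (Function.update u 0 (max (u 0) 0)) := rfl

theorem range_baseModel (n : ℕ) : range (baseModel n) = {u | 0 ≤ u 0} :=
  range_modelWithCornersEuclideanHalfSpace (n + 1)

theorem halfSpaceRetraction_mem (u : EuclideanSpace ℝ (Fin (n + 1))) :
    halfSpaceRetraction n u ∈ range (baseModel n) := mem_range_self _

theorem halfSpaceRetraction_of_mem {u : EuclideanSpace ℝ (Fin (n + 1))}
    (hu : u ∈ range (baseModel n)) : halfSpaceRetraction n u = u :=
  (baseModel n).right_inv hu

theorem halfSpaceRetraction_apply_zero_of_neg {u : EuclideanSpace ℝ (Fin (n + 1))} (hu : u 0 < 0) :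
    halfSpaceRetraction n u 0 = 0 := by
  simp [halfSpaceRetraction_eq, hu.le]

theorem norm_halfSpaceRetraction_sub_le (u v : EuclideanSpace ℝ (Fin (n + 1))) :
    ‖halfSpaceRetraction n u - halfSpaceRetraction n v‖ ≤ ‖u - v‖ := by
  rw [EuclideanSpace.norm_eq, EuclideanSpace.norm_eq]
  refine Real.sqrt_le_sqrt (Finset.sum_le_sum fun i _ => ?_)
  gcongr
  by_cases hi : i = 0
  · subst hi
    simpa [halfSpaceRetraction_eq] using abs_max_sub_max_le_abs (u 0) (v 0) 0
  · simp [halfSpaceRetraction_eq, hi]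

open scoped NNReal in
/-- A map of a half ball which is close to the identity and preserves the boundary extends to a
homeomorphism of the ball, which preserves the complement of the half space. -/
theorem exists_openPartialHomeomorph_of_lipschitzOnWith
    {f : EuclideanSpace ℝ (Fin (n + 1)) → EuclideanSpace ℝ (Fin (n + 1))}
    {u₀ : EuclideanSpace ℝ (Fin (n + 1))} {ρ : ℝ} (hu₀ : u₀ ∈ range (baseModel n)) {c : ℝ≥0}
    (hc : c < 1)
    (hf : LipschitzOnWith c (fun u => f u - u) (Metric.ball u₀ ρ ∩ range (baseModel n)))
    (hb : ∀ u ∈ Metric.ball u₀ ρ, u 0 = 0 → f u 0 = 0) :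
    ∃ Φ : OpenPartialHomeomorph (EuclideanSpace ℝ (Fin (n + 1))) (EuclideanSpace ℝ (Fin (n + 1))),
      Φ.source = Metric.ball u₀ ρ ∧
      (∀ u ∈ range (baseModel n), Φ u = f u) ∧
      ∀ u ∈ Metric.ball u₀ ρ, Φ u ∈ range (baseModel n) → u ∈ range (baseModel n) := by
  set r := halfSpaceRetraction n with hr
  have hball : ∀ u ∈ Metric.ball u₀ ρ, r u ∈ Metric.ball u₀ ρ := by
    intro u hu
    rw [Metric.mem_ball, dist_eq_norm] at hu ⊢
    have := norm_halfSpaceRetraction_sub_le u u₀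
    rw [halfSpaceRetraction_of_mem hu₀] at this
    exact this.trans_lt hu
  let F : EuclideanSpace ℝ (Fin (n + 1)) → EuclideanSpace ℝ (Fin (n + 1)) :=
    fun u => u + (f (r u) - r u)
  have hF : ApproximatesLinearOn F
      (ContinuousLinearEquiv.refl ℝ (EuclideanSpace ℝ (Fin (n + 1))) :
        EuclideanSpace ℝ (Fin (n + 1)) →L[ℝ] EuclideanSpace ℝ (Fin (n + 1)))
      (Metric.ball u₀ ρ) c := by
    intro u hu v hv
    have h1 := lipschitzOnWith_iff_norm_sub_le.1 hf ⟨hball u hu, halfSpaceRetraction_mem u⟩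
      ⟨hball v hv, halfSpaceRetraction_mem v⟩
    have h2 : F u - F v - (u - v) = f (r u) - r u - (f (r v) - r v) := by
      simp only [F]; abel
    change ‖F u - F v - (u - v)‖ ≤ _
    rw [h2]
    exact h1.trans (mul_le_mul_of_nonneg_left (norm_halfSpaceRetraction_sub_le u v) c.2)
  have hc' : Subsingleton (EuclideanSpace ℝ (Fin (n + 1))) ∨
      c < ‖((ContinuousLinearEquiv.refl ℝ (EuclideanSpace ℝ (Fin (n + 1)))).symm :
        EuclideanSpace ℝ (Fin (n + 1)) →L[ℝ] EuclideanSpace ℝ (Fin (n + 1)))‖₊⁻¹ := by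
    right
    have : ‖((ContinuousLinearEquiv.refl ℝ (EuclideanSpace ℝ (Fin (n + 1)))).symm :
        EuclideanSpace ℝ (Fin (n + 1)) →L[ℝ] EuclideanSpace ℝ (Fin (n + 1)))‖₊ = 1 :=
      NNReal.eq ContinuousLinearMap.norm_id
    rw [this, inv_one]
    exact hc
  refine ⟨hF.toOpenPartialHomeomorph F _ hc' Metric.isOpen_ball, rfl, fun u hu => ?_,
    fun u hu h => ?_⟩
  · change u + (f (r u) - r u) = f u
    rw [hr, halfSpaceRetraction_of_mem hu]
    abel
  · rw [range_baseModel]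
    by_contra hneg
    have hneg : u 0 < 0 := not_le.1 hneg
    have h0 : r u 0 = 0 := halfSpaceRetraction_apply_zero_of_neg hneg
    have h1 : f (r u) 0 = 0 := hb _ (hball u hu) h0
    have h2 : (u + (f (r u) - r u)) 0 = u 0 := by simp [h0, h1]
    rw [range_baseModel] at h
    have h3 : 0 ≤ (u + (f (r u) - r u)) 0 := h
    rw [h2] at h3
    exact absurd h3 (not_le.2 hneg)

end HalfSpace

end

section

section LocalDiffeomorphisms

variable {n : ℕ} {X : Type*} [TopologicalSpace X] [ChartedSpace (EuclideanHalfSpace (n + 1)) X]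
  [IsManifold (baseModel n) ∞ X]

theorem mem_boundary_iff_extChartAt_apply_zero {x₀ x : X}
    (hx : x ∈ (chartAt (EuclideanHalfSpace (n + 1)) x₀).source) :
    x ∈ (baseModel n).boundary X ↔ extChartAt (baseModel n) x₀ x 0 = 0 := by
  have : IsManifold (baseModel n) 1 X := .of_le (n := ∞) ENat.LEInfty.out
  set e := chartAt (EuclideanHalfSpace (n + 1)) x₀ with he
  have h1 : (baseModel n).IsInteriorPoint x ↔ 0 < extChartAt (baseModel n) x₀ x 0 := by
    rw [(baseModel n).isInteriorPoint_iff_of_mem_atlas one_ne_zero (chart_mem_atlas _ x₀) hx]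
    have h2 := interior_range_modelWithCornersEuclideanHalfSpace (n + 1)
    constructor
    · intro h
      have := e.interior_extend_target_subset_interior_range h
      rwa [h2] at this
    · intro h
      refine e.mem_interior_extend_target (e.map_source hx) ?_
      rwa [h2]
  have h3 : 0 ≤ extChartAt (baseModel n) x₀ x 0 := by
    have : extChartAt (baseModel n) x₀ x ∈ range (baseModel n) := mem_range_self _
    rwa [range_baseModel] at this
  change (baseModel n).IsBoundaryPoint x ↔ _
  rw [(baseModel n).isBoundaryPoint_iff_not_isInteriorPoint, h1, not_lt]
  exact ⟨fun h => le_antisymm h h3, fun h => h.le⟩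

theorem exists_openPartialHomeomorph_of_norm_fderivWithin_le {f : X → X} {x₀ : X} {ρ : ℝ}
    (hball : range (baseModel n) ∩ Metric.ball (extChartAt (baseModel n) x₀ x₀) ρ ⊆
      (extChartAt (baseModel n) x₀).target)
    (hsm : ∀ u ∈ range (baseModel n) ∩ Metric.ball (extChartAt (baseModel n) x₀ x₀) ρ,
      ContMDiffAt (baseModel n) (baseModel n) ∞ f ((extChartAt (baseModel n) x₀).symm u))
    (hsrc : ∀ u ∈ range (baseModel n) ∩ Metric.ball (extChartAt (baseModel n) x₀ x₀) ρ,
      f ((extChartAt (baseModel n) x₀).symm u) ∈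
        (chartAt (EuclideanHalfSpace (n + 1)) x₀).source)
    (hder : ∀ u ∈ range (baseModel n) ∩ Metric.ball (extChartAt (baseModel n) x₀ x₀) ρ,
      ‖fderivWithin ℝ (fun u => extChartAt (baseModel n) x₀
        (f ((extChartAt (baseModel n) x₀).symm u))) (range (baseModel n)) u -
          ContinuousLinearMap.id ℝ _‖ ≤ 1 / 2)
    (hb : ∀ u ∈ range (baseModel n) ∩ Metric.ball (extChartAt (baseModel n) x₀ x₀) ρ,
      u 0 = 0 → extChartAt (baseModel n) x₀ (f ((extChartAt (baseModel n) x₀).symm u)) 0 = 0) :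
    ∃ Ψ : OpenPartialHomeomorph X X, Ψ.source = (extChartAt (baseModel n) x₀).source ∩
        extChartAt (baseModel n) x₀ ⁻¹' Metric.ball (extChartAt (baseModel n) x₀ x₀) ρ ∧
      (∀ x, Ψ x = f x) ∧ ContMDiffOn (baseModel n) (baseModel n) ∞ Ψ Ψ.source ∧
      ContMDiffOn (baseModel n) (baseModel n) ∞ Ψ.symm Ψ.target := by
  set J := baseModel n with hJ
  set e := extChartAt J x₀ with he
  set u₀ := e x₀ with hu₀
  set S := range J ∩ Metric.ball u₀ ρ with hS
  let fc : EuclideanSpace ℝ (Fin (n + 1)) → EuclideanSpace ℝ (Fin (n + 1)) :=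
    fun u => e (f (e.symm u))
  have hesrc : e.source = (chartAt (EuclideanHalfSpace (n + 1)) x₀).source := extChartAt_source J x₀
  have hSu : UniqueDiffOn ℝ S := J.uniqueDiffOn.inter Metric.isOpen_ball
  have hfc0 : ∀ u ∈ S, ContDiffWithinAt ℝ ∞ fc (range J) u := by
    intro u hu
    have h1 : e.symm u ∈ (chartAt (EuclideanHalfSpace (n + 1)) x₀).source :=
      hesrc ▸ e.map_target (hball hu)
    have h2 := ((contMDiffAt_iff_of_mem_source h1 (hsrc u hu)).1 (hsm u hu)).2
    have h3 : extChartAt J x₀ (e.symm u) = u := e.right_inv (hball hu)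
    rwa [h3] at h2
  have hfc : ContDiffOn ℝ ∞ fc S := fun u hu => (hfc0 u hu).mono inter_subset_left
  have hfd : ∀ u ∈ S, fderivWithin ℝ fc S u = fderivWithin ℝ fc (range J) u := fun u hu =>
    fderivWithin_inter (Metric.isOpen_ball.mem_nhds hu.2)
  have hder' : ∀ u ∈ S, ‖fderivWithin ℝ fc S u - ContinuousLinearMap.id ℝ _‖ ≤ 1 / 2 := fun u hu =>
    (hfd u hu).symm ▸ hder u hu
  have hlip : LipschitzOnWith (1 / 2) (fun u => fc u - u) (Metric.ball u₀ ρ ∩ range J) := by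
    rw [inter_comm]
    refine (J.convex_range.inter (convex_ball u₀ ρ)).lipschitzOnWith_of_nnnorm_hasFDerivWithin_le
      (f' := fun u => fderivWithin ℝ fc S u - ContinuousLinearMap.id ℝ _) (fun u hu => ?_)
      (fun u hu => ?_)
    · exact ((hfc.differentiableOn (by simp)) u hu).hasFDerivWithinAt.sub (hasFDerivWithinAt_id u S)
    · rw [← NNReal.coe_le_coe]
      simpa using hder' u hu
  obtain ⟨Φ, hΦs, hΦ, hΦr⟩ := exists_openPartialHomeomorph_of_lipschitzOnWith
    (mem_range_self _) (by rw [← NNReal.coe_lt_coe]; norm_num) hlip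
    (fun u hu h => hb u ⟨by rw [hJ, range_baseModel]; exact h.ge, hu⟩ h)
  set T := range J ∩ Φ.target with hT
  have hTu : UniqueDiffOn ℝ T := J.uniqueDiffOn.inter Φ.open_target
  have hgS : MapsTo Φ.symm T S := by
    intro v hv
    have h1 : Φ.symm v ∈ Metric.ball u₀ ρ := hΦs ▸ Φ.map_target hv.2
    exact ⟨hΦr _ h1 (by rw [Φ.right_inv hv.2]; exact hv.1), h1⟩
  have hfg : ∀ v ∈ T, fc (Φ.symm v) = v := fun v hv =>
    (hΦ _ (hgS hv).1).symm.trans (Φ.right_inv hv.2)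
  have hg : ContDiffOn ℝ ∞ Φ.symm T := contDiffOn_of_rightInverse hSu hTu hfc
    (Φ.continuousOn_symm.mono inter_subset_right) hgS hfg fun v hv =>
      isInvertible_of_norm_sub_id_lt_one ((hder' _ (hgS hv)).trans_lt (by norm_num))
  have hxS : ∀ x ∈ e.source ∩ e ⁻¹' Metric.ball u₀ ρ, e x ∈ S := fun x hx =>
    ⟨mem_range_self _, hx.2⟩
  have hyT : ∀ y ∈ e.source ∩ e ⁻¹' Φ.target, e y ∈ T := fun y hy => ⟨mem_range_self _, hy.2⟩
  have hef : ∀ x ∈ e.source ∩ e ⁻¹' Metric.ball u₀ ρ, e (f x) = Φ (e x) := by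
    intro x hx
    rw [hΦ _ (hxS x hx).1]
    change e (f x) = e (f (e.symm (e x)))
    rw [e.left_inv hx.1]
  have hfsrc : ∀ x ∈ e.source ∩ e ⁻¹' Metric.ball u₀ ρ, f x ∈ e.source := by
    intro x hx
    have := hsrc _ (hxS x hx)
    rw [e.left_inv hx.1] at this
    rwa [hesrc]
  have hsymm : ContMDiffOn J J ∞ (fun y => e.symm (Φ.symm (e y))) (e.source ∩ e ⁻¹' Φ.target) := by
    refine (contMDiffOn_extChartAt_symm x₀).comp (t := e.target) ?_
      fun y hy => hball (hgS (hyT y hy))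
    refine hg.contMDiffOn.comp ?_ hyT
    have h1 : ContMDiffOn J 𝓘(ℝ, EuclideanSpace ℝ (Fin (n + 1))) ∞ e e.source := by
      rw [hesrc]
      exact contMDiffOn_extChartAt
    exact h1.mono inter_subset_left
  have hfsm : ContMDiffOn J J ∞ f (e.source ∩ e ⁻¹' Metric.ball u₀ ρ) := by
    intro x hx
    have := hsm _ (hxS x hx)
    rw [e.left_inv hx.1] at this
    exact this.contMDiffWithinAt
  refine ⟨{ toFun := f
            invFun := fun y => e.symm (Φ.symm (e y))
            source := e.source ∩ e ⁻¹' Metric.ball u₀ ρ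
            target := e.source ∩ e ⁻¹' Φ.target
            map_source' := fun x hx => ⟨hfsrc x hx, ?_⟩
            map_target' := fun y hy => ?_
            left_inv' := fun x hx => ?_
            right_inv' := fun y hy => ?_
            open_source := isOpen_extChartAt_preimage' x₀ Metric.isOpen_ball
            open_target := isOpen_extChartAt_preimage' x₀ Φ.open_target
            continuousOn_toFun := hfsm.continuousOn
            continuousOn_invFun := hsymm.continuousOn }, rfl, fun _ => rfl, hfsm, hsymm⟩
  · change e (f x) ∈ Φ.target
    rw [hef x hx]
    exact Φ.map_source (hΦs ▸ hx.2)
  · have h1 := hgS (hyT y hy)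
    refine ⟨e.map_target (hball h1), ?_⟩
    change e (e.symm (Φ.symm (e y))) ∈ Metric.ball u₀ ρ
    rw [e.right_inv (hball h1)]
    exact h1.2
  · rw [hef x hx, Φ.left_inv (hΦs ▸ hx.2), e.left_inv hx.1]
  · have h1 := hgS (hyT y hy)
    refine e.injOn ?_ hy.1 (hfg _ (hyT y hy))
    rw [hesrc]
    exact hsrc _ h1

/-- A smooth family of maps which preserve the boundary, starting at the identity, consists of
diffeomorphisms of a fixed neighbourhood for small times. -/
theorem exists_diffeomorph_family {f : ℝ → X → X} {x₀ : X}
    (hf : ∀ᶠ q : ℝ × X in 𝓝 (0, x₀), ContMDiffAt (𝓘(ℝ, ℝ).prod (baseModel n)) (baseModel n) ∞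
      (fun q : ℝ × X => f q.1 q.2) q)
    (hf₀ : ∀ᶠ x in 𝓝 x₀, f 0 x = x)
    (hb : ∀ᶠ q : ℝ × X in 𝓝 (0, x₀), q.2 ∈ (baseModel n).boundary X →
      f q.1 q.2 ∈ (baseModel n).boundary X) {P : ℝ × X → Prop} (hP : ∀ᶠ q in 𝓝 (0, x₀), P q) :
    ∃ ε > 0, ∃ W : Set X, x₀ ∈ W ∧ ∀ t : ℝ, |t| < ε → (∀ x ∈ W, P (t, x)) ∧
      ∃ Ψ : OpenPartialHomeomorph X X, Ψ.source = W ∧ (∀ x, Ψ x = f t x) ∧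
        ContMDiffOn (baseModel n) (baseModel n) ∞ Ψ Ψ.source ∧
        ContMDiffOn (baseModel n) (baseModel n) ∞ Ψ.symm Ψ.target := by
  set J := baseModel n with hJ
  set e := extChartAt J x₀ with he
  set u₀ := e x₀ with hu₀
  have hu₀r : u₀ ∈ range J := mem_range_self _
  have hesrc : e.source = (chartAt (EuclideanHalfSpace (n + 1)) x₀).source := extChartAt_source J x₀
  set G := familyInChart J J f x₀ x₀ with hG
  have hx₀ : f 0 x₀ = x₀ := hf₀.self_of_nhds
  have hGs : ContDiffWithinAt ℝ ∞ G (univ ×ˢ range J) (0, u₀) := by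
    have := contDiffWithinAt_familyInChart hf.self_of_nhds
    rwa [hx₀] at this
  have hudo := uniqueDiffOn_univ_prod J.uniqueDiffOn
  have hmem : ((0 : ℝ), u₀) ∈ (univ ×ˢ range J : Set (ℝ × EuclideanSpace ℝ (Fin (n + 1)))) :=
    ⟨mem_univ _, hu₀r⟩
  have hslice : ∀ᶠ p in 𝓝[univ ×ˢ range J] ((0 : ℝ), u₀),
      fderivWithin ℝ (fun u => G (p.1, u)) (range J) p.2 =
        (fderivWithin ℝ G (univ ×ˢ range J) p).comp (ContinuousLinearMap.inr ℝ ℝ _) := by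
    have h1 := (hGs.of_le (m := 1) ENat.LEInfty.out).eventually (by simp)
    rw [insert_eq_of_mem hmem] at h1
    filter_upwards [h1, self_mem_nhdsWithin] with p hp hp'
    exact (hasFDerivWithinAt_slice (hp.differentiableWithinAt (by simp))).fderivWithin
      (J.uniqueDiffOn p.2 hp'.2)
  have hder : ∀ᶠ p in 𝓝[univ ×ˢ range J] ((0 : ℝ), u₀),
      ‖fderivWithin ℝ (fun u => G (p.1, u)) (range J) p.2 - ContinuousLinearMap.id ℝ _‖ ≤ 1 / 2 := by
    have h1 : ContinuousWithinAt (fun p => (fderivWithin ℝ G (univ ×ˢ range J) p).comp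
        (ContinuousLinearMap.inr ℝ ℝ (EuclideanSpace ℝ (Fin (n + 1)))))
        (univ ×ˢ range J) ((0 : ℝ), u₀) :=
      ((hGs.fderivWithin_right hudo (m := ∞) le_rfl hmem).continuousWithinAt).clm_comp
        continuousWithinAt_const
    have h2 : fderivWithin ℝ (fun u => G (0, u)) (range J) u₀ = ContinuousLinearMap.id ℝ _ := by
      have h3 : (fun u => G (0, u)) =ᶠ[𝓝[range J] u₀] id := by
        have h4 : Filter.Tendsto e.symm (𝓝[range J] u₀) (𝓝 x₀) := by
          have := (continuousAt_extChartAt_symm (I := J) x₀).tendsto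
          rw [extChartAt_to_inv] at this
          exact this.mono_left nhdsWithin_le_nhds
        filter_upwards [h4.eventually hf₀, extChartAt_target_mem_nhdsWithin x₀] with u h5 h6
        change e (f 0 (e.symm u)) = u
        rw [h5, e.right_inv h6]
      rw [h3.fderivWithin_eq (h3.self_of_nhdsWithin hu₀r)]
      exact fderivWithin_id (J.uniqueDiffOn u₀ hu₀r)
    have h3 := hslice.self_of_nhdsWithin hmem
    rw [h2] at h3
    have h4 : ContinuousWithinAt (fun p => ‖(fderivWithin ℝ G (univ ×ˢ range J) p).comp
        (ContinuousLinearMap.inr ℝ ℝ (EuclideanSpace ℝ (Fin (n + 1)))) -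
          ContinuousLinearMap.id ℝ _‖) (univ ×ˢ range J) ((0 : ℝ), u₀) :=
      (h1.sub continuousWithinAt_const).norm
    have h5 := h4.tendsto.eventually_lt_const (u := 1 / 2) (by rw [← h3]; simp)
    filter_upwards [h5, hslice] with p hp hp'
    rw [hp']
    exact hp.le
  have hsrc : ∀ᶠ q : ℝ × X in 𝓝 (0, x₀),
      f q.1 q.2 ∈ (chartAt (EuclideanHalfSpace (n + 1)) x₀).source :=
    hf.self_of_nhds.continuousAt.eventually ((chartAt _ x₀).open_source.mem_nhds
      (by simp only [hx₀]; exact mem_chart_source _ x₀))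
  have htar : ∀ᶠ p in 𝓝[univ ×ˢ range J] ((0 : ℝ), u₀), p.2 ∈ e.target := by
    rw [nhdsWithin_prod_eq]
    exact Filter.tendsto_snd.eventually (extChartAt_target_mem_nhdsWithin x₀)
  have hall := (htar.and hder).and ((tendsto_prodMap_extChartAt_symm J 0 x₀).eventually
    ((hf.and hsrc).and (hb.and hP)))
  obtain ⟨ε, hε, hQ⟩ := Metric.mem_nhdsWithin_iff.1 hall
  have hQ' : ∀ t : ℝ, |t| < ε → ∀ u ∈ range J ∩ Metric.ball u₀ ε, _ := fun t ht u hu =>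
    hQ (show (t, u) ∈ Metric.ball ((0 : ℝ), u₀) ε ∩ univ ×ˢ range J from
      ⟨by rw [← ball_prod_same]; exact ⟨by simpa using ht, hu.2⟩, mem_univ _, hu.1⟩)
  refine ⟨ε, hε, e.source ∩ e ⁻¹' Metric.ball u₀ ε,
    ⟨mem_extChartAt_source x₀, Metric.mem_ball_self hε⟩, fun t ht => ⟨fun x hx => ?_, ?_⟩⟩
  · have h1 := (hQ' t ht (e x) ⟨mem_range_self _, hx.2⟩).2.2.2
    change P (t, e.symm (e x)) at h1
    rwa [e.left_inv hx.1] at h1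
  · refine exists_openPartialHomeomorph_of_norm_fderivWithin_le
      (fun u hu => (hQ' t ht u ⟨hu.1, hu.2⟩).1.1) (fun u hu => ?_)
      (fun u hu => (hQ' t ht u hu).2.1.2) (fun u hu => (hQ' t ht u hu).1.2) (fun u hu h0 => ?_)
    · exact (hQ' t ht u hu).2.1.1.comp (f := fun x => (t, x)) (g := fun q : ℝ × X => f q.1 q.2) _
        (contMDiffAt_const.prodMk contMDiffAt_id)
    · have h1 := hQ' t ht u hu
      have h2 : e.symm u ∈ (chartAt (EuclideanHalfSpace (n + 1)) x₀).source :=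
        hesrc ▸ e.map_target h1.1.1
      rw [← mem_boundary_iff_extChartAt_apply_zero h1.2.1.2]
      refine h1.2.2.1 ((mem_boundary_iff_extChartAt_apply_zero h2).2 ?_)
      change e (e.symm u) 0 = 0
      rw [e.right_inv h1.1.1, h0]

end LocalDiffeomorphisms

end

section

section FlowOfSymmetries

variable {n : ℕ}
  {X : Type*} [TopologicalSpace X] [ChartedSpace (EuclideanHalfSpace (n + 1)) X]
  [IsManifold (baseModel n) ∞ X]
  {E : Type*} [NormedAddCommGroup E] [NormedSpace ℝ E] [FiniteDimensional ℝ E]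
  {H : Type*} [TopologicalSpace H]
  {I : ModelWithCorners ℝ E H} {M : Type*} [TopologicalSpace M] [ChartedSpace H M] [T2Space M]
  [IsManifold I ∞ M]
  {d : ℕ} {B : Type*} [TopologicalSpace B] [ChartedSpace (EuclideanSpace ℝ (Fin d)) B]
  [IsManifold (𝓡 d) ∞ B]

theorem IsCartanSymmetry.eventually_mem_range {p : M → X} {Θ : DForm I M (n + 1)}
    {bc : BoundaryCondition p Θ d B} {ξ : VField I M} (hξ : IsCartanSymmetry bc ξ)
    {D : Set (ℝ × M)} {φ : ℝ → M → M} (hφ : IsLocalFlow ξ D φ) {U : Set X} (hU : IsOpen U)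
    {σ : X → M} (hσ : ContMDiffOn (baseModel n) I ∞ σ U) (hbc : SatisfiesBoundaryCondition bc U σ)
    {x₀ : X} (hx₀ : x₀ ∈ U) (hD : ((0 : ℝ), σ x₀) ∈ D) :
    ∀ᶠ q : ℝ × X in 𝓝 (0, x₀), q.2 ∈ (baseModel n).boundary X →
      φ q.1 (σ q.2) ∈ range bc.incl := by
  have : CompleteSpace E := FiniteDimensional.complete ℝ E
  have hX : IsManifold (baseModel n) 1 X := .of_le (n := ∞) ENat.LEInfty.out
  have hσ' : ContMDiffAt (baseModel n) I ∞ σ x₀ := (hσ x₀ hx₀).contMDiffAt (hU.mem_nhds hx₀)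
  by_cases hb : x₀ ∈ (baseModel n).boundary X
  · obtain ⟨b₀, hb₀⟩ := hbc x₀ hx₀ hb
    have : LocallyCompactSpace B := ChartedSpace.locallyCompactSpace (EuclideanSpace ℝ (Fin d)) B
    obtain ⟨K, hK, hKb⟩ := exists_compact_mem_nhds b₀
    have hemb := bc.isSmoothEmbedding.isEmbedding
    rw [hemb.isInducing.nhds_eq_comap] at hKb
    obtain ⟨O, hO, hOK⟩ := hKb
    rw [hb₀] at hO
    have hc := (hφ.contMDiffAt_comp hσ' hD).continuousAt
    have h1 : ∀ᶠ q : ℝ × X in 𝓝 (0, x₀), φ q.1 (σ q.2) ∈ O ∧ (q.1, σ q.2) ∈ D ∧ q.2 ∈ U := by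
      refine (hc.eventually ?_).and ((hφ.eventually_mem hσ'.continuousAt hD).and
        (continuousAt_snd.eventually (hU.mem_nhds hx₀)))
      simp only [hφ.zero _ hD]
      exact hO
    obtain ⟨T, hT, N, hN, hTN⟩ := mem_nhds_prod_iff.1 h1
    obtain ⟨ε, hε, hεT⟩ := Metric.mem_nhds_iff.1 hT
    filter_upwards [prod_mem_nhds (Metric.ball_mem_nhds 0 hε) hN] with q hq hqb
    have hsub : uIcc 0 q.1 ⊆ Metric.ball 0 ε :=
      (convex_ball (0 : ℝ) ε).ordConnected.uIcc_subset (Metric.mem_ball_self hε) hq.1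
    have h2 : ∀ s ∈ uIcc 0 q.1, _ := fun s hs =>
      hTN (show (s, q.2) ∈ T ×ˢ N from ⟨hεT (hsub hs), hq.2⟩)
    have h3 := h2 q.1 right_mem_uIcc
    refine (hξ.mem_range_iff hφ h3.2.1 (hK.image hemb.continuous).isClosed (image_subset_range _ _)
      (O := O) ?_ fun s hs => (h2 s hs).1).2 (hbc _ h3.2.2 hqb)
    rintro _ ⟨⟨b, rfl⟩, hb⟩
    exact mem_image_of_mem _ (hOK hb)
  · have h1 : ∀ᶠ x in 𝓝 x₀, x ∉ (baseModel n).boundary X :=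
      ((baseModel n).isClosed_boundary (M := X) one_ne_zero).isOpen_compl.mem_nhds hb
    filter_upwards [(continuous_snd.tendsto ((0 : ℝ), x₀)).eventually h1] with q hq hq'
    exact absurd hq' hq

/-- The flow of a Cartan symmetry maps solutions to solutions. -/
theorem IsCartanSymmetry.flowPreservesSolutions {p : M → X} (hp : ContMDiff I (baseModel n) ∞ p)
    {Θ : DForm I M (n + 1)} (hΘ : Θ.IsSmooth) {bc : BoundaryCondition p Θ d B} {ξ : VField I M}
    (hξ : IsCartanSymmetry bc ξ) {D : Set (ℝ × M)} {φ : ℝ → M → M} (hφ : IsLocalFlow ξ D φ) :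
    FlowPreservesSolutions bc D φ := by
  have : CompleteSpace E := FiniteDimensional.complete ℝ E
  obtain ⟨α, hα, hLie, -⟩ := hξ.exists_potential
  rintro U σ ⟨hσ, hbc⟩
  refine ⟨fun t Ψ hΨ => ?_, fun x₀ hx₀ hD => ?_⟩
  · have h1 := hΨ.solvesFieldEquations hΘ hξ.smooth hα hLie hφ hσ
    refine ⟨h1, fun hB => ⟨h1, hΨ.satisfiesBoundaryCondition fun x hx hxb => ?_⟩⟩
    exact (hξ.mem_range_iff hφ (hΨ.mem_domain x hx) hB subset_rfl (O := univ)
      inter_subset_left fun _ _ => mem_univ _).2 (hbc x (hΨ.source_subset hx) hxb)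
  · have hσ' : ContMDiffAt (baseModel n) I ∞ σ x₀ :=
      (hσ.smooth x₀ hx₀).contMDiffAt (hσ.isOpen.mem_nhds hx₀)
    have hP : ∀ᶠ q : ℝ × X in 𝓝 (0, x₀), q.2 ∈ U ∧ (q.1, σ q.2) ∈ D ∧
        (q.2 ∈ (baseModel n).boundary X → φ q.1 (σ q.2) ∈ range bc.incl) :=
      (continuousAt_snd.eventually (hσ.isOpen.mem_nhds hx₀)).and
        ((hφ.eventually_mem hσ'.continuousAt hD).and
          (hξ.eventually_mem_range hφ hσ.isOpen hσ.smooth hbc hx₀ hD))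
    have hf : ∀ᶠ q : ℝ × X in 𝓝 (0, x₀), ContMDiffAt (𝓘(ℝ, ℝ).prod (baseModel n)) (baseModel n) ∞
        (fun q : ℝ × X => p (φ q.1 (σ q.2))) q := hP.mono fun q hq =>
      (hp _).comp q (hφ.contMDiffAt_comp
        ((hσ.smooth _ hq.1).contMDiffAt (hσ.isOpen.mem_nhds hq.1)) hq.2.1)
    have hf₀ : ∀ᶠ x in 𝓝 x₀, p (φ 0 (σ x)) = x := by
      filter_upwards [((Continuous.prodMk_right (0 : ℝ)).tendsto x₀).eventually hP] with x hx
      rw [hφ.zero _ hx.2.1, hσ.section_eq x hx.1]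
    have hb : ∀ᶠ q : ℝ × X in 𝓝 (0, x₀), q.2 ∈ (baseModel n).boundary X →
        p (φ q.1 (σ q.2)) ∈ (baseModel n).boundary X := hP.mono fun q hq hqb => by
      rw [← bc.range_proj]
      obtain ⟨b, hb⟩ := hq.2.2 hqb
      exact ⟨b, congrArg p hb⟩
    obtain ⟨ε, hε, W, hW, h⟩ :=
      exists_diffeomorph_family (f := fun t x => p (φ t (σ x))) hf hf₀ hb hP
    refine ⟨ε, hε, W, hW, fun t ht => ?_⟩
    obtain ⟨hPt, Ψ, rfl, hΨ, hs, hs'⟩ := h t ht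
    have hΨ' : IsBaseMap (n := n) p D φ U σ t Ψ :=
      ⟨fun x hx => (hPt x hx).1, fun x hx => (hPt x hx).2.1, fun x _ => hΨ x, hs, hs'⟩
    exact ⟨Ψ, rfl, hΨ', hΨ'.solvesFieldEquations hΘ hξ.smooth hα hLie hφ hσ,
      hΨ'.satisfiesBoundaryCondition fun x hx => (hPt x hx).2.2⟩

end FlowOfSymmetries

end

section

section AlternatingSmoothness

variable {F V : Type*} [NormedAddCommGroup F] [NormedSpace ℝ F] [NormedAddCommGroup V]
  [NormedSpace ℝ V] [FiniteDimensional ℝ V] {k : ℕ}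

/-- Evaluation of alternating forms, as a continuous linear map. -/
def evalForm (v : Fin k → V) : (V [⋀^Fin k]→L[ℝ] ℝ) →L[ℝ] ℝ :=
  LinearMap.toContinuousLinearMap
    { toFun := fun θ => θ v
      map_add' := fun _ _ => rfl
      map_smul' := fun _ _ => rfl }

/-- A family of alternating forms is smooth as soon as its values are. -/
theorem contDiffOn_alternating {f : F → V [⋀^Fin k]→L[ℝ] ℝ} {s : Set F}
    (h : ∀ v : Fin k → V, ContDiffOn ℝ ∞ (fun u => f u v) s) : ContDiffOn ℝ ∞ f s := by
  let b := Module.finBasis ℝ V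
  let Φ : (V [⋀^Fin k]→L[ℝ] ℝ) →L[ℝ] ((Fin k → Fin (Module.finrank ℝ V)) → ℝ) :=
    ContinuousLinearMap.pi fun i => evalForm fun j => b (i j)
  have hΦ : Function.Injective Φ := fun θ θ' hθ =>
    ContinuousAlternatingMap.toAlternatingMap_injective
      (b.ext_alternating fun i _ => congrFun hθ i)
  obtain ⟨L, hL⟩ := Φ.toLinearMap.exists_leftInverse_of_injective (LinearMap.ker_eq_bot.2 hΦ)
  have h1 : f = fun u => LinearMap.toContinuousLinearMap L (Φ (f u)) :=
    funext fun u => (LinearMap.congr_fun hL (f u)).symm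
  rw [h1]
  exact (LinearMap.toContinuousLinearMap L).contDiff.comp_contDiffOn
    (contDiffOn_pi.2 fun i => h fun j => b (i j))

end AlternatingSmoothness

section ChartDerivatives

variable {E : Type*} [NormedAddCommGroup E] [NormedSpace ℝ E] {H : Type*} [TopologicalSpace H]
  {I : ModelWithCorners ℝ E H} {M : Type*} [TopologicalSpace M] [ChartedSpace H M]

theorem chartDeriv_apply {e : OpenPartialHomeomorph M H} (he : e ∈ IsManifold.maximalAtlas I ∞ M)
    {x : M} (hx : x ∈ e.source) (v : TangentSpace I x) :
    chartDeriv he hx v = mfderiv I 𝓘(ℝ, E) (e.extend I) x v := by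
  have h1 := HasMFDerivAt.comp x (I.hasMFDerivAt (x := e x))
    ((mdiff_of_mem he).mdifferentiableAt hx).hasMFDerivAt
  have h2 : mfderiv I 𝓘(ℝ, E) (e.extend I) x = _ := h1.mfderiv
  rw [h2]
  rfl

variable [IsManifold I ∞ M]

theorem chartDeriv_mfderivWithin_extend_symm {e : OpenPartialHomeomorph M H}
    (he : e ∈ IsManifold.maximalAtlas I ∞ M) {u : E} (hu : u ∈ (e.extend I).target)
    (hx : (e.extend I).symm u ∈ e.source) (v : E) :
    chartDeriv he hx (mfderivWithin 𝓘(ℝ, E) I (e.extend I).symm (range I) u v) = v := by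
  have hur : u ∈ range I := mem_range_of_mem_extend_target hu
  have hud : UniqueMDiffWithinAt 𝓘(ℝ, E) (range I) u :=
    (uniqueDiffWithinAt_range hur).uniqueMDiffWithinAt
  have hx' : (e.extend I).symm u ∈ (e.extend I).source := (e.extend I).map_target hu
  have h1 : MDifferentiableAt I 𝓘(ℝ, E) (e.extend I) ((e.extend I).symm u) :=
    (e.contMDiffAt_extend he hx).mdifferentiableAt (by simp)
  have h2 := mfderiv_comp_mfderivWithin u h1
    ((contMDiffWithinAt_extend_symm he hu).mdifferentiableWithinAt (by simp)) hud
  have h3 : (e.extend I ∘ (e.extend I).symm) =ᶠ[𝓝[range I] u] id := by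
    filter_upwards [extend_target_mem_nhdsWithin_range hu] with w hw
    exact (e.extend I).right_inv hw
  have h4 : mfderivWithin 𝓘(ℝ, E) 𝓘(ℝ, E) (e.extend I ∘ (e.extend I).symm) (range I) u =
      ContinuousLinearMap.id ℝ E := by
    rw [h3.mfderivWithin_eq (h3.self_of_nhdsWithin hur)]
    exact mfderivWithin_id hud
  rw [chartDeriv_apply]
  exact DFunLike.congr_fun (h2.symm.trans h4) v

theorem DForm.inExtend_apply {k : ℕ} (θ : DForm I M k) {e : OpenPartialHomeomorph M H}
    (he : e ∈ IsManifold.maximalAtlas I ∞ M) {x : M} (hx : x ∈ e.source) (v : Fin k → E) :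
    θ.inExtend e (e.extend I x) v = θ x fun i => (chartDeriv he hx).symm (v i) := by
  have hx' : x ∈ (e.extend I).source := by rwa [e.extend_source]
  have key : ∀ y (hy : y ∈ e.source), y = x → ∀ w : Fin k → E,
      (∀ i, chartDeriv he hy (w i) = v i) →
      θ y w = θ x fun i => (chartDeriv he hx).symm (v i) := by
    rintro _ hy rfl w hw
    exact congrArg _ (funext fun i => ((chartDeriv he hx).symm_apply_apply (w i)).symm.trans
      (congrArg (chartDeriv he hx).symm (hw i)))
  exact key _ (by rwa [(e.extend I).left_inv hx']) ((e.extend I).left_inv hx') _ fun i =>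
    chartDeriv_mfderivWithin_extend_symm he ((e.extend I).map_source hx') _ _

end ChartDerivatives

section TotalSpaces

variable {E : Type*} [NormedAddCommGroup E] [NormedSpace ℝ E] {H : Type*} [TopologicalSpace H]
  {I : ModelWithCorners ℝ E H} {Y : Type*} [TopologicalSpace Y] [ChartedSpace H Y]
  {G : Type*} [NormedAddCommGroup G] [NormedSpace ℝ G] {P : Y → Type*}

theorem hasMFDerivAt_modelProdFst (p : ModelProd H G) :
    HasMFDerivAt (I.prod 𝓘(ℝ, G)) I (fun q : ModelProd H G => q.1) p
      (ContinuousLinearMap.fst ℝ E G) := by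
  have h3 : HasMFDerivAt (I.prod 𝓘(ℝ, G)) I (fun p : H × G => p.1) p
      (ContinuousLinearMap.fst ℝ E G) := hasMFDerivAt_fst _
  rw [chartedSpaceSelf_prod] at h3
  exact h3

theorem contMDiff_modelProdFst :
    ContMDiff (I.prod 𝓘(ℝ, G)) I ∞ (fun q : ModelProd H G => q.1) := by
  have h3 : ContMDiff (I.prod 𝓘(ℝ, G)) I ∞ (fun p : H × G => p.1) := contMDiff_fst
  rw [chartedSpaceSelf_prod] at h3
  exact h3

namespace FibreAtlas

variable (A : FibreAtlas I G P)

theorem contMDiff_fst :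
    letI := A.core.toTopologicalSpace
    letI := A.core.toChartedSpace
    ContMDiff (I.prod 𝓘(ℝ, G)) I ∞ (fun z : Σ y, P y => z.1) := by
  let _ := A.core.toTopologicalSpace
  let _ := A.core.toChartedSpace
  have _ := A.isManifold
  intro z
  have hc := A.mem_index z.1
  set e := A.chart (A.index z.1) with he
  have hsrc : (chartAt (ModelProd H G) z).source = {z | z.1 ∈ e.source} := rfl
  have h1 : ContMDiffAt (I.prod 𝓘(ℝ, G)) I ∞
      (fun z' : Σ y, P y => e.symm (chartAt (ModelProd H G) z z').1) z := by
    have h2 : ContMDiffAt I I ∞ e.symm (chartAt (ModelProd H G) z z).1 :=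
      (contMDiffOn_symm_of_mem_maximalAtlas (A.chart_mem _)).contMDiffAt
        (e.open_target.mem_nhds (e.map_source hc))
    have h3 : ContMDiffAt (I.prod 𝓘(ℝ, G)) (I.prod 𝓘(ℝ, G)) ∞ (chartAt (ModelProd H G) z) z :=
      contMDiffAt_of_mem_maximalAtlas (IsManifold.chart_mem_maximalAtlas z)
        (mem_chart_source _ z)
    exact h2.comp z ((contMDiff_modelProdFst _).comp z h3)
  refine h1.congr_of_eventuallyEq ?_
  filter_upwards [(chartAt (ModelProd H G) z).open_source.mem_nhds (mem_chart_source _ z)]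
    with z' hz'
  exact (e.left_inv hz').symm

theorem t2Space [T2Space Y] [T2Space H] :
    letI := A.core.toTopologicalSpace
    T2Space (Σ y, P y) := by
  let _ := A.core.toTopologicalSpace
  let _ := A.core.toChartedSpace
  have hc : Continuous (fun z : Σ y, P y => z.1) := A.contMDiff_fst.continuous
  have hT : T2Space (ModelProd H G) := inferInstanceAs (T2Space (H × G))
  refine ⟨fun z z' hzz' => ?_⟩
  by_cases h : z.1 = z'.1
  · let e := chartAt (ModelProd H G) z
    have hz : z ∈ e.source := mem_chart_source _ z
    have hz' : z' ∈ e.source := by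
      change z'.1 ∈ (A.chart (A.index z.1)).source
      rw [← h]
      exact A.mem_index z.1
    obtain ⟨u, v, hu, hv, hzu, hzv, huv⟩ := t2_separation fun h' => hzz' (e.injOn hz hz' h')
    exact ⟨e.source ∩ e ⁻¹' u, e.source ∩ e ⁻¹' v, e.isOpen_inter_preimage hu,
      e.isOpen_inter_preimage hv, ⟨hz, hzu⟩, ⟨hz', hzv⟩,
      (huv.preimage e).mono inter_subset_right inter_subset_right⟩
  · obtain ⟨u, v, hu, hv, hzu, hzv, huv⟩ := t2_separation h
    exact ⟨_, _, hu.preimage hc, hv.preimage hc, hzu, hzv, huv.preimage _⟩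

theorem chartDeriv_mfderiv_fst (z₀ : Σ y, P y) {u : E × G} :
    letI := A.core.toTopologicalSpace
    letI := A.core.toChartedSpace
    u ∈ (extChartAt (I.prod 𝓘(ℝ, G)) z₀).target →
    ∀ (hz : ((extChartAt (I.prod 𝓘(ℝ, G)) z₀).symm u).1 ∈ (A.chart (A.index z₀.1)).source)
      (V : E × G), chartDeriv (A.chart_mem _) hz
        (mfderiv (I.prod 𝓘(ℝ, G)) I (fun z : Σ y, P y => z.1)
          ((extChartAt (I.prod 𝓘(ℝ, G)) z₀).symm u)
          (mfderivWithin 𝓘(ℝ, E × G) (I.prod 𝓘(ℝ, G)) (extChartAt (I.prod 𝓘(ℝ, G)) z₀).symm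
            (range (I.prod 𝓘(ℝ, G))) u V)) = V.1 := by
  let _ := A.core.toTopologicalSpace
  let _ := A.core.toChartedSpace
  have _ := A.isManifold
  intro hu hz V
  set J := I.prod 𝓘(ℝ, G) with hJ
  set z := (extChartAt J z₀).symm u with hzdef
  set e := A.chart (A.index z₀.1) with he
  have hχ : chartAt (ModelProd H G) z₀ ∈ IsManifold.maximalAtlas J ∞ (Σ y, P y) :=
    IsManifold.chart_mem_maximalAtlas z₀
  have hzs : z ∈ (chartAt (ModelProd H G) z₀).source := hz
  have h1 := mfderiv_comp z ((mdiff_of_mem (A.chart_mem (A.index z₀.1))).mdifferentiableAt hz)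
    ((A.contMDiff_fst z).mdifferentiableAt (by simp))
  have h2 := (HasMFDerivAt.comp z (hasMFDerivAt_modelProdFst (I := I) (G := G)
    (chartAt (ModelProd H G) z₀ z))
    ((mdiff_of_mem hχ).mdifferentiableAt hzs).hasMFDerivAt).mfderiv
  have h3 : mfderiv J I (e ∘ fun z : Σ y, P y => z.1) z =
      mfderiv J I ((fun q : ModelProd H G => q.1) ∘ chartAt (ModelProd H G) z₀) z := by
    apply Filter.EventuallyEq.mfderiv_eq
    filter_upwards [(chartAt (ModelProd H G) z₀).open_source.mem_nhds hzs] with z' _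
    rfl
  have h4 := DFunLike.congr_fun (h1.symm.trans (h3.trans h2))
    (mfderivWithin 𝓘(ℝ, E × G) J (extChartAt J z₀).symm (range J) u V)
  refine Eq.trans h4 ?_
  exact congrArg Prod.fst (chartDeriv_mfderivWithin_extend_symm hχ hu hzs V)

end FibreAtlas

end TotalSpaces

end

section

section Lines

variable {E : Type*} [NormedAddCommGroup E] [NormedSpace ℝ E] {H : Type*} [TopologicalSpace H]
  {I : ModelWithCorners ℝ E H} {M : Type*} [TopologicalSpace M] [ChartedSpace H M]
  [IsManifold I ∞ M]

/-- The derivative of a function along a curve which is a straight line in a chart. -/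
theorem mfderiv_eq_fderivWithin_of_line {L : M → ℝ} (hL : ContMDiff I 𝓘(ℝ, ℝ) ∞ L) (z₀ : M)
    {γ : ℝ → M} {z : M} {w : TangentSpace I (γ 0)}
    (hγ : HasMFDerivAt 𝓘(ℝ, ℝ) I γ 0 ((1 : ℝ →L[ℝ] ℝ).smulRight w)) (hγ0 : γ 0 = z)
    (hs : ∀ t, γ t ∈ (extChartAt I z₀).source) {v : E}
    (hv : ∀ t : ℝ, extChartAt I z₀ (γ t) = extChartAt I z₀ z + t • v) :
    (mfderiv I 𝓘(ℝ, ℝ) L z w : ℝ) =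
      fderivWithin ℝ (fun u => L ((extChartAt I z₀).symm u)) (range I) (extChartAt I z₀ z) v := by
  subst hγ0
  have h1 : HasMFDerivAt 𝓘(ℝ, ℝ) 𝓘(ℝ, ℝ) (L ∘ γ) 0
      ((mfderiv I 𝓘(ℝ, ℝ) L (γ 0)).comp ((1 : ℝ →L[ℝ] ℝ).smulRight w)) :=
    HasMFDerivAt.comp (0 : ℝ) (((hL (γ 0)).mdifferentiableAt (by simp)).hasMFDerivAt) hγ
  let D : ℝ →L[ℝ] ℝ := (mfderiv I 𝓘(ℝ, ℝ) L (γ 0)).comp ((1 : ℝ →L[ℝ] ℝ).smulRight w)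
  have h2 : HasFDerivAt (L ∘ γ) D 0 := h1.hasFDerivAt
  have h3 : L ∘ γ = fun t : ℝ => L ((extChartAt I z₀).symm (extChartAt I z₀ (γ 0) + t • v)) := by
    funext t
    change L (γ t) = _
    rw [← hv, (extChartAt I z₀).left_inv (hs t)]
  have hLχ : DifferentiableWithinAt ℝ (fun u => L ((extChartAt I z₀).symm u)) (range I)
      (extChartAt I z₀ (γ 0)) :=
    ((hL _).comp_contMDiffWithinAt (extChartAt I z₀ (γ 0)) (contMDiffWithinAt_extChartAt_symm_range
      z₀ ((extChartAt I z₀).map_source (hs 0)))).contDiffWithinAt.differentiableWithinAt (by simp)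
  have h4 : HasDerivAt (fun t : ℝ => extChartAt I z₀ (γ 0) + t • v) v 0 := by
    simpa using ((hasDerivAt_id (0 : ℝ)).smul_const v).const_add (extChartAt I z₀ (γ 0))
  have h6 : HasFDerivWithinAt (fun u => L ((extChartAt I z₀).symm u))
      (fderivWithin ℝ (fun u => L ((extChartAt I z₀).symm u)) (range I) (extChartAt I z₀ (γ 0)))
      (range I) (extChartAt I z₀ (γ 0) + (0 : ℝ) • v) := by
    rw [zero_smul, add_zero]
    exact hLχ.hasFDerivWithinAt
  have h5 := h6.comp_hasDerivAt (0 : ℝ) h4 (Filter.Eventually.of_forall fun t => by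
    rw [← hv t]
    exact mem_range_self _)
  rw [h3] at h2
  have h9 : D 1 = _ := h2.hasDerivAt.unique h5
  exact (congrArg (mfderiv I 𝓘(ℝ, ℝ) L (γ 0)) (one_smul ℝ w)).symm.trans h9

end Lines

variable {n m : ℕ}
  {X : Type*} [TopologicalSpace X] [ChartedSpace (EuclideanHalfSpace (n + 1)) X]
  {Y : Type*} [TopologicalSpace Y] [ChartedSpace (TotalSpaceModel n m) Y]
  {π : Fibration n m X Y}

theorem Fibration.contMDiff (π : Fibration n m X Y) :
    ContMDiff (totalModel n m) (baseModel n) ∞ π.toFun := fun y =>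
  (π.chartAround y).contMDiffOn_proj.contMDiffAt
    ((π.chartAround y).tot.open_source.mem_nhds (π.mem_chartAround y))

instance : T2Space (EuclideanHalfSpace (n + 1)) :=
  inferInstanceAs (T2Space {x : EuclideanSpace ℝ (Fin (n + 1)) // 0 ≤ x 0})

instance : T2Space (TotalSpaceModel n m) :=
  inferInstanceAs (T2Space (EuclideanHalfSpace (n + 1) × EuclideanSpace ℝ (Fin m)))

theorem FibredChart.fst_totalModel_tot (c : FibredChart π) {y : Y} (hy : y ∈ c.tot.source) :
    (totalModel n m (c.tot y)).1 = c.base.extend (baseModel n) (π.toFun y) :=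
  congrArg (baseModel n) (c.fst_tot y hy)

theorem FibredChart.jetCoord_dbase (c : FibredChart π) {y : Y} (hy : y ∈ c.tot.source)
    (A : JetFiber π y) (v : TangentSpace (baseModel n) (π.toFun y)) :
    c.jetCoord hy A (c.dbase hy v) = (c.dtot hy (A.1 v)).2 := by
  change (c.dtot hy (A.1 ((c.dbase hy).symm (c.dbase hy v)))).2 = _
  rw [ContinuousLinearEquiv.symm_apply_apply]

namespace JetBundle

instance [T2Space Y] : T2Space (JetBundle π) := (jetAtlas π).t2Space

theorem contMDiff_toTotal :
    ContMDiff (jetModel n m) (totalModel n m) ∞ (toTotal : JetBundle π → Y) :=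
  (jetAtlas π).contMDiff_fst

theorem contMDiff_toBase : ContMDiff (jetModel n m) (baseModel n) ∞ (toBase : JetBundle π → X) :=
  π.contMDiff.comp contMDiff_toTotal

theorem mfderiv_toBase (z : JetBundle π) (w : TangentSpace (jetModel n m) z) :
    mfderiv (jetModel n m) (baseModel n) toBase z w =
      π.deriv z.1 (mfderiv (jetModel n m) (totalModel n m) toTotal z w) :=
  DFunLike.congr_fun (mfderiv_comp z ((π.contMDiff z.1).mdifferentiableAt (by simp))
    ((contMDiff_toTotal z).mdifferentiableAt (by simp))) w

theorem deriv_contact (z : JetBundle π) (w : TangentSpace (jetModel n m) z) :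
    π.deriv z.1 (contact z w) = 0 := by
  have h1 : π.deriv z.1 (contact z w) =
      π.deriv z.1 (mfderiv (jetModel n m) (totalModel n m) toTotal z w) -
      π.deriv z.1 (z.2.1 (mfderiv (jetModel n m) (baseModel n) toBase z w)) := map_sub _ _ _
  have h2 : π.deriv z.1 (z.2.1 (mfderiv (jetModel n m) (baseModel n) toBase z w)) =
      mfderiv (jetModel n m) (baseModel n) toBase z w := DFunLike.congr_fun z.2.2 _
  rw [h1, h2, mfderiv_toBase, sub_self]

section Coordinates

variable (z₀ : JetBundle π)

theorem mem_source_of_mem_target {u : TotalVectorModel n m ×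
      (EuclideanSpace ℝ (Fin (n + 1)) →L[ℝ] EuclideanSpace ℝ (Fin m))}
    (hu : u ∈ (extChartAt (jetModel n m) z₀).target) :
    ((extChartAt (jetModel n m) z₀).symm u).1 ∈ (π.chartAround z₀.1).tot.source := by
  have h := (extChartAt (jetModel n m) z₀).map_target hu
  rw [extChartAt_source] at h
  exact h

theorem extChartAt_apply {z : JetBundle π} (hz : z.1 ∈ (π.chartAround z₀.1).tot.source) :
    extChartAt (jetModel n m) z₀ z = (totalModel n m ((π.chartAround z₀.1).tot z.1),
      (π.chartAround z₀.1).jetCoord hz z.2) :=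
  congrArg (jetModel n m) ((jetAtlas π).totalMap_of_mem (i := π.chartAround z₀.1) hz)

variable {z₀} {u : TotalVectorModel n m ×
      (EuclideanSpace ℝ (Fin (n + 1)) →L[ℝ] EuclideanSpace ℝ (Fin m))}
    (hu : u ∈ (extChartAt (jetModel n m) z₀).target)

theorem fst_fst_eq (hu : u ∈ (extChartAt (jetModel n m) z₀).target) : u.1.1 = (π.chartAround z₀.1).base.extend (baseModel n)
    (toBase ((extChartAt (jetModel n m) z₀).symm u)) := by
  have hz := mem_source_of_mem_target z₀ hu
  have h1 := extChartAt_apply z₀ hz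
  rw [(extChartAt (jetModel n m) z₀).right_inv hu] at h1
  exact (congrArg (fun q => q.1.1) h1).trans ((π.chartAround z₀.1).fst_totalModel_tot hz)

theorem jetCoord_eq : (π.chartAround z₀.1).jetCoord (mem_source_of_mem_target z₀ hu)
    ((extChartAt (jetModel n m) z₀).symm u).2 = u.2 := by
  have h1 := extChartAt_apply z₀ (mem_source_of_mem_target z₀ hu)
  rw [(extChartAt (jetModel n m) z₀).right_inv hu] at h1
  exact (congrArg Prod.snd h1).symm

variable (z₀ u) in
/-- The tangent vector at the point with coordinates `u` whose coordinates are `V`. -/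
def coordVector (V : TotalVectorModel n m ×
      (EuclideanSpace ℝ (Fin (n + 1)) →L[ℝ] EuclideanSpace ℝ (Fin m))) :
    TangentSpace (jetModel n m) ((extChartAt (jetModel n m) z₀).symm u) :=
  mfderivWithin 𝓘(ℝ, TotalVectorModel n m ×
      (EuclideanSpace ℝ (Fin (n + 1)) →L[ℝ] EuclideanSpace ℝ (Fin m))) (jetModel n m)
    (extChartAt (jetModel n m) z₀).symm (range (jetModel n m)) u V

theorem dtot_mfderiv_toTotal (V : TotalVectorModel n m ×
      (EuclideanSpace ℝ (Fin (n + 1)) →L[ℝ] EuclideanSpace ℝ (Fin m))) :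
    (π.chartAround z₀.1).dtot (mem_source_of_mem_target z₀ hu)
      (mfderiv (jetModel n m) (totalModel n m) toTotal _ (coordVector z₀ u V)) = V.1 :=
  (jetAtlas π).chartDeriv_mfderiv_fst z₀ hu (mem_source_of_mem_target z₀ hu) V

theorem dbase_mfderiv_toBase (V : TotalVectorModel n m ×
      (EuclideanSpace ℝ (Fin (n + 1)) →L[ℝ] EuclideanSpace ℝ (Fin m))) :
    (π.chartAround z₀.1).dbase (mem_source_of_mem_target z₀ hu)
      (mfderiv (jetModel n m) (baseModel n) toBase _ (coordVector z₀ u V)) = V.1.1 := by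
  rw [mfderiv_toBase, FibredChart.dbase_deriv, dtot_mfderiv_toTotal hu]

theorem dtot_contact (V : TotalVectorModel n m ×
      (EuclideanSpace ℝ (Fin (n + 1)) →L[ℝ] EuclideanSpace ℝ (Fin m))) :
    ((π.chartAround z₀.1).dtot (mem_source_of_mem_target z₀ hu)
      (contact _ (coordVector z₀ u V))).2 = V.1.2 - u.2 V.1.1 := by
  have h1 : ((π.chartAround z₀.1).dtot (mem_source_of_mem_target z₀ hu)
      (contact _ (coordVector z₀ u V))).2 =
      ((π.chartAround z₀.1).dtot (mem_source_of_mem_target z₀ hu)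
        (mfderiv (jetModel n m) (totalModel n m) toTotal _ (coordVector z₀ u V))).2 -
      ((π.chartAround z₀.1).dtot (mem_source_of_mem_target z₀ hu)
        (((extChartAt (jetModel n m) z₀).symm u).2.1
          (mfderiv (jetModel n m) (baseModel n) toBase _ (coordVector z₀ u V)))).2 :=
    congrArg Prod.snd (map_sub _ _ _)
  have h2 := (π.chartAround z₀.1).jetCoord_dbase (mem_source_of_mem_target z₀ hu)
    ((extChartAt (jetModel n m) z₀).symm u).2
    (mfderiv (jetModel n m) (baseModel n) toBase _ (coordVector z₀ u V))
  rw [dbase_mfderiv_toBase hu V, jetCoord_eq hu] at h2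
  rw [h1, ← h2, dtot_mfderiv_toTotal hu V]

end Coordinates

theorem deriv_comp_add_smul (z : JetBundle π)
    {f : TangentSpace (baseModel n) (π.toFun z.1) →L[ℝ] TangentSpace (totalModel n m) z.1}
    (hf : (π.deriv z.1).comp f = 0) (t : ℝ) :
    (π.deriv z.1).comp (z.2.1 + t • f) = ContinuousLinearMap.id ℝ _ := by
  rw [ContinuousLinearMap.comp_add, ContinuousLinearMap.comp_smul, hf, smul_zero, add_zero]
  exact z.2.2

theorem mk_add_zero_smul (z : JetBundle π)
    {f : TangentSpace (baseModel n) (π.toFun z.1) →L[ℝ] TangentSpace (totalModel n m) z.1}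
    (hf : (π.deriv z.1).comp f = 0) :
    mk (π := π) z.1 ⟨z.2.1 + (0 : ℝ) • f, deriv_comp_add_smul z hf 0⟩ = z := by
  refine Sigma.ext rfl (heq_of_eq (Subtype.ext ?_))
  change z.2.1 + (0 : ℝ) • f = z.2.1
  rw [zero_smul, add_zero]

theorem extChartAt_mk_add_smul {z₀ z : JetBundle π}
    (hz : z.1 ∈ (π.chartAround z₀.1).tot.source)
    {f : TangentSpace (baseModel n) (π.toFun z.1) →L[ℝ] TangentSpace (totalModel n m) z.1}
    (hf : (π.deriv z.1).comp f = 0) (t : ℝ) :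
    extChartAt (jetModel n m) z₀ (mk z.1 ⟨z.2.1 + t • f, deriv_comp_add_smul z hf t⟩) =
    extChartAt (jetModel n m) z₀ z + t • ((0 : TotalVectorModel n m),
      ((ContinuousLinearMap.snd ℝ _ _).comp ((π.chartAround z₀.1).dtot hz :
          _ →L[ℝ] TotalVectorModel n m)).comp (f.comp (((π.chartAround z₀.1).dbase hz).symm :
            EuclideanSpace ℝ (Fin (n + 1)) →L[ℝ] _))) := by
  rw [extChartAt_apply z₀ hz]
  refine (extChartAt_apply z₀ (z := mk z.1 ⟨z.2.1 + t • f, deriv_comp_add_smul z hf t⟩)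
    hz).trans (Prod.ext ?_ ?_)
  · have h2 : t • (0 : TotalVectorModel n m) = 0 := smul_zero t
    change _ = _ + t • (0 : TotalVectorModel n m)
    rw [h2, add_zero]
  · exact (π.chartAround z₀.1).jetCoord_add hz z.2 f t (deriv_comp_add_smul z hf t)

theorem mfderiv_verticalLift {L : JetBundle π → ℝ} (hL : ContMDiff (jetModel n m) 𝓘(ℝ, ℝ) ∞ L)
    {z₀ z : JetBundle π} (hz : z.1 ∈ (π.chartAround z₀.1).tot.source)
    (f : TangentSpace (baseModel n) (π.toFun z.1) →L[ℝ] TangentSpace (totalModel n m) z.1)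
    (hf : (π.deriv z.1).comp f = 0) :
    (mfderiv (jetModel n m) 𝓘(ℝ, ℝ) L z (verticalLift z f) : ℝ) =
    fderivWithin ℝ (fun u => L ((extChartAt (jetModel n m) z₀).symm u)) (range (jetModel n m))
      (extChartAt (jetModel n m) z₀ z)
      (0, ((ContinuousLinearMap.snd ℝ _ _).comp ((π.chartAround z₀.1).dtot hz :
          _ →L[ℝ] TotalVectorModel n m)).comp (f.comp (((π.chartAround z₀.1).dbase hz).symm :
            EuclideanSpace ℝ (Fin (n + 1)) →L[ℝ] _))) := by
  refine mfderiv_eq_fderivWithin_of_line hL z₀ (hasMFDerivAt_verticalLift z f hf)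
    (mk_add_zero_smul z hf) (fun t => ?_) fun t => ?_
  · rw [extChartAt_source]
    exact hz
  · exact extChartAt_mk_add_smul hz hf t

end JetBundle

end

section

variable {n m : ℕ}
  {X : Type*} [TopologicalSpace X] [ChartedSpace (EuclideanHalfSpace (n + 1)) X]
  [IsManifold (baseModel n) ∞ X]
  {Y : Type*} [TopologicalSpace Y] [ChartedSpace (TotalSpaceModel n m) Y]
  {π : Fibration n m X Y}

theorem insertSum_apply {V V₁ V₂ : Type*} [NormedAddCommGroup V] [NormedSpace ℝ V]
    [NormedAddCommGroup V₁] [NormedSpace ℝ V₁] [FiniteDimensional ℝ V₁] [NormedAddCommGroup V₂]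
    [NormedSpace ℝ V₂] {k : ℕ} (η : V₁ [⋀^Fin k]→L[ℝ] ℝ) (P : V →L[ℝ] V₁) (Q : V →L[ℝ] V₂)
    (v : Fin k → V) (u : V₁) :
    insertSum η P Q v u = ∑ i, η (Function.update (fun j => P (v j)) i u) • Q (v i) := by
  change (∑ i, (η.toContinuousMultilinearMap.toContinuousLinearMap
    (fun j => P (v j)) i).smulRight (Q (v i))) u = _
  simp only [sum_apply, ContinuousLinearMap.smulRight_apply,
    ContinuousMultilinearMap.toContinuousLinearMap_apply]
  rfl

namespace JetBundle

variable {z₀ : JetBundle π} {u : TotalVectorModel n m ×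
      (EuclideanSpace ℝ (Fin (n + 1)) →L[ℝ] EuclideanSpace ℝ (Fin m))}

theorem form_toBase_eq (η : DForm (baseModel n) X (n + 1))
    (hu : u ∈ (extChartAt (jetModel n m) z₀).target) (v : Fin (n + 1) → EuclideanSpace ℝ (Fin (n + 1))) :
    η (toBase ((extChartAt (jetModel n m) z₀).symm u))
      (fun i => ((π.chartAround z₀.1).dbase (mem_source_of_mem_target z₀ hu)).symm (v i)) =
    η.inExtend (π.chartAround z₀.1).base u.1.1 v := by
  rw [fst_fst_eq hu]
  exact (η.inExtend_apply (π.chartAround z₀.1).base_mem _ v).symm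

/-- The coordinate expression of the contact components of the vertical endomorphism. -/
def insertSumCoord (η : DForm (baseModel n) X (n + 1)) (z₀ : JetBundle π)
    (V : Fin (n + 1) → TotalVectorModel n m ×
      (EuclideanSpace ℝ (Fin (n + 1)) →L[ℝ] EuclideanSpace ℝ (Fin m)))
    (u : TotalVectorModel n m ×
      (EuclideanSpace ℝ (Fin (n + 1)) →L[ℝ] EuclideanSpace ℝ (Fin m))) :
    EuclideanSpace ℝ (Fin (n + 1)) →L[ℝ] EuclideanSpace ℝ (Fin m) :=
  ∑ i, ((η.inExtend (π.chartAround z₀.1).base u.1.1).toContinuousMultilinearMap.toContinuousLinearMap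
    (fun j => (V j).1.1) i).smulRight ((V i).1.2 - u.2 (V i).1.1)

theorem insertSumCoord_apply (η : DForm (baseModel n) X (n + 1)) (z₀ : JetBundle π)
    (V : Fin (n + 1) → TotalVectorModel n m ×
      (EuclideanSpace ℝ (Fin (n + 1)) →L[ℝ] EuclideanSpace ℝ (Fin m)))
    (u : TotalVectorModel n m ×
      (EuclideanSpace ℝ (Fin (n + 1)) →L[ℝ] EuclideanSpace ℝ (Fin m)))
    (v : EuclideanSpace ℝ (Fin (n + 1))) :
    insertSumCoord η z₀ V u v = ∑ i, η.inExtend (π.chartAround z₀.1).base u.1.1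
      (Function.update (fun j => (V j).1.1) i v) • ((V i).1.2 - u.2 (V i).1.1) := by
  simp only [insertSumCoord, sum_apply, ContinuousLinearMap.smulRight_apply,
    ContinuousMultilinearMap.toContinuousLinearMap_apply]
  rfl

/-- The value of `∑ ηᵢ ⊗ wᵢ`, whose vertical lift is that of the vertical endomorphism. -/
def contactSum (η : DForm (baseModel n) X (n + 1)) (z : JetBundle π)
    (w : Fin (n + 1) → TangentSpace (jetModel n m) z) :
    TangentSpace (baseModel n) (π.toFun z.1) →L[ℝ] TangentSpace (totalModel n m) z.1 :=
  insertSum (V₁ := EuclideanSpace ℝ (Fin (n + 1))) (V₂ := TotalVectorModel n m)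
      (V := TotalVectorModel n m ×
        (EuclideanSpace ℝ (Fin (n + 1)) →L[ℝ] EuclideanSpace ℝ (Fin m)))
      (η (toBase z)) (mfderiv (jetModel n m) (baseModel n) toBase z) (contact z) w

theorem contactSum_apply (η : DForm (baseModel n) X (n + 1)) (z : JetBundle π)
    (w : Fin (n + 1) → TangentSpace (jetModel n m) z) (v : TangentSpace (baseModel n) (toBase z)) :
    contactSum η z w v = ∑ i, (η (toBase z) (Function.update
      (fun j => mfderiv (jetModel n m) (baseModel n) toBase z (w j)) i v) : ℝ) •
        contact z (w i) := by
  exact insertSum_apply (V₁ := EuclideanSpace ℝ (Fin (n + 1))) (V₂ := TotalVectorModel n m)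
      (V := TotalVectorModel n m ×
        (EuclideanSpace ℝ (Fin (n + 1)) →L[ℝ] EuclideanSpace ℝ (Fin m))) _ _ _ _ _

theorem deriv_comp_contactSum (η : DForm (baseModel n) X (n + 1)) (z : JetBundle π)
    (w : Fin (n + 1) → TangentSpace (jetModel n m) z) :
    (π.deriv z.1).comp (contactSum η z w) = 0 := by
  ext1 v
  change π.deriv z.1 (contactSum η z w v) = 0
  rw [contactSum_apply]
  refine (map_sum _ _ _).trans (Finset.sum_eq_zero fun i _ => ?_)
  exact ((π.deriv z.1).map_smul _ _).trans (by rw [deriv_contact, smul_zero])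

theorem cartanForm_apply (η : DForm (baseModel n) X (n + 1)) (L : JetBundle π → ℝ) (z : JetBundle π)
    (w : Fin (n + 1) → TangentSpace (jetModel n m) z) :
    cartanForm η L z w = L z * η (toBase z) (fun i =>
      mfderiv (jetModel n m) (baseModel n) toBase z (w i)) +
      DFunLike.coe (F := TangentSpace (jetModel n m) z →L[ℝ] ℝ) (mfderiv (jetModel n m) 𝓘(ℝ, ℝ) L z)
        (verticalLift z (contactSum η z w)) := rfl

theorem mfderiv_toBase_coordVector (hu : u ∈ (extChartAt (jetModel n m) z₀).target)
    (V : TotalVectorModel n m ×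
      (EuclideanSpace ℝ (Fin (n + 1)) →L[ℝ] EuclideanSpace ℝ (Fin m))) :
    mfderiv (jetModel n m) (baseModel n) toBase _ (coordVector z₀ u V) =
      ((π.chartAround z₀.1).dbase (mem_source_of_mem_target z₀ hu)).symm V.1.1 :=
  (ContinuousLinearEquiv.eq_symm_apply _).2 (dbase_mfderiv_toBase hu V)

theorem contactSum_coord (η : DForm (baseModel n) X (n + 1))
    (hu : u ∈ (extChartAt (jetModel n m) z₀).target) (V : Fin (n + 1) → TotalVectorModel n m ×
      (EuclideanSpace ℝ (Fin (n + 1)) →L[ℝ] EuclideanSpace ℝ (Fin m))) :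
    ((ContinuousLinearMap.snd ℝ _ _).comp
      ((π.chartAround z₀.1).dtot (mem_source_of_mem_target z₀ hu) :
          _ →L[ℝ] TotalVectorModel n m)).comp ((contactSum η _ fun i => coordVector z₀ u (V i)).comp
            (((π.chartAround z₀.1).dbase (mem_source_of_mem_target z₀ hu)).symm :
            EuclideanSpace ℝ (Fin (n + 1)) →L[ℝ] _)) = insertSumCoord η z₀ V u := by
  ext1 v
  have hsmul : ∀ (a : ℝ) (p : TotalVectorModel n m), (a • p).2 = a • p.2 := fun _ _ => rfl
  rw [insertSumCoord_apply]
  change ((π.chartAround z₀.1).dtot (mem_source_of_mem_target z₀ hu) (contactSum η _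
    (fun i => coordVector z₀ u (V i))
      (((π.chartAround z₀.1).dbase (mem_source_of_mem_target z₀ hu)).symm v))).2 = _
  rw [contactSum_apply]
  refine (congrArg Prod.snd (map_sum _ _ _)).trans (Prod.snd_sum.trans
    (Finset.sum_congr rfl fun i _ => ?_))
  refine (congrArg Prod.snd (map_smul _ _ _)).trans ((hsmul _ _).trans ?_)
  refine congrArg₂ (fun (a : ℝ) (b : EuclideanSpace ℝ (Fin m)) => a • b) ?_ (dtot_contact hu (V i))
  rw [← form_toBase_eq η hu]
  refine congrArg _ (funext fun j => ?_)
  by_cases h : j = i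
  · subst h
    rw [Function.update_self, Function.update_self]
  · rw [Function.update_of_ne h, Function.update_of_ne h]
    exact mfderiv_toBase_coordVector hu (V j)

theorem cartanForm_inChart (η : DForm (baseModel n) X (n + 1)) {L : JetBundle π → ℝ}
    (hL : ContMDiff (jetModel n m) 𝓘(ℝ, ℝ) ∞ L) (hu : u ∈ (extChartAt (jetModel n m) z₀).target)
    (V : Fin (n + 1) → TotalVectorModel n m ×
      (EuclideanSpace ℝ (Fin (n + 1)) →L[ℝ] EuclideanSpace ℝ (Fin m))) :
    (cartanForm η L).inChart z₀ u V = L ((extChartAt (jetModel n m) z₀).symm u) *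
      η.inExtend (π.chartAround z₀.1).base u.1.1 (fun i => (V i).1.1) +
      fderivWithin ℝ (fun u => L ((extChartAt (jetModel n m) z₀).symm u)) (range (jetModel n m)) u
        (0, insertSumCoord η z₀ V u) := by
  refine (cartanForm_apply η L _ fun i => coordVector z₀ u (V i)).trans ?_
  refine congrArg₂ (· + ·) (congrArg₂ (· * ·) rfl ?_) ?_
  · rw [← form_toBase_eq η hu]
    exact congrArg _ (funext fun i => mfderiv_toBase_coordVector hu (V i))
  · refine (mfderiv_verticalLift hL (mem_source_of_mem_target z₀ hu) _
      (deriv_comp_contactSum η _ _)).trans ?_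
    rw [contactSum_coord η hu V, (extChartAt (jetModel n m) z₀).right_inv hu]

end JetBundle

end

section

section Functions

variable {E : Type*} [NormedAddCommGroup E] [NormedSpace ℝ E] {H : Type*} [TopologicalSpace H]
  {I : ModelWithCorners ℝ E H} {M : Type*} [TopologicalSpace M] [ChartedSpace H M]
  [IsManifold I ∞ M]

theorem contDiffWithinAt_comp_extChartAt_symm {L : M → ℝ} (hL : ContMDiff I 𝓘(ℝ, ℝ) ∞ L) (z₀ : M)
    {u : E} (hu : u ∈ (extChartAt I z₀).target) :
    ContDiffWithinAt ℝ ∞ (fun u => L ((extChartAt I z₀).symm u)) (range I) u :=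
  ((hL _).comp_contMDiffWithinAt u
    (contMDiffWithinAt_extChartAt_symm_range z₀ hu)).contDiffWithinAt

theorem contDiffWithinAt_fderivWithin_comp_extChartAt_symm {L : M → ℝ}
    (hL : ContMDiff I 𝓘(ℝ, ℝ) ∞ L) (z₀ : M) {u : E} (hu : u ∈ (extChartAt I z₀).target) :
    ContDiffWithinAt ℝ ∞ (fderivWithin ℝ (fun u => L ((extChartAt I z₀).symm u)) (range I))
      (range I) u :=
  (contDiffWithinAt_comp_extChartAt_symm hL z₀ hu).fderivWithin_right I.uniqueDiffOn le_rfl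
    (extChartAt_target_subset_range z₀ hu)

end Functions

variable {n m : ℕ}
  {X : Type*} [TopologicalSpace X] [ChartedSpace (EuclideanHalfSpace (n + 1)) X]
  [IsManifold (baseModel n) ∞ X]
  {Y : Type*} [TopologicalSpace Y] [ChartedSpace (TotalSpaceModel n m) Y]
  {π : Fibration n m X Y}

namespace JetBundle

theorem contDiffOn_inExtend_base {η : DForm (baseModel n) X (n + 1)} (hη : η.IsSmooth)
    (z₀ : JetBundle π) : ContDiffOn ℝ ∞ (fun u : TotalVectorModel n m ×
      (EuclideanSpace ℝ (Fin (n + 1)) →L[ℝ] EuclideanSpace ℝ (Fin m)) =>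
        η.inExtend (π.chartAround z₀.1).base u.1.1) (extChartAt (jetModel n m) z₀).target := by
  intro u hu
  have hs := (π.chartAround z₀.1).maps_source _ (mem_source_of_mem_target z₀ hu)
  have h1 : u.1.1 ∈ ((π.chartAround z₀.1).base.extend (baseModel n)).target := by
    rw [fst_fst_eq hu]
    exact ((π.chartAround z₀.1).base.extend (baseModel n)).map_source
      (by rwa [OpenPartialHomeomorph.extend_source])
  have h2 := hη.contDiffWithinAt_inExtend (π.chartAround z₀.1).base_mem h1
  refine h2.comp u (contDiff_fst.comp contDiff_fst).contDiffWithinAt fun w hw => ?_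
  change w.1.1 ∈ _
  rw [fst_fst_eq hw]
  exact mem_range_self _

theorem contDiffOn_insertSumCoord {η : DForm (baseModel n) X (n + 1)} (hη : η.IsSmooth)
    (z₀ : JetBundle π) (V : Fin (n + 1) → TotalVectorModel n m ×
      (EuclideanSpace ℝ (Fin (n + 1)) →L[ℝ] EuclideanSpace ℝ (Fin m))) :
    ContDiffOn ℝ ∞ (insertSumCoord η z₀ V) (extChartAt (jetModel n m) z₀).target := by
  refine contDiffOn_clm_apply.2 fun v => ?_
  simp only [insertSumCoord_apply]
  have h1 : ∀ i, ContDiffOn ℝ ∞ (fun u : TotalVectorModel n m ×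
      (EuclideanSpace ℝ (Fin (n + 1)) →L[ℝ] EuclideanSpace ℝ (Fin m)) =>
        η.inExtend (π.chartAround z₀.1).base u.1.1 (Function.update (fun j => (V j).1.1) i v))
      (extChartAt (jetModel n m) z₀).target := fun i =>
    (evalForm (Function.update (fun j => (V j).1.1) i v)).contDiff.comp_contDiffOn (contDiffOn_inExtend_base hη z₀)
  have h2 : ∀ i, ContDiffOn ℝ ∞ (fun u : TotalVectorModel n m ×
      (EuclideanSpace ℝ (Fin (n + 1)) →L[ℝ] EuclideanSpace ℝ (Fin m)) =>
        (V i).1.2 - u.2 (V i).1.1) (extChartAt (jetModel n m) z₀).target := fun i =>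
    (contDiff_const.sub (contDiff_snd.clm_apply contDiff_const)).contDiffOn
  exact ContDiffOn.sum fun i _ => (h1 i).smul (h2 i)

theorem cartanForm_isSmooth {η : DForm (baseModel n) X (n + 1)} (hη : η.IsSmooth)
    {L : JetBundle π → ℝ} (hL : ContMDiff (jetModel n m) 𝓘(ℝ, ℝ) ∞ L) :
    (cartanForm η L).IsSmooth := by
  intro z₀
  refine contDiffOn_alternating fun V => ?_
  refine ContDiffOn.congr ?_ fun u hu => cartanForm_inChart η hL hu V
  have h1 : ContDiffOn ℝ ∞ (fun u => L ((extChartAt (jetModel n m) z₀).symm u))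
      (extChartAt (jetModel n m) z₀).target := fun u hu =>
    (contDiffWithinAt_comp_extChartAt_symm hL z₀ hu).mono (extChartAt_target_subset_range z₀)
  have h2 : ContDiffOn ℝ ∞ (fderivWithin ℝ
      (fun u => L ((extChartAt (jetModel n m) z₀).symm u)) (range (jetModel n m)))
      (extChartAt (jetModel n m) z₀).target := fun u hu =>
    (contDiffWithinAt_fderivWithin_comp_extChartAt_symm hL z₀ hu).mono
      (extChartAt_target_subset_range z₀)
  have h3 := (evalForm fun i => (V i).1.1).contDiff.comp_contDiffOn
    (contDiffOn_inExtend_base hη z₀)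
  exact (h1.mul h3).add (h2.clm_apply (contDiffOn_const.prodMk (contDiffOn_insertSumCoord hη z₀ V)))

end JetBundle

end

section

variable {n m : ℕ}
  {X : Type*} [TopologicalSpace X] [ChartedSpace (EuclideanHalfSpace (n + 1)) X]
  {Y : Type*} [TopologicalSpace Y] [ChartedSpace (TotalSpaceModel n m) Y]
  {π : Fibration n m X Y}

namespace FormBundle

theorem contMDiff_toTotal :
    ContMDiff (formModel n m) (totalModel n m) ∞ (toTotal : FormBundle π → Y) :=
  (formAtlas π).contMDiff_fst

theorem extChartAt_apply (w₀ : FormBundle π) {w : FormBundle π}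
    (hw : w.1 ∈ (π.chartAround w₀.1).tot.source) :
    extChartAt (formModel n m) w₀ w = (totalModel n m ((π.chartAround w₀.1).tot w.1),
      (π.chartAround w₀.1).formCoord hw w.2) :=
  congrArg (formModel n m) ((formAtlas π).totalMap_of_mem (i := π.chartAround w₀.1) hw)

theorem extChartAt_snd_apply (w₀ : FormBundle π) {w : FormBundle π}
    (hw : w.1 ∈ (π.chartAround w₀.1).tot.source) (v : Fin (n + 1) → TotalVectorModel n m) :
    (extChartAt (formModel n m) w₀ w).2.1 v =
      w.2.1 fun i => ((π.chartAround w₀.1).dtot hw).symm (v i) := by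
  rw [extChartAt_apply w₀ hw]
  rfl

end FormBundle

theorem dtot_congr {y₀ y₀' y y' : Y} (h₀ : y₀' = y₀) (h : y' = y)
    (hy : y ∈ (π.chartAround y₀).tot.source) (hy' : y' ∈ (π.chartAround y₀').tot.source)
    (v : TotalVectorModel n m) :
    (π.chartAround y₀').dtot hy' v = (π.chartAround y₀).dtot hy v := by
  subst h₀ h
  rfl

namespace DualJetBundle

instance [T2Space Y] : T2Space (DualJetBundle π) := (dualAtlas π).t2Space

theorem contMDiff_fst :
    ContMDiff (dualModel n m) (totalModel n m) ∞ (fun z : DualJetBundle π => z.1) :=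
  (dualAtlas π).contMDiff_fst

theorem contMDiff_toBase :
    ContMDiff (dualModel n m) (baseModel n) ∞ (toBase : DualJetBundle π → X) :=
  π.contMDiff.comp contMDiff_fst

theorem mem_source_of_mem_target (z₀ : DualJetBundle π)
    {u : TotalVectorModel n m × DualFiberModel n m}
    (hu : u ∈ (extChartAt (dualModel n m) z₀).target) :
    ((extChartAt (dualModel n m) z₀).symm u).1 ∈ (π.chartAround z₀.1).tot.source := by
  have h := (extChartAt (dualModel n m) z₀).map_target hu
  rw [extChartAt_source] at h
  exact h

end DualJetBundle

namespace IsHamiltonian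

variable {h : DualJetBundle π → FormBundle π}

theorem fst_apply (hh : IsHamiltonian h) (z : DualJetBundle π) : (h z).1 = z.1 :=
  congrArg Sigma.fst (hh.toDual_apply z)

theorem mem_source (hh : IsHamiltonian h) {z₀ : DualJetBundle π}
    {u : TotalVectorModel n m × DualFiberModel n m}
    (hu : u ∈ (extChartAt (dualModel n m) z₀).target) :
    (h ((extChartAt (dualModel n m) z₀).symm u)).1 ∈ (π.chartAround (h z₀).1).tot.source := by
  rw [hh.fst_apply, hh.fst_apply]
  exact DualJetBundle.mem_source_of_mem_target z₀ hu

theorem mfderiv_toTotal_mfderiv (hh : IsHamiltonian h) (z : DualJetBundle π)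
    (v : TangentSpace (dualModel n m) z) :
    (mfderiv (formModel n m) (totalModel n m) FormBundle.toTotal (h z)
      (mfderiv (dualModel n m) (formModel n m) h z v) : TotalVectorModel n m) =
      mfderiv (dualModel n m) (totalModel n m) (fun z : DualJetBundle π => z.1) z v := by
  have h1 := mfderiv_comp z ((FormBundle.contMDiff_toTotal (h z)).mdifferentiableAt (by simp))
    ((hh.smooth z).mdifferentiableAt (by simp))
  have key : ∀ f : DualJetBundle π → Y, f = (fun z : DualJetBundle π => z.1) →
      (mfderiv (dualModel n m) (totalModel n m) f z v : TotalVectorModel n m) =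
      mfderiv (dualModel n m) (totalModel n m) (fun z : DualJetBundle π => z.1) z v := by
    rintro _ rfl
    rfl
  exact (DFunLike.congr_fun h1 v).symm.trans (key _ (funext hh.fst_apply))

theorem hamiltonForm_inChart (hh : IsHamiltonian h) {z₀ : DualJetBundle π}
    {u : TotalVectorModel n m × DualFiberModel n m}
    (hu : u ∈ (extChartAt (dualModel n m) z₀).target)
    (V : Fin (n + 1) → TotalVectorModel n m × DualFiberModel n m) :
    (hamiltonForm h).inChart z₀ u V = (extChartAt (formModel n m) (h z₀)
      (h ((extChartAt (dualModel n m) z₀).symm u))).2.1 fun i => (V i).1 := by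
  rw [FormBundle.extChartAt_snd_apply (h z₀) (hh.mem_source hu)]
  refine congrArg (h ((extChartAt (dualModel n m) z₀).symm u)).2.1 (funext fun i => ?_)
  refine (ContinuousLinearEquiv.eq_symm_apply _).2 ?_
  refine (congrArg _ (hh.mfderiv_toTotal_mfderiv _ _)).trans ?_
  refine (dtot_congr (hh.fst_apply z₀) (hh.fst_apply _)
    (DualJetBundle.mem_source_of_mem_target z₀ hu) _ _).trans ?_
  exact (dualAtlas π).chartDeriv_mfderiv_fst z₀ hu
    (DualJetBundle.mem_source_of_mem_target z₀ hu) (V i)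

theorem hamiltonForm_isSmooth (hh : IsHamiltonian h) : (hamiltonForm h).IsSmooth := by
  intro z₀
  refine contDiffOn_alternating fun V => ?_
  refine ContDiffOn.congr ?_ fun u hu => hh.hamiltonForm_inChart hu V
  have h1 : ContMDiffOn 𝓘(ℝ, TotalVectorModel n m × DualFiberModel n m) (formModel n m) ∞
      (h ∘ (extChartAt (dualModel n m) z₀).symm) (extChartAt (dualModel n m) z₀).target :=
    hh.smooth.comp_contMDiffOn (contMDiffOn_extChartAt_symm z₀)
  have h2 := ((contMDiffOn_extChartAt (I := formModel n m) (n := ∞) (x := h z₀)).comp h1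
    fun u hu => hh.mem_source hu).contDiffOn
  exact ((evalForm fun i => (V i).1).comp ((ModelForms n m 2).subtypeL.comp
    (ContinuousLinearMap.snd ℝ (TotalVectorModel n m) (FormFiberModel n m)))).contDiff.comp_contDiffOn h2

end IsHamiltonian

end

end FieldTheory

end

theorem mainTheorem3 (n m : ℕ)
    {X : Type*} [TopologicalSpace X] [T2Space X]
    [ChartedSpace (EuclideanHalfSpace (n + 1)) X] [IsManifold (𝓡∂ (n + 1)) ∞ X]
    {Y : Type*} [TopologicalSpace Y] [T2Space Y]
    [ChartedSpace (TotalSpaceModel n m) Y]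
    [IsManifold (totalModel n m) ∞ Y]
    (π : Fibration n m X Y) :
    (∀ (η : DForm (𝓡∂ (n + 1)) X (n + 1)), IsVolumeForm η →
      ∀ (L : JetBundle π → ℝ), ContMDiff (jetModel n m) 𝓘(ℝ, ℝ) ∞ L →
      ∀ (d : ℕ) (B : Type*) [TopologicalSpace B] [ChartedSpace (EuclideanSpace ℝ (Fin d)) B]
        [IsManifold (𝓡 d) ∞ B]
        (bc : BoundaryCondition JetBundle.toBase
          (JetBundle.cartanForm η L) d B)
        (ξ : VField (jetModel n m) (JetBundle π))
        (D : Set (ℝ × JetBundle π))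
        (φ : ℝ → JetBundle π → JetBundle π),
        IsCartanSymmetry bc ξ → IsLocalFlow ξ D φ →
        FlowPreservesSolutions bc D φ) ∧
    (∀ (h : DualJetBundle π → FormBundle π),
      IsHamiltonian h →
      ∀ (d : ℕ) (B : Type*) [TopologicalSpace B] [ChartedSpace (EuclideanSpace ℝ (Fin d)) B]
        [IsManifold (𝓡 d) ∞ B]
        (bc : BoundaryCondition DualJetBundle.toBase
          (hamiltonForm h) d B)
        (ξ : VField (dualModel n m) (DualJetBundle π))
        (D : Set (ℝ × DualJetBundle π))
        (φ : ℝ → DualJetBundle π → DualJetBundle π),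
        IsCartanSymmetry bc ξ → IsLocalFlow ξ D φ →
        FlowPreservesSolutions bc D φ) := by
  refine ⟨fun η hη L hL d B _ _ _ bc ξ D φ hξ hφ => ?_, fun h hh d B _ _ _ bc ξ D φ hξ hφ => ?_⟩
  · exact IsCartanSymmetry.flowPreservesSolutions JetBundle.contMDiff_toBase
      (JetBundle.cartanForm_isSmooth hη.smooth hL) hξ hφ
  · exact IsCartanSymmetry.flowPreservesSolutions DualJetBundle.contMDiff_toBase
      hh.hamiltonForm_isSmooth hξ hφ
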